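/- Let $n$ be a non-negative integer, $\hbar>0$, $\varsigma>0$ and $1<\rho\le 2$. **Symbols.** Let $\mathcal E^\rho(\mathbb R^{2n})$ be the space of smooth functions $f:\mathbb R^{2n}\to\mathbb C$ such that for every $L>0$ $$\|f\|_L=\sup_{x,\kappa}\frac{L^{|\kappa|}\,|\partial^\kappa f(x)|}{(\kappa!)^{1-1/\rho}}\,e^{-|x/L|^\rho}<\infty,\qquad |x|=\max_j|x_j|,$$ with the topology defined by the norms $\|\cdot\|_L$, and let $\mathcal W^\rho(\mathbb R^{2n})\subset\mathcal E^\rho(\mathbb R^{2n})$ consist of the smooth $f$ with $\sup_{x,\kappa}L^{|\kappa|}(\kappa!)^{-(1-1/\rho)}(1+|x|)^N|\partial^\kappa f(x)|<\infty$ for all $L>0$, $N=0,1,2,\dots$. Write $x=(p_1,\dots,p_n;q^1,\dots,q^n)$ and $z^j=(\varsigma q^j+i\varsigma^{-1}p_j)/\sqrt2$, and write $f(z,\bar z)$ for the value of $f$ at the point with holomorphic coordinates $z\in\mathbb C^n$. The Wick star product is $$(f\star_{Wick}g)(z,\bar z)=\sum_{m\ge0}\frac{\hbar^m}{m!}\sum_{j_1,\dots,j_m=1}^n(\partial_{z^{j_1}}\cdots\partial_{z^{j_m}}f)\,(\partial_{\bar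 z_{j_1}}\cdots\partial_{\bar z_{j_m}}g)(z,\bar z).$$ **Operators.** Let $d\mu(z)=\pi^{-n}\,d(\mathrm{Re}\,z)\,d(\mathrm{Im}\,z)$, $\|z\|^2=\sum_j|z_j|^2$, and let $\mathcal F^2$ be the Fock–Bargmann space of antiholomorphic functions $\varphi(\bar z)$ on $\mathbb C^n$ with $\int|\varphi(\bar z)|^2e^{-\|z\|^2/\hbar}\,d\mu(z)<\infty$. Put $A=1/(2\hbar)$ and let $\bar E^{2,A}_\rho$ be the space of antiholomorphic functions on $\mathbb C^n$ with $|\varphi(\bar z)|\le C e^{A\|z\|^2-r\|z\|^\rho}$ for some $C,r>0$ depending on $\varphi$, with the (locally convex) inductive limit topology of the Banach spaces with norms $\|\varphi\|_r=\sup_z|\varphi(\bar z)|e^{-A\|z\|^2+r\|z\|^\rho}$, $r>0$. Then $\bar E^{2,A}_\rho\subset\mathcal F^2$. Let $\mathcal A_{\bar E^{2,A}_\rho}(\mathcal F^2)$ be the algebra of the operators in $\mathcal F^2$ that are defined on $\bar E^{2,A}_\rho$ and map it linearly and continuously into itself, with the topology of uniform convergence on bounded subsets of $\bar E^{2,A}_\rho$.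 **Claim.** The space $\mathcal E^\rho(\mathbb R^{2n})$ is an associative unital algebra under $\star_{Wick}$ (the series converging absolutely at every point), with unit the constant function $1$. The Wick correspondence, which takes $f\in\mathcal W^\rho(\mathbb R^{2n})$ to the operator $$(\mathfrak f\varphi)(\bar z)=\int\tilde f(w,\bar w)\,\bigl(e^{w\bar z}e^{-\hbar\bar w\partial_{\bar z}}\varphi\bigr)(\bar z)\,d\mu(w)=\int\tilde f(w,\bar w)\,e^{w\cdot\bar z}\varphi(\bar z-\hbar\bar w)\,d\mu(w),$$ $$\tilde f(w,\bar w)=\int f(z,\bar z)\,e^{z\cdot\bar w-\bar z\cdot w}\,d\mu(z),$$ whose integral converges absolutely for $\varphi\in\bar E^{2,A}_\rho$, has an extension to a continuous unital algebra homomorphism from $(\mathcal E^\rho(\mathbb R^{2n}),\star_{Wick})$ to $\mathcal A_{\bar E^{2,A}_\rho}(\mathcal F^2)$, and this extension is unique, even among all continuous linear maps from $\mathcal E^\rho(\mathbb R^{2n})$ to $\mathcal A_{\bar E^{2,A}_\rho}(\mathcal F^2)$ that extend the Wick correspondence. -/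

import Mathlib

open MeasureTheory
open scoped ContDiff

noncomputable section

namespace WickFock

/-! ## Partial derivatives and multi-indices on `ℝ^d` -/

section Euclid

variable {ι : Type*} [Fintype ι] [DecidableEq ι]

/-- The partial derivative `∂f/∂x_j`. -/
def pderiv (j : ι) (f : (ι → ℝ) → ℂ) : (ι → ℝ) → ℂ :=
  fun x => fderiv ℝ f x (Pi.single j 1)

/-- The derivative taken `κ j` times in the direction `j`, for all `j` in the list `l`. -/
def listDeriv (l : List ι) (κ : ι → ℕ) (f : (ι → ℝ) → ℂ) : (ι → ℝ) → ℂ :=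
  l.foldr (fun j g => (pderiv j)^[κ j] g) f

/-- The multi-index derivative `∂^κ f`. For smooth `f` the order of the coordinates
is irrelevant. -/
def mderiv (κ : ι → ℕ) (f : (ι → ℝ) → ℂ) : (ι → ℝ) → ℂ :=
  listDeriv Finset.univ.toList κ f

/-- `|κ| = ∑ κ_j`. -/
def mabs (κ : ι → ℕ) : ℕ := ∑ j, κ j

/-- `κ! = ∏ κ_j!`. -/
def mfact (κ : ι → ℕ) : ℕ := ∏ j, (κ j).factorial


/-- The space `𝓔^ρ(ℝ^d)`: smooth functions with
`|∂^κ f(x)| ≤ C_L L^{-|κ|} (κ!)^{1-1/ρ} exp(|x/L|^ρ)` for every `L > 0`.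
The norm `‖x‖` on `ι → ℝ` is `max_j |x_j|`. -/
def MemE (ρ : ℝ) (f : (ι → ℝ) → ℂ) : Prop :=
  ContDiff ℝ ∞ f ∧ ∀ L : ℝ, 0 < L → ∃ C : ℝ, ∀ (κ : ι → ℕ) (x : ι → ℝ),
    ‖mderiv κ f x‖ ≤ C * (L ^ mabs κ)⁻¹ * (mfact κ : ℝ) ^ (1 - 1 / ρ) *
      Real.exp ((‖x‖ / L) ^ ρ)

/-- The space `𝓦^ρ(ℝ^d)`: smooth functions with
`|∂^κ f(x)| ≤ C_{N,L} L^{-|κ|} (κ!)^{1-1/ρ} (1+|x|)^{-N}` for all `L > 0`, `N = 0, 1, 2, …`. -/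
def MemW (ρ : ℝ) (f : (ι → ℝ) → ℂ) : Prop :=
  ContDiff ℝ ∞ f ∧ ∀ L : ℝ, 0 < L → ∀ N : ℕ, ∃ C : ℝ, ∀ (κ : ι → ℕ) (x : ι → ℝ),
    ‖mderiv κ f x‖ ≤ C * (L ^ mabs κ)⁻¹ * (mfact κ : ℝ) ^ (1 - 1 / ρ) * ((1 + ‖x‖) ^ N)⁻¹

theorem pderiv_smooth (j : ι) {f : (ι → ℝ) → ℂ} (hf : ContDiff ℝ ∞ f) :
    ContDiff ℝ ∞ (pderiv j f) :=
  (hf.fderiv_right (m := ∞) (by simp)).clm_apply contDiff_const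

theorem pderiv_add (j : ι) {f g : (ι → ℝ) → ℂ} (hf : ContDiff ℝ ∞ f) (hg : ContDiff ℝ ∞ g) :
    pderiv j (f + g) = pderiv j f + pderiv j g := by
  funext x
  have h1 := (hf.differentiable (by simp)) x
  have h2 := (hg.differentiable (by simp)) x
  simp [pderiv, fderiv_add h1 h2]

theorem pderiv_smul (j : ι) (c : ℂ) {f : (ι → ℝ) → ℂ} (hf : ContDiff ℝ ∞ f) :
    pderiv j (c • f) = c • pderiv j f := by
  funext x
  have h1 := (hf.differentiable (by simp)) x
  simp [pderiv, fderiv_const_smul h1 c]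

theorem iter_smooth (j : ι) (k : ℕ) {f : (ι → ℝ) → ℂ} (hf : ContDiff ℝ ∞ f) :
    ContDiff ℝ ∞ ((pderiv j)^[k] f) := by
  induction k with
  | zero => simpa using hf
  | succ k ih => rw [Function.iterate_succ_apply']; exact pderiv_smooth j ih

theorem iter_add (j : ι) (k : ℕ) {f g : (ι → ℝ) → ℂ} (hf : ContDiff ℝ ∞ f)
    (hg : ContDiff ℝ ∞ g) :
    (pderiv j)^[k] (f + g) = (pderiv j)^[k] f + (pderiv j)^[k] g := by
  induction k with
  | zero => rfl
  | succ k ih =>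
    simp only [Function.iterate_succ_apply', ih]
    exact pderiv_add j (iter_smooth j k hf) (iter_smooth j k hg)

theorem iter_smul (j : ι) (k : ℕ) (c : ℂ) {f : (ι → ℝ) → ℂ} (hf : ContDiff ℝ ∞ f) :
    (pderiv j)^[k] (c • f) = c • (pderiv j)^[k] f := by
  induction k with
  | zero => rfl
  | succ k ih =>
    simp only [Function.iterate_succ_apply', ih]
    exact pderiv_smul j c (iter_smooth j k hf)

theorem listDeriv_smooth (l : List ι) (κ : ι → ℕ) {f : (ι → ℝ) → ℂ} (hf : ContDiff ℝ ∞ f) :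
    ContDiff ℝ ∞ (listDeriv l κ f) := by
  induction l with
  | nil => exact hf
  | cons j l ih => exact iter_smooth j (κ j) ih

theorem mderiv_add (κ : ι → ℕ) {f g : (ι → ℝ) → ℂ} (hf : ContDiff ℝ ∞ f)
    (hg : ContDiff ℝ ∞ g) : mderiv κ (f + g) = mderiv κ f + mderiv κ g := by
  have : ∀ l : List ι, listDeriv l κ (f + g) = listDeriv l κ f + listDeriv l κ g := by
    intro l
    induction l with
    | nil => rfl
    | cons j l ih =>
      change (pderiv j)^[κ j] (listDeriv l κ (f + g)) = _
      rw [ih]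
      exact iter_add j (κ j) (listDeriv_smooth l κ hf) (listDeriv_smooth l κ hg)
  exact this _

theorem mderiv_smul (κ : ι → ℕ) (c : ℂ) {f : (ι → ℝ) → ℂ} (hf : ContDiff ℝ ∞ f) :
    mderiv κ (c • f) = c • mderiv κ f := by
  have : ∀ l : List ι, listDeriv l κ (c • f) = c • listDeriv l κ f := by
    intro l
    induction l with
    | nil => rfl
    | cons j l ih =>
      change (pderiv j)^[κ j] (listDeriv l κ (c • f)) = _
      rw [ih]
      exact iter_smul j (κ j) c (listDeriv_smooth l κ hf)
  exact this _

theorem MemE.add {ρ : ℝ} {f g : (ι → ℝ) → ℂ} (hf : MemE ρ f) (hg : MemE ρ g) :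
    MemE ρ (f + g) := by
  refine ⟨hf.1.add hg.1, fun L hL => ?_⟩
  obtain ⟨C, hC⟩ := hf.2 L hL
  obtain ⟨D, hD⟩ := hg.2 L hL
  refine ⟨C + D, fun κ x => ?_⟩
  rw [mderiv_add κ hf.1 hg.1, Pi.add_apply]
  refine (norm_add_le _ _).trans ((add_le_add (hC κ x) (hD κ x)).trans (le_of_eq ?_))
  ring

theorem MemE.smul {ρ : ℝ} (c : ℂ) {f : (ι → ℝ) → ℂ} (hf : MemE ρ f) : MemE ρ (c • f) := by
  refine ⟨hf.1.const_smul c, fun L hL => ?_⟩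
  obtain ⟨C, hC⟩ := hf.2 L hL
  refine ⟨‖c‖ * C, fun κ x => ?_⟩
  rw [mderiv_smul κ c hf.1, Pi.smul_apply, norm_smul]
  refine (mul_le_mul_of_nonneg_left (hC κ x) (norm_nonneg c)).trans (le_of_eq ?_)
  ring

theorem memE_zero (ρ : ℝ) : MemE ρ (0 : (ι → ℝ) → ℂ) := by
  refine ⟨contDiff_const, fun L _ => ⟨0, fun κ x => ?_⟩⟩
  have h := mderiv_smul κ 0 (f := (0 : (ι → ℝ) → ℂ)) contDiff_const
  rw [zero_smul, zero_smul] at h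
  simp [h]

/-- `𝓦^ρ ⊆ 𝓔^ρ`. -/
theorem MemW.memE {ρ : ℝ} {f : (ι → ℝ) → ℂ} (hf : MemW ρ f) : MemE ρ f := by
  refine ⟨hf.1, fun L hL => ?_⟩
  obtain ⟨C, hC⟩ := hf.2 L hL 0
  refine ⟨|C|, fun κ x => (hC κ x).trans ?_⟩
  have h1 : (1 : ℝ) ≤ Real.exp ((‖x‖ / L) ^ ρ) := by
    rw [Real.one_le_exp_iff]; positivity
  have h2 : C * (L ^ mabs κ)⁻¹ * (mfact κ : ℝ) ^ (1 - 1 / ρ)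
      ≤ |C| * (L ^ mabs κ)⁻¹ * (mfact κ : ℝ) ^ (1 - 1 / ρ) := by
    gcongr; exact le_abs_self C
  have h3 : 0 ≤ |C| * (L ^ mabs κ)⁻¹ * (mfact κ : ℝ) ^ (1 - 1 / ρ) := by positivity
  simp only [pow_zero, inv_one, mul_one]
  exact h2.trans (le_mul_of_one_le_right h3 h1)

variable (ι) in
/-- `𝓔^ρ` as a linear subspace of the space of all functions. -/
def ESubmodule (ρ : ℝ) : Submodule ℂ ((ι → ℝ) → ℂ) where
  carrier := {f | MemE ρ f}
  add_mem' := MemE.add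
  zero_mem' := memE_zero ρ
  smul_mem' c _ hf := MemE.smul c hf

variable (ι) in
/-- The vector space `𝓔^ρ`, as a type of its own, so that it carries its own topology and not
the topology of pointwise convergence. -/
def ESpace (ρ : ℝ) : Type _ := ESubmodule ι ρ

instance (ρ : ℝ) : AddCommGroup (ESpace ι ρ) := inferInstanceAs (AddCommGroup (ESubmodule ι ρ))

instance (ρ : ℝ) : Module ℂ (ESpace ι ρ) := inferInstanceAs (Module ℂ (ESubmodule ι ρ))

/-- The function underlying an element of `𝓔^ρ`. -/
def ESpace.fn {ρ : ℝ} (f : ESpace ι ρ) : (ι → ℝ) → ℂ := f.1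

theorem ESpace.memE {ρ : ℝ} (f : ESpace ι ρ) : MemE ρ f.fn := f.2

/-- The quantity `L^{|κ|} |∂^κ f(x)| (κ!)^{-(1-1/ρ)} exp(-|x/L|^ρ)`. -/
def wt (ρ L : ℝ) (f : (ι → ℝ) → ℂ) (p : (ι → ℕ) × (ι → ℝ)) : ℝ :=
  L ^ mabs p.1 * ‖mderiv p.1 f p.2‖ / (mfact p.1 : ℝ) ^ (1 - 1 / ρ) *
    Real.exp (-(‖p.2‖ / L) ^ ρ)


theorem wt_nonneg {ρ L : ℝ} (hL : 0 < L) (f : (ι → ℝ) → ℂ) (p) : 0 ≤ wt ρ L f p := by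
  unfold wt; positivity

theorem wt_bdd {ρ L : ℝ} (hL : 0 < L) {f : (ι → ℝ) → ℂ} (hf : MemE ρ f) :
    BddAbove (Set.range (wt ρ L f)) := by
  obtain ⟨C, hC⟩ := hf.2 L hL
  refine ⟨C, ?_⟩
  rintro _ ⟨⟨κ, x⟩, rfl⟩
  have hfac : (0 : ℝ) < (mfact κ : ℝ) ^ (1 - 1 / ρ) := by
    apply Real.rpow_pos_of_pos
    exact_mod_cast Finset.prod_pos fun j _ => Nat.factorial_pos (κ j)
  have hp : 0 < L ^ mabs κ := by positivity
  have h := hC κ x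
  unfold wt
  dsimp only
  rw [Real.exp_neg]
  have he := Real.exp_pos ((‖x‖ / L) ^ ρ)
  calc L ^ mabs κ * ‖mderiv κ f x‖ / (mfact κ : ℝ) ^ (1 - 1 / ρ) * (Real.exp ((‖x‖ / L) ^ ρ))⁻¹
      ≤ L ^ mabs κ * (C * (L ^ mabs κ)⁻¹ * (mfact κ : ℝ) ^ (1 - 1 / ρ) *
        Real.exp ((‖x‖ / L) ^ ρ)) / (mfact κ : ℝ) ^ (1 - 1 / ρ) *
        (Real.exp ((‖x‖ / L) ^ ρ))⁻¹ := by gcongr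
    _ = C := by field_simp

/-- The norm `‖f‖_L = sup_{x,κ} L^{|κ|} |∂^κ f(x)| (κ!)^{-(1-1/ρ)} exp(-|x/L|^ρ)` on `𝓔^ρ`. -/
def ESpace.norm (ρ : ℝ) (L : {L : ℝ // 0 < L}) : Seminorm ℂ (ESpace ι ρ) :=
  Seminorm.of (fun f => ⨆ p, wt ρ L.1 f.fn p)
    (by
      intro f g
      refine ciSup_le fun p => ?_
      refine le_trans ?_ (add_le_add (le_ciSup (wt_bdd L.2 f.memE) p)
        (le_ciSup (wt_bdd L.2 g.memE) p))
      have hfg : (f + g).fn = f.fn + g.fn := rfl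
      have hL := L.2
      unfold wt
      rw [hfg, mderiv_add _ f.memE.1 g.memE.1, Pi.add_apply, ← add_mul, ← add_div, ← mul_add]
      gcongr
      exact norm_add_le _ _)
    (by
      intro c f
      have hcf : (c • f).fn = c • f.fn := rfl
      rw [Real.mul_iSup_of_nonneg (norm_nonneg c)]
      congr 1
      funext p
      unfold wt
      rw [hcf, mderiv_smul _ c f.memE.1, Pi.smul_apply, norm_smul]
      ring)

instance : Nonempty {L : ℝ // 0 < L} := ⟨⟨1, one_pos⟩⟩

/-- The topology of `𝓔^ρ`, defined by the norms `‖·‖_L`, `L > 0`. -/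
instance (ρ : ℝ) : TopologicalSpace (ESpace ι ρ) :=
  (SeminormFamily.moduleFilterBasis (𝕜 := ℂ) (ESpace.norm (ι := ι) ρ)).topology

end Euclid

/-! ## The Fock–Bargmann space and the spaces `Ē^{2,A}_ρ` -/

/-- The Hermitian norm `‖z‖ = (∑ |z_j|²)^{1/2}` on `ℂ^n`. -/
def hnorm {n : ℕ} (z : Fin n → ℂ) : ℝ := Real.sqrt (∑ j, ‖z j‖ ^ 2)

/-- The measure `dμ(z) = π^{-n} d(Re z) d(Im z)` on `ℂ^n`. -/
def muC (n : ℕ) : Measure (Fin n → ℂ) := ENNReal.ofReal ((Real.pi ^ n)⁻¹) • volume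

/-- Antiholomorphic functions on `ℂ^n`: `z ↦ φ(z̄)` with `φ` entire. -/
def Antiholomorphic {n : ℕ} (Φ : (Fin n → ℂ) → ℂ) : Prop :=
  Differentiable ℂ fun ζ : Fin n → ℂ => Φ (star ζ)

/-- The Fock–Bargmann space: antiholomorphic functions that are square integrable
with respect to `exp(-‖z‖²/ℏ) dμ(z)`. -/
def MemFock {n : ℕ} (ℏ : ℝ) (Φ : (Fin n → ℂ) → ℂ) : Prop :=
  Antiholomorphic Φ ∧
    Integrable (fun z => ‖Φ z‖ ^ 2 * Real.exp (-(1 / ℏ) * hnorm z ^ 2)) (muC n)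

/-- `|Φ(z)| ≤ C exp(A‖z‖² - r‖z‖^ρ)`. -/
def EbarBound {n : ℕ} (ρ A r C : ℝ) (Φ : (Fin n → ℂ) → ℂ) : Prop :=
  ∀ z, ‖Φ z‖ ≤ C * Real.exp (A * hnorm z ^ 2 - r * hnorm z ^ ρ)

/-- Membership in `Ē^{2,A}_ρ`. -/
def MemEbar {n : ℕ} (ρ A : ℝ) (Φ : (Fin n → ℂ) → ℂ) : Prop :=
  Antiholomorphic Φ ∧ ∃ C r : ℝ, 0 < r ∧ EbarBound ρ A r C Φ

theorem hnorm_nonneg {n : ℕ} (z : Fin n → ℂ) : 0 ≤ hnorm z := Real.sqrt_nonneg _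

theorem MemEbar.add {n : ℕ} {ρ A : ℝ} {Φ Ψ : (Fin n → ℂ) → ℂ} (hΦ : MemEbar ρ A Φ)
    (hΨ : MemEbar ρ A Ψ) : MemEbar ρ A (Φ + Ψ) := by
  obtain ⟨h1, C, r, hr, hC⟩ := hΦ
  obtain ⟨h2, D, s, hs, hD⟩ := hΨ
  refine ⟨Differentiable.add h1 h2, |C| + |D|, min r s, lt_min hr hs, fun z => ?_⟩
  have hz := Real.rpow_nonneg (hnorm_nonneg z) ρ
  rw [Pi.add_apply, add_mul]
  refine (norm_add_le _ _).trans (add_le_add ((hC z).trans ?_) ((hD z).trans ?_))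
  · refine mul_le_mul (le_abs_self C) (Real.exp_le_exp.2 ?_) (Real.exp_pos _).le (abs_nonneg C)
    have := mul_le_mul_of_nonneg_right (min_le_left r s) hz
    linarith
  · refine mul_le_mul (le_abs_self D) (Real.exp_le_exp.2 ?_) (Real.exp_pos _).le (abs_nonneg D)
    have := mul_le_mul_of_nonneg_right (min_le_right r s) hz
    linarith

/-- `Ē^{2,A}_ρ` as a linear subspace of the space of all functions on `ℂ^n`. -/
def EbarSubmodule (n : ℕ) (ρ A : ℝ) : Submodule ℂ ((Fin n → ℂ) → ℂ) where
  carrier := {Φ | MemEbar ρ A Φ}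
  add_mem' := MemEbar.add
  zero_mem' := ⟨differentiable_const 0, 0, 1, one_pos, fun z => by simp⟩
  smul_mem' c Φ hΦ := by
    obtain ⟨h1, C, r, hr, hC⟩ := hΦ
    refine ⟨Differentiable.const_smul h1 c, ‖c‖ * C, r, hr, fun z => ?_⟩
    rw [Pi.smul_apply, norm_smul, mul_assoc]
    exact mul_le_mul_of_nonneg_left (hC z) (norm_nonneg c)

/-- The vector space `Ē^{2,A}_ρ`, as a type of its own. -/
def Ebar (n : ℕ) (ρ A : ℝ) : Type := EbarSubmodule n ρ A

instance (n : ℕ) (ρ A : ℝ) : AddCommGroup (Ebar n ρ A) :=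
  inferInstanceAs (AddCommGroup (EbarSubmodule n ρ A))

instance (n : ℕ) (ρ A : ℝ) : Module ℂ (Ebar n ρ A) :=
  inferInstanceAs (Module ℂ (EbarSubmodule n ρ A))

/-- The function underlying an element of `Ē^{2,A}_ρ`. -/
def Ebar.fn {n : ℕ} {ρ A : ℝ} (φ : Ebar n ρ A) : (Fin n → ℂ) → ℂ := φ.1

/-- A seminorm on `Ē^{2,A}_ρ` whose restriction to each Banach space of the family (the functions
with finite norm `‖φ‖_r = sup_z |φ(z)| exp(-A‖z‖² + r‖z‖^ρ)`) is continuous,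
i.e. bounded by a multiple of `‖·‖_r`. -/
def StepContinuous {n : ℕ} {ρ A : ℝ} (p : Seminorm ℂ (Ebar n ρ A)) : Prop :=
  ∀ r : ℝ, 0 < r → ∃ K : ℝ, ∀ (φ : Ebar n ρ A) (C : ℝ),
    EbarBound ρ A r C φ.fn → p φ ≤ K * C

instance (n : ℕ) (ρ A : ℝ) : Nonempty {p : Seminorm ℂ (Ebar n ρ A) // StepContinuous p} :=
  ⟨⟨0, fun _ _ => ⟨0, fun _ _ _ => by simp⟩⟩⟩

/-- The locally convex inductive limit topology on `Ē^{2,A}_ρ`: the topology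
defined by all seminorms that are continuous on every space of the family. -/
instance (n : ℕ) (ρ A : ℝ) : TopologicalSpace (Ebar n ρ A) :=
  (SeminormFamily.moduleFilterBasis (𝕜 := ℂ)
    (fun p : {p : Seminorm ℂ (Ebar n ρ A) // StepContinuous p} => p.1)).topology

instance (n : ℕ) (ρ A : ℝ) : IsTopologicalAddGroup (Ebar n ρ A) :=
  AddGroupFilterBasis.isTopologicalAddGroup _

instance (n : ℕ) (ρ A : ℝ) : ContinuousSMul ℂ (Ebar n ρ A) :=
  ModuleFilterBasis.continuousSMul _

/-- The algebra of operators defined on `Ē^{2,A}_ρ` and mapping it continuously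
into itself. Mathlib's topology on it is that of uniform convergence on bounded subsets. -/
abbrev OpAlg (n : ℕ) (ρ A : ℝ) : Type := Ebar n ρ A →L[ℂ] Ebar n ρ A

/-! ## The Wick star product and the Wick correspondence -/

/-- The index set of the coordinates `x = (p_1,…,p_n; q^1,…,q^n)` of `ℝ^{2n}`:
`Sum.inl j` for `p_j` and `Sum.inr j` for `q^j`. -/
abbrev PQ (n : ℕ) : Type := Fin n ⊕ Fin n

/-- The point `x = (p, q)` with `z^j = (ς q^j + i ς⁻¹ p_j)/√2`. -/
def ofZ {n : ℕ} (ς : ℝ) (z : Fin n → ℂ) : PQ n → ℝ :=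
  Sum.elim (fun j => Real.sqrt 2 * ς * (z j).im) (fun j => Real.sqrt 2 * ς⁻¹ * (z j).re)

/-- `∂/∂z^j = (ς⁻¹ ∂/∂q^j - i ς ∂/∂p_j)/√2`. -/
def dz {n : ℕ} (ς : ℝ) (j : Fin n) (f : (PQ n → ℝ) → ℂ) : (PQ n → ℝ) → ℂ := fun x =>
  (1 / (Real.sqrt 2 : ℂ)) * ((ς : ℂ)⁻¹ * pderiv (Sum.inr j) f x
    - Complex.I * ς * pderiv (Sum.inl j) f x)

/-- `∂/∂z̄_j = (ς⁻¹ ∂/∂q^j + i ς ∂/∂p_j)/√2`. -/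
def dzbar {n : ℕ} (ς : ℝ) (j : Fin n) (f : (PQ n → ℝ) → ℂ) : (PQ n → ℝ) → ℂ := fun x =>
  (1 / (Real.sqrt 2 : ℂ)) * ((ς : ℂ)⁻¹ * pderiv (Sum.inr j) f x
    + Complex.I * ς * pderiv (Sum.inl j) f x)

/-- The term of order `m` of `f(z,z̄) exp(ℏ ∂_z← · ∂_z̄→) g(z,z̄)`, namely
`(ℏ^m/m!) ∑_{j_1,…,j_m} (∂_{z^{j_1}}⋯∂_{z^{j_m}} f)(∂_{z̄_{j_1}}⋯∂_{z̄_{j_m}} g)`. -/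
def wickTerm {n : ℕ} (ℏ ς : ℝ) (f g : (PQ n → ℝ) → ℂ) (m : ℕ) (x : PQ n → ℝ) : ℂ :=
  ((ℏ : ℂ) ^ m / (m.factorial : ℂ)) * ∑ J : Fin m → Fin n,
    (List.ofFn J).foldr (dz ς) f x * (List.ofFn J).foldr (dzbar ς) g x

/-- The Wick star product. -/
def wickStar {n : ℕ} (ℏ ς : ℝ) (f g : (PQ n → ℝ) → ℂ) : (PQ n → ℝ) → ℂ :=
  fun x => ∑' m, wickTerm ℏ ς f g m x

/-- The symplectic Fourier transform in the holomorphic variables,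
`f̃(w,w̄) = ∫ f(z,z̄) exp(z·w̄ - z̄·w) dμ(z)`. -/
def sympFourier {n : ℕ} (ς : ℝ) (f : (PQ n → ℝ) → ℂ) (w : Fin n → ℂ) : ℂ :=
  ∫ z, f (ofZ ς z) * Complex.exp (z ⬝ᵥ star w - star z ⬝ᵥ w) ∂(muC n)

/-- The integrand `f̃(w,w̄) (e^{w z̄} e^{-ℏ w̄ ∂_z̄} Φ)(z)` of the Wick correspondence; the operator
`e^{-ℏ w̄ ∂_z̄}` is the translation of `z̄` by `-ℏ w̄`. -/
def wickIntegrand {n : ℕ} (ℏ ς : ℝ) (f : (PQ n → ℝ) → ℂ) (Φ : (Fin n → ℂ) → ℂ)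
    (z w : Fin n → ℂ) : ℂ :=
  sympFourier ς f w * (Complex.exp (w ⬝ᵥ star z) * Φ (z - (ℏ : ℂ) • w))

/-- The Wick correspondence: the operator `𝔣 = ∫ f̃(w,w̄) e^{w z̄} e^{-ℏ w̄ ∂_z̄} dμ(w)`. -/
def wickOp {n : ℕ} (ℏ ς : ℝ) (f : (PQ n → ℝ) → ℂ) (Φ : (Fin n → ℂ) → ℂ) : (Fin n → ℂ) → ℂ :=
  fun z => ∫ w, wickIntegrand ℏ ς f Φ z w ∂(muC n)

/-- `J` extends the Wick correspondence, which is given on `𝓦^ρ(ℝ^{2n})`. -/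
def ExtendsWick {n : ℕ} {ρ A : ℝ} (ℏ ς : ℝ)
    (J : ESpace (PQ n) ρ → OpAlg n ρ A) : Prop :=
  ∀ f : ESpace (PQ n) ρ, MemW ρ f.fn → ∀ φ : Ebar n ρ A, (J f φ).fn = wickOp ℏ ς f.fn φ.fn

end WickFock

end

open WickFock

/-!
# The Wick correspondence on `𝓔^ρ`

The functions of class `𝓔^ρ` are exactly the restrictions to `ℝ^{2n}` of the entire functions on the
complexified phase space that have growth of order `ρ` and minimal type, `|F(ζ)| ≤ C_ε exp(ε‖ζ‖^ρ)`
for every `ε > 0`, and the family of norms `‖f‖_L` is equivalent to that of the weighted suprema of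
the extensions.
One direction is Cauchy's estimate on polydiscs with radii that depend on the order of
differentiation (`exists_norm_mderiv_le`), the other one is the Taylor series (`MemE.exists_isExt`,
`IsExt.norm_le_of_memE`). Everything is then done with entire functions `F(u, b)` of the two
independent arguments `u` and `b` that stand for `z` and `z̄`.

Let `γ` be the Gaussian probability measure with density `ℏ^{-n} exp(-‖u‖²/ℏ)`. Since `ρ ≤ 2` and the
type is minimal, symbols are dominated by every Gaussian, and the integrals

* `(Op F φ)(b) = ∫ F(u, b) exp(b·u/ℏ) φ(ū) dγ(u)` (`wop`),
* `(F ⋆ G)(ζ) = ∫ F(ζ + u) G(ζ + ū) dγ(u)` (`starInt`)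

converge absolutely. The identity `|exp(z̄·u/ℏ)| exp(-‖u‖²/(2ℏ)) = exp(‖z‖²/(2ℏ) - ‖u - z‖²/(2ℏ))`
shows that `Op F` acts continuously in `Ē^{2,A}_ρ` with `A = 1/(2ℏ)`, with bounds by a single norm of
`F` on each Banach space of the inductive family (`exists_wop_bound`). The star product of two
functions of minimal type is of minimal type, and expanding the first factor in its Taylor series
turns the Gaussian integral into the series that defines the Wick product, by the reproducing
property of the kernel `exp(b·u/ℏ)` (`hasSum_wickTerm`).

For `b = w̄` a translation of the integration variable shows that the kernel of `Op F ∘ Op G` is that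
of `Op (F ⋆ G)`. Both kernels are entire in `(w, b)`, so this holds for all `b` (`starInt_mul_exp`).
Hence `Op F ∘ Op G = Op (F ⋆ G)` (`wop_wop`), and associativity of the star product follows by
applying operators to kernels (`starInt_assoc`).

For `f` of class `𝓦^ρ` a shift of the contour of integration shows that `f̃` decays faster than every
Gaussian (`exists_norm_sympFourier_le`). Fourier inversion therefore extends to
`F(u, b) = ∫ f̃(w) exp(w·b - w̄·u) dμ(w)`, and with the reproducing property the operator of the Wick
correspondence is `Op F` (`wickOp_eq_wop`). So `f ↦ Op F` extends the Wick correspondence to `𝓔^ρ`.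

A bounded subset of `Ē^{2,A}_ρ` is bounded in one of the Banach spaces of the family
(`Ebar.exists_bound_of_isVonNBounded`), which makes the extension continuous. It is unique because
`𝓦^ρ` is dense in `𝓔^ρ`: elements of `𝓔^ρ` are limits of their Taylor polynomials, and a polynomial
times `χ(δζ)`, with `χ` the Fourier–Laplace transform of a bump function, is of class `𝓦^ρ` and tends
to the polynomial as `δ → 0` (`eq_zero_of_eq_zero_on_memW`).
-/

namespace WickFock

/-! ### Entire functions of several variables -/

section Entire

variable {E : Type*} [NormedAddCommGroup E] [NormedSpace ℂ E]

/-- Restriction of an entire function to a complex line. -/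
theorem differentiable_line {F : E → ℂ} (hF : Differentiable ℂ F) (x v : E) :
    Differentiable ℂ fun t : ℂ => F (x + t • v) :=
  hF.comp (by fun_prop)

theorem hasDerivAt_line {F : E → ℂ} (hF : Differentiable ℂ F) (x v : E) (t : ℂ) :
    HasDerivAt (fun t : ℂ => F (x + t • v)) (fderiv ℂ F (x + t • v) v) t := by
  have h1 : HasDerivAt (fun t : ℂ => x + t • v) v t := by
    simpa using ((hasDerivAt_id t).smul_const v).const_add x
  exact (hF (x + t • v)).hasFDerivAt.comp_hasDerivAt t h1

/-- Cauchy's estimate for the Fréchet derivative. -/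
theorem norm_fderiv_le_of_ball {F : E → ℂ} (hF : Differentiable ℂ F) {x : E} {R M : ℝ}
    (hR : 0 < R) (hM : ∀ y, ‖y - x‖ ≤ R → ‖F y‖ ≤ M) : ‖fderiv ℂ F x‖ ≤ M / R := by
  have hM0 : 0 ≤ M := (norm_nonneg _).trans (hM x (by simp [hR.le]))
  refine ContinuousLinearMap.opNorm_le_bound _ (by positivity) fun v => ?_
  rcases eq_or_ne v 0 with rfl | hv
  · simp
  have hv' : 0 < ‖v‖ := norm_pos_iff.2 hv
  have h := Complex.norm_deriv_le_of_forall_mem_sphere_norm_le (c := 0) (R := R / ‖v‖) (C := M)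
    (by positivity) (differentiable_line hF x v).diffContOnCl (by
      intro t ht
      apply hM
      have : ‖t‖ = R / ‖v‖ := by simpa using ht
      rw [add_sub_cancel_left, norm_smul, this]
      exact (div_mul_cancel₀ R hv'.ne').le)
  rw [(hasDerivAt_line hF x v 0).deriv] at h
  simp only [zero_smul, add_zero] at h
  refine h.trans (le_of_eq ?_)
  field_simp

/-- The derivative of an entire function in a fixed direction. -/
noncomputable def dirDeriv (v : E) (F : E → ℂ) : E → ℂ := fun x => fderiv ℂ F x v

theorem dirDeriv_const_mul (v : E) (c : ℂ) {F : E → ℂ} (hF : Differentiable ℂ F) :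
    dirDeriv v (fun x => c * F x) = fun x => c * dirDeriv v F x := by
  funext x; simp [dirDeriv, fderiv_const_mul (hF x)]

variable [FiniteDimensional ℂ E]

/-- Differentiation under the integral sign for a jointly continuous family of entire functions.
Local domination of the functions suffices: Cauchy's estimate dominates the derivatives. -/
theorem hasFDerivAt_integral_of_locally_dominated {α : Type*} [TopologicalSpace α]
    [MeasurableSpace α] [OpensMeasurableSpace α] [SecondCountableTopology α]
    {μ : Measure α} {f : E → α → ℂ}
    (hc : Continuous (Function.uncurry f)) (hd : ∀ u, Differentiable ℂ fun x => f x u) (x₀ : E)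
    {bound : α → ℝ} (hb : Integrable bound μ)
    (hle : ∀ x, ‖x - x₀‖ ≤ 2 → ∀ u, ‖f x u‖ ≤ bound u) :
    Integrable (fun u => fderiv ℂ (fun x => f x u) x₀) μ ∧
    HasFDerivAt (fun x => ∫ u, f x u ∂μ) (∫ u, fderiv ℂ (fun x => f x u) x₀ ∂μ) x₀ := by
  borelize E
  have : ProperSpace E := FiniteDimensional.proper ℂ E
  have hswap : Continuous (Function.uncurry fun (u : α) (x : E) => f x u) :=
    hc.comp continuous_swap
  have hm := measurable_fderiv_with_param ℂ hswap
  have hm' : AEStronglyMeasurable (fun u => fderiv ℂ (fun x => f x u) x₀) μ := by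
    have h1 : Measurable fun u : α => (u, x₀) := by fun_prop
    exact (hm.comp h1).aestronglyMeasurable
  -- Cauchy's estimate on balls of radius `1`, which lie in the ball of radius `2` about `x₀`.
  have hbd : ∀ u, ∀ x ∈ Metric.ball x₀ 1, ‖fderiv ℂ (fun x => f x u) x‖ ≤ bound u := by
    intro u x hx
    refine (norm_fderiv_le_of_ball (hd u) one_pos (M := bound u) fun y hy => hle y ?_ u).trans
      (by simp)
    have h1 : ‖x - x₀‖ < 1 := by simpa [dist_eq_norm] using hx
    calc ‖y - x₀‖ = ‖(y - x) + (x - x₀)‖ := by congr 1; abel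
      _ ≤ ‖y - x‖ + ‖x - x₀‖ := norm_add_le _ _
      _ ≤ 2 := by linarith
  have hmeas : ∀ x, AEStronglyMeasurable (f x) μ := fun x => by
    have : Continuous (f x) := hc.comp (by fun_prop : Continuous fun u => (x, u))
    exact this.aestronglyMeasurable
  refine ⟨hb.mono' hm' (.of_forall fun u => hbd u x₀ (by simp)), ?_⟩
  exact hasFDerivAt_integral_of_dominated_of_fderiv_le (Metric.ball_mem_nhds x₀ one_pos)
    (.of_forall hmeas)
    (hb.mono' (hmeas x₀) (.of_forall fun u => hle x₀ (by simp) u)) hm'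
    (.of_forall hbd) hb (.of_forall fun u x _ => (hd u x).hasFDerivAt)

/-- An integral of entire functions is entire. -/
theorem differentiable_integral_of_locally_dominated {α : Type*} [TopologicalSpace α]
    [MeasurableSpace α] [OpensMeasurableSpace α] [SecondCountableTopology α]
    {μ : Measure α} {f : E → α → ℂ}
    (hc : Continuous (Function.uncurry f)) (hd : ∀ u, Differentiable ℂ fun x => f x u)
    (hb : ∀ x₀, ∃ bound : α → ℝ, Integrable bound μ ∧
      ∀ x, ‖x - x₀‖ ≤ 2 → ∀ u, ‖f x u‖ ≤ bound u) :
    Differentiable ℂ fun x => ∫ u, f x u ∂μ := fun x₀ => by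
  obtain ⟨b, hb, hle⟩ := hb x₀
  exact (hasFDerivAt_integral_of_locally_dominated hc hd x₀ hb hle).2.differentiableAt

/-- Directional derivatives of entire functions are entire, by Cauchy's integral formula on
complex lines. -/
theorem dirDeriv_differentiable (v : E) {F : E → ℂ} (hF : Differentiable ℂ F) :
    Differentiable ℂ (dirDeriv v F) := by
  have : ProperSpace E := FiniteDimensional.proper ℂ E
  have key : dirDeriv v F = fun x => (2 * Real.pi : ℂ)⁻¹ * ∫ θ in Set.Icc (0 : ℝ) (2 * Real.pi),
      Complex.exp (-(θ * Complex.I)) * F (x + Complex.exp (θ * Complex.I) • v) := by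
    funext x
    have h := Complex.two_pi_I_inv_smul_circleIntegral_sub_sq_inv_smul_of_differentiable
      (U := Set.univ) (c := 0) (w₀ := 0) (R := 1) isOpen_univ (Set.subset_univ _)
      (differentiable_line hF x v).differentiableOn (by simp)
    rw [(hasDerivAt_line hF x v 0).deriv] at h
    simp only [zero_smul, add_zero] at h
    change fderiv ℂ F x v = _
    rw [← h, circleIntegral, intervalIntegral.integral_of_le Real.two_pi_pos.le,
      ← MeasureTheory.integral_Icc_eq_integral_Ioc, smul_eq_mul,
      ← MeasureTheory.integral_const_mul, ← MeasureTheory.integral_const_mul]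
    refine MeasureTheory.integral_congr_ae (.of_forall fun θ => ?_)
    have he : Complex.exp (-(θ * Complex.I)) = (Complex.exp (θ * Complex.I))⁻¹ := Complex.exp_neg _
    have h0 := Complex.exp_ne_zero (θ * Complex.I)
    simp only [deriv_circleMap, circleMap, Complex.ofReal_one, one_mul, zero_add, sub_zero,
      smul_eq_mul, he]
    have hpi : (Real.pi : ℂ) ≠ 0 := by exact_mod_cast Real.pi_ne_zero
    field_simp
  rw [key]
  refine Differentiable.const_mul ?_ _
  refine differentiable_integral_of_locally_dominated ?_ ?_ ?_
  · have := hF.continuous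
    simp only [Function.uncurry_def]
    fun_prop
  · intro u
    exact (hF.comp (by fun_prop)).const_mul _
  · intro x₀
    obtain ⟨M, hM⟩ := (isCompact_closedBall x₀ (2 + ‖v‖)).exists_bound_of_continuousOn
      hF.continuous.continuousOn
    refine ⟨fun _ => M, by simp, fun x hx θ => ?_⟩
    rw [norm_mul, ← neg_mul, ← Complex.ofReal_neg, Complex.norm_exp_ofReal_mul_I, one_mul]
    apply hM
    rw [mem_closedBall_iff_norm]
    calc ‖x + Complex.exp (θ * Complex.I) • v - x₀‖
        = ‖(x - x₀) + Complex.exp (θ * Complex.I) • v‖ := by congr 1; abel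
      _ ≤ ‖x - x₀‖ + ‖Complex.exp (θ * Complex.I) • v‖ := norm_add_le _ _
      _ ≤ 2 + ‖v‖ := by rw [norm_smul, Complex.norm_exp_ofReal_mul_I, one_mul]; linarith

/-- Entire functions are infinitely differentiable. -/
theorem contDiff_of_entire {F : E → ℂ} (hF : Differentiable ℂ F) : ContDiff ℂ ∞ F := by
  rw [contDiff_infty]
  intro k
  induction k generalizing F with
  | zero => exact contDiff_zero.2 hF.continuous
  | succ k ih =>
    have : ((k + 1 : ℕ) : WithTop ℕ∞) = (k : WithTop ℕ∞) + 1 := by norm_cast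
    rw [this, contDiff_succ_iff_fderiv_apply]
    exact ⟨hF, by simp, fun v => ih (dirDeriv_differentiable v hF)⟩

end Entire

/-! ### Entire extensions of functions on `ℝ^d` -/

section Ext

variable {ι : Type*}

/-- The embedding of `ℝ^d` into `ℂ^d`. -/
def toC (x : ι → ℝ) : ι → ℂ := fun j => (x j : ℂ)

@[simp] theorem toC_apply (x : ι → ℝ) (j : ι) : toC x j = x j := rfl

theorem toC_add (x y : ι → ℝ) : toC (x + y) = toC x + toC y := by
  funext j; simp

theorem toC_smul (t : ℝ) (x : ι → ℝ) : toC (t • x) = (t : ℂ) • toC x := by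
  funext j; simp

theorem toC_single [DecidableEq ι] (j : ι) : toC (Pi.single j 1) = Pi.single j 1 := by
  funext i
  rcases eq_or_ne i j with rfl | h
  · simp
  · simp [h]

theorem re_add_im (ζ : ι → ℂ) :
    ζ = toC (fun j => (ζ j).re) + Complex.I • toC (fun j => (ζ j).im) := by
  funext j
  simp only [Pi.add_apply, Pi.smul_apply, toC_apply, smul_eq_mul]
  rw [mul_comm, Complex.re_add_im]

variable [Fintype ι]

theorem norm_toC (x : ι → ℝ) : ‖toC x‖ = ‖x‖ := by
  simp [Pi.norm_def, toC, nnnorm]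

variable (ι) in
/-- The embedding of `ℝ^d` into `ℂ^d` as a continuous linear map. -/
noncomputable def toCL : (ι → ℝ) →L[ℝ] (ι → ℂ) :=
  LinearMap.toContinuousLinearMap
    { toFun := toC, map_add' := toC_add, map_smul' := fun t x => by
        rw [toC_smul]; funext j; simp }

theorem continuous_toC : Continuous (toC : (ι → ℝ) → (ι → ℂ)) := (toCL ι).continuous

/-- `F` is an entire extension of `f`. -/
def IsExt (F : (ι → ℂ) → ℂ) (f : (ι → ℝ) → ℂ) : Prop :=
  Differentiable ℂ F ∧ ∀ x, F (toC x) = f x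

/-- A function of one complex variable that vanishes on the real line vanishes. -/
theorem eq_zero_of_real {h : ℂ → ℂ} (hh : Differentiable ℂ h) (h0 : ∀ t : ℝ, h t = 0) (t : ℂ) :
    h t = 0 := by
  have h1 : AnalyticOnNhd ℂ h Set.univ := hh.differentiableOn.analyticOnNhd isOpen_univ
  have h2 : Set.EqOn h 0 Set.univ := by
    refine h1.eqOn_zero_of_preconnected_of_frequently_eq_zero isPreconnected_univ
      (Set.mem_univ 0) ?_
    have h3 : Filter.Tendsto (fun k : ℕ => (((1 : ℝ) / ((k : ℝ) + 1) : ℝ) : ℂ)) Filter.atTop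
        (nhdsWithin 0 {0}ᶜ) := by
      refine tendsto_nhdsWithin_iff.2 ⟨?_, .of_forall fun k => ?_⟩
      · have := (Complex.continuous_ofReal.tendsto 0).comp
          (tendsto_one_div_add_atTop_nhds_zero_nat (𝕜 := ℝ))
        simpa [Function.comp_def] using this
      · simp only [Set.mem_compl_iff, Set.mem_singleton_iff, Complex.ofReal_eq_zero]
        positivity
    exact h3.frequently (.of_forall fun k => h0 _)
  exact h2 (Set.mem_univ t)

/-- Two entire functions of one variable that agree on the real line are equal. -/
theorem eq_of_eq_real {h k : ℂ → ℂ} (hh : Differentiable ℂ h) (hk : Differentiable ℂ k)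
    (h0 : ∀ t : ℝ, h t = k t) (t : ℂ) : h t = k t :=
  sub_eq_zero.1 (eq_zero_of_real (hh.sub hk) (fun t => sub_eq_zero.2 (h0 t)) t)

theorem IsExt.unique {F G : (ι → ℂ) → ℂ} {f : (ι → ℝ) → ℂ} (hF : IsExt F f) (hG : IsExt G f) :
    F = G := by
  funext ζ
  rw [re_add_im ζ]
  refine eq_of_eq_real (differentiable_line hF.1 _ _) (differentiable_line hG.1 _ _)
    (fun t => ?_) Complex.I
  rw [← toC_smul, ← toC_add, hF.2, hG.2]

theorem IsExt.add {F G : (ι → ℂ) → ℂ} {f g : (ι → ℝ) → ℂ} (hF : IsExt F f) (hG : IsExt G g) :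
    IsExt (F + G) (f + g) :=
  ⟨hF.1.add hG.1, fun x => by simp [hF.2, hG.2]⟩

theorem IsExt.smul {F : (ι → ℂ) → ℂ} {f : (ι → ℝ) → ℂ} (c : ℂ) (hF : IsExt F f) :
    IsExt (c • F) (c • f) :=
  ⟨hF.1.const_smul c, fun x => by simp [hF.2]⟩

theorem IsExt.contDiff {F : (ι → ℂ) → ℂ} {f : (ι → ℝ) → ℂ} (hF : IsExt F f) :
    ContDiff ℝ ∞ f := by
  have h : f = F ∘ toCL ι := by funext x; exact (hF.2 x).symm
  rw [h]
  exact ((contDiff_of_entire hF.1).restrict_scalars ℝ).comp (toCL ι).contDiff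

/-- The real Fréchet derivative of `f` is the restriction of the complex one of its extension. -/
theorem IsExt.fderiv {F : (ι → ℂ) → ℂ} {f : (ι → ℝ) → ℂ} (hF : IsExt F f) (x y : ι → ℝ) :
    fderiv ℝ f x y = dirDeriv (toC y) F (toC x) := by
  have h : f = F ∘ toCL ι := by funext x; exact (hF.2 x).symm
  have h1 : HasFDerivAt F ((_root_.fderiv ℂ F (toC x)).restrictScalars ℝ) (toCL ι x) :=
    (hF.1 (toC x)).hasFDerivAt.restrictScalars ℝ
  rw [h, (h1.comp x (toCL ι).hasFDerivAt).fderiv]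
  rfl

variable [DecidableEq ι]

theorem IsExt.pderiv {F : (ι → ℂ) → ℂ} {f : (ι → ℝ) → ℂ} (hF : IsExt F f) (j : ι) :
    IsExt (dirDeriv (Pi.single j 1) F) (pderiv j f) :=
  ⟨dirDeriv_differentiable _ hF.1, fun x => by
    rw [WickFock.pderiv, hF.fderiv, toC_single]⟩

end Ext

/-! ### The Hermitian norm and the pairing `z · w` -/

section Hnorm

variable {n : ℕ}

theorem hnorm_eq_norm (z : Fin n → ℂ) : hnorm z = ‖(WithLp.toLp 2 z : EuclideanSpace ℂ (Fin n))‖ := by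
  rw [EuclideanSpace.norm_eq]; rfl

theorem hnorm_sq (z : Fin n → ℂ) : hnorm z ^ 2 = ∑ j, ‖z j‖ ^ 2 :=
  Real.sq_sqrt (Finset.sum_nonneg fun _ _ => sq_nonneg _)

theorem hnorm_zero : hnorm (0 : Fin n → ℂ) = 0 := by simp [hnorm]

theorem hnorm_add_le (z w : Fin n → ℂ) : hnorm (z + w) ≤ hnorm z + hnorm w := by
  simp only [hnorm_eq_norm, WithLp.toLp_add]; exact norm_add_le _ _

theorem hnorm_smul (c : ℂ) (z : Fin n → ℂ) : hnorm (c • z) = ‖c‖ * hnorm z := by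
  simp only [hnorm_eq_norm, WithLp.toLp_smul, norm_smul]

theorem hnorm_neg (z : Fin n → ℂ) : hnorm (-z) = hnorm z := by
  simp only [hnorm_eq_norm, WithLp.toLp_neg, norm_neg]

theorem hnorm_star (z : Fin n → ℂ) : hnorm (star z) = hnorm z := by
  simp [hnorm]

theorem continuous_hnorm : Continuous (hnorm : (Fin n → ℂ) → ℝ) := by
  unfold hnorm; fun_prop

theorem norm_le_hnorm (z : Fin n → ℂ) : ‖z‖ ≤ hnorm z := by
  rw [hnorm_eq_norm]
  refine (pi_norm_le_iff_of_nonneg (norm_nonneg _)).2 fun j => ?_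
  exact PiLp.norm_apply_le (WithLp.toLp 2 z : EuclideanSpace ℂ (Fin n)) j

theorem hnorm_le (z : Fin n → ℂ) : hnorm z ≤ n * ‖z‖ := by
  refine Real.sqrt_le_iff.2 ⟨by positivity, ?_⟩
  calc ∑ j, ‖z j‖ ^ 2 ≤ ∑ _j : Fin n, ‖z‖ ^ 2 := by
        gcongr with j; exact norm_le_pi_norm z j
    _ = n * ‖z‖ ^ 2 := by simp
    _ ≤ (n * ‖z‖) ^ 2 := by
        rw [mul_pow]
        gcongr
        exact_mod_cast Nat.le_self_pow two_ne_zero n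

theorem norm_dot_le (z w : Fin n → ℂ) : ‖z ⬝ᵥ w‖ ≤ hnorm z * hnorm w := by
  have h := norm_inner_le_norm (𝕜 := ℂ) (WithLp.toLp 2 (star w) : EuclideanSpace ℂ (Fin n))
    (WithLp.toLp 2 z)
  rw [EuclideanSpace.inner_eq_star_dotProduct, ← hnorm_eq_norm, ← hnorm_eq_norm, hnorm_star] at h
  simpa [mul_comm] using h

theorem re_dot_le (z w : Fin n → ℂ) : (z ⬝ᵥ w).re ≤ hnorm z * hnorm w :=
  (Complex.re_le_norm _).trans (norm_dot_le z w)

theorem star_dot_self (z : Fin n → ℂ) : star z ⬝ᵥ z = ((hnorm z ^ 2 : ℝ) : ℂ) := by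
  rw [hnorm_sq, dotProduct]
  push_cast
  refine Finset.sum_congr rfl fun j _ => ?_
  rw [Pi.star_apply, RCLike.star_def, ← Complex.normSq_eq_conj_mul_self, Complex.normSq_eq_norm_sq]
  norm_cast

theorem star_dot (z w : Fin n → ℂ) : star (z ⬝ᵥ w) = star z ⬝ᵥ star w := by
  simp [dotProduct]

theorem hnorm_sub_sq (u z : Fin n → ℂ) :
    hnorm (u - z) ^ 2 = hnorm u ^ 2 + hnorm z ^ 2 - 2 * (star z ⬝ᵥ u).re := by
  have h := congrArg Complex.re (star_dot_self (u - z))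
  have h1 := congrArg Complex.re (star_dot_self u)
  have h2 := congrArg Complex.re (star_dot_self z)
  have h3 : (star u ⬝ᵥ z).re = (star z ⬝ᵥ u).re := by
    have : star u ⬝ᵥ z = star (star z ⬝ᵥ u) := by
      rw [star_dot, star_star, dotProduct_comm z]
    rw [this]; simp
  rw [star_sub, sub_dotProduct, dotProduct_sub, dotProduct_sub] at h
  simp only [Complex.sub_re, Complex.ofReal_re] at h h1 h2
  linarith

end Hnorm

/-! ### Gaussian integrals over `ℂ^n` -/

section Gauss

variable {n : ℕ}

instance : SFinite (muC n) := by unfold muC; infer_instance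

instance : (muC n).IsAddRightInvariant := by unfold muC; infer_instance

theorem integrable_muC_of_volume {E : Type*} [NormedAddCommGroup E] {f : (Fin n → ℂ) → E}
    (hf : Integrable f) : Integrable f (muC n) :=
  hf.smul_measure ENNReal.ofReal_ne_top

theorem integral_muC (f : (Fin n → ℂ) → ℂ) :
    ∫ u, f u ∂(muC n) = ((Real.pi ^ n)⁻¹ : ℝ) * ∫ u, f u := by
  rw [muC, integral_smul_measure, ENNReal.toReal_ofReal (by positivity), Complex.real_smul]

theorem exp_neg_hnorm_sq (c : ℝ) (u : Fin n → ℂ) :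
    Real.exp (-c * hnorm u ^ 2) = ∏ j, Real.exp (-c * ‖u j‖ ^ (2 : ℝ)) := by
  rw [← Real.exp_sum, hnorm_sq, Finset.mul_sum]
  simp

theorem integral_exp_neg_norm_sq {c : ℝ} (hc : 0 < c) :
    ∫ z : ℂ, Real.exp (-c * ‖z‖ ^ (2 : ℝ)) = Real.pi / c := by
  rw [Complex.integral_exp_neg_mul_rpow one_le_two hc]
  norm_num
  rw [Real.rpow_neg_one]; rfl

theorem integrable_exp_neg_norm_sq {c : ℝ} (hc : 0 < c) :
    Integrable fun z : ℂ => Real.exp (-c * ‖z‖ ^ (2 : ℝ)) := by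
  refine Integrable.of_integral_ne_zero ?_
  rw [integral_exp_neg_norm_sq hc]
  positivity

theorem integrable_exp_neg_hnorm_sq {c : ℝ} (hc : 0 < c) :
    Integrable (fun u : Fin n → ℂ => Real.exp (-c * hnorm u ^ 2)) (muC n) := by
  refine integrable_muC_of_volume ?_
  simp only [exp_neg_hnorm_sq]
  exact Integrable.fintype_prod (f := fun _ z => Real.exp (-c * ‖z‖ ^ (2 : ℝ)))
    fun _ => integrable_exp_neg_norm_sq hc

/-- `exp(b t - c t²) ≤ exp(b²/(2c)) exp(-(c/2) t²)`. -/
theorem linear_sub_sq_le {c : ℝ} (hc : 0 < c) (b t : ℝ) :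
    b * t - c * t ^ 2 ≤ b ^ 2 / (2 * c) - c / 2 * t ^ 2 := by
  have h : b ^ 2 / (2 * c) - c / 2 * t ^ 2 - (b * t - c * t ^ 2) = (c * t - b) ^ 2 / (2 * c) := by
    field_simp; ring
  have : 0 ≤ (c * t - b) ^ 2 / (2 * c) := by positivity
  linarith

theorem integrable_exp_linear_sub_sq {c : ℝ} (hc : 0 < c) (C b : ℝ) :
    Integrable (fun u : Fin n → ℂ => C * Real.exp (b * hnorm u - c * hnorm u ^ 2)) (muC n) := by
  refine Integrable.const_mul ?_ C
  refine ((integrable_exp_neg_hnorm_sq (n := n) (half_pos hc)).const_mul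
    (Real.exp (b ^ 2 / (2 * c)))).mono' ?_ (.of_forall fun u => ?_)
  · have := continuous_hnorm (n := n)
    exact Continuous.aestronglyMeasurable (by fun_prop)
  · rw [Real.norm_eq_abs, abs_of_pos (Real.exp_pos _), ← Real.exp_add]
    refine Real.exp_le_exp.2 ?_
    have := linear_sub_sq_le hc b (hnorm u)
    linarith

theorem integrable_of_gauss_bound {f : (Fin n → ℂ) → ℂ} (hf : Continuous f) {C b c : ℝ}
    (hc : 0 < c) (h : ∀ u, ‖f u‖ ≤ C * Real.exp (b * hnorm u - c * hnorm u ^ 2)) :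
    Integrable f (muC n) :=
  (integrable_exp_linear_sub_sq hc C b).mono' hf.aestronglyMeasurable (.of_forall h)

/-- The density `ℏ^{-n} exp(-‖u‖²/ℏ)` of the Gaussian probability measure with respect to `μ`. -/
noncomputable def gw (ℏ : ℝ) (u : Fin n → ℂ) : ℂ := ((ℏ ^ n)⁻¹ * Real.exp (-(1 / ℏ) * hnorm u ^ 2) : ℝ)

theorem continuous_gw (ℏ : ℝ) : Continuous (gw ℏ : (Fin n → ℂ) → ℂ) := by
  have := continuous_hnorm (n := n)
  unfold gw
  fun_prop

theorem norm_gw {ℏ : ℝ} (hℏ : 0 < ℏ) (u : Fin n → ℂ) :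
    ‖gw ℏ u‖ = (ℏ ^ n)⁻¹ * Real.exp (-(1 / ℏ) * hnorm u ^ 2) := by
  rw [gw, Complex.norm_real, Real.norm_eq_abs, abs_of_nonneg (by positivity)]

theorem gw_eq (ℏ : ℝ) (u : Fin n → ℂ) :
    gw ℏ u = ((ℏ ^ n)⁻¹ : ℝ) * Complex.exp (-(star u ⬝ᵥ u) / ℏ) := by
  rw [gw, star_dot_self]
  push_cast
  congr 2
  ring

theorem integral_gw {ℏ : ℝ} (hℏ : 0 < ℏ) : ∫ u, gw ℏ u ∂(muC n) = 1 := by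
  have h1 : 0 < 1 / ℏ := by positivity
  rw [integral_muC]
  unfold gw
  rw [integral_complex_ofReal, integral_const_mul]
  simp only [exp_neg_hnorm_sq]
  rw [integral_fintype_prod_volume_eq_pow (fun z : ℂ => Real.exp (-(1 / ℏ) * ‖z‖ ^ (2 : ℝ))),
    integral_exp_neg_norm_sq h1, Fintype.card_fin, ← Complex.ofReal_mul]
  have hpi := Real.pi_pos
  rw [Complex.ofReal_eq_one]
  rw [div_div_eq_mul_div, div_one, mul_pow]
  field_simp

theorem measurePreserving_smul_unit {a : ℂ} (ha : ‖a‖ = 1) :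
    MeasurePreserving (fun u : Fin n → ℂ => a • u) (muC n) (muC n) := by
  have h : MeasurePreserving (fun u : Fin n → ℂ => a • u) volume volume := by
    have h1 : MeasurePreserving (fun z : ℂ => a * z) volume volume :=
      (rotation ⟨a, by simpa [Submonoid.unitSphere] using ha⟩).measurePreserving
    exact volume_preserving_pi (fun _ : Fin n => h1)
  exact h.smul_measure _

/-- The mean value property of entire functions with respect to a Gaussian measure, obtained by
averaging over the rotations `u ↦ e^{iθ} u`. -/
theorem integral_antiholomorphic_gw {ℏ : ℝ} (hℏ : 0 < ℏ) {Q : (Fin n → ℂ) → ℂ}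
    (hQ : Differentiable ℂ Q) (hint : Integrable (fun u => Q (star u) * gw ℏ u) (muC n)) :
    ∫ u, Q (star u) * gw ℏ u ∂(muC n) = Q 0 := by
  set I := ∫ u, Q (star u) * gw ℏ u ∂(muC n) with hI
  have hQc := hQ.continuous
  have hgc := continuous_gw (n := n) ℏ
  have hg1 : ∀ a : ℂ, ‖a‖ = 1 → ∀ u : Fin n → ℂ, gw ℏ (a • u) = gw ℏ u := by
    intro a ha u
    simp only [gw, hnorm_smul, ha, one_mul]
  have hnorm1 : ∀ θ : ℝ, ‖circleMap 0 1 θ‖ = 1 := by intro θ; simp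
  have hemb : ∀ a : ℂ, ‖a‖ = 1 → MeasurableEmbedding fun u : Fin n → ℂ => a • u := by
    intro a ha
    have : a ≠ 0 := by rintro rfl; simp at ha
    exact (Homeomorph.smulOfNeZero a this).measurableEmbedding
  have hrot : ∀ θ : ℝ, (fun u => Q (circleMap 0 1 θ • star u) * gw ℏ u) =
      (fun u => Q (star u) * gw ℏ u) ∘ fun u => star (circleMap 0 1 θ) • u := by
    intro θ
    funext u
    have : ‖star (circleMap 0 1 θ)‖ = 1 := by rw [norm_star, hnorm1]
    simp only [Function.comp, star_smul, star_star, hg1 _ this]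
  have hrot1 : ∀ θ : ℝ, ∫ u, Q (circleMap 0 1 θ • star u) * gw ℏ u ∂(muC n) = I := by
    intro θ
    have ha : ‖star (circleMap 0 1 θ)‖ = 1 := by rw [norm_star, hnorm1]
    rw [hrot θ]
    exact (measurePreserving_smul_unit ha).integral_comp (hemb _ ha)
      fun u => Q (star u) * gw ℏ u
  have hrot2 : ∀ θ : ℝ, Integrable (fun u => Q (circleMap 0 1 θ • star u) * gw ℏ u) (muC n) := by
    intro θ
    have ha : ‖star (circleMap 0 1 θ)‖ = 1 := by rw [norm_star, hnorm1]
    rw [hrot θ, (measurePreserving_smul_unit ha).integrable_comp_emb (hemb _ ha)]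
    exact hint
  have hrot3 : ∀ θ : ℝ, ∫ u, ‖Q (circleMap 0 1 θ • star u) * gw ℏ u‖ ∂(muC n) =
      ∫ u, ‖Q (star u) * gw ℏ u‖ ∂(muC n) := by
    intro θ
    have ha : ‖star (circleMap 0 1 θ)‖ = 1 := by rw [norm_star, hnorm1]
    have : (fun u => ‖Q (circleMap 0 1 θ • star u) * gw ℏ u‖) =
      (fun u => ‖Q (star u) * gw ℏ u‖) ∘ fun u => star (circleMap 0 1 θ) • u := by
      funext u; exact congrArg norm (congrFun (hrot θ) u)
    rw [this]
    exact (measurePreserving_smul_unit ha).integral_comp (hemb _ ha)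
      fun u => ‖Q (star u) * gw ℏ u‖
  -- The rotated integrands have the same integral of the norm, so Fubini applies over `[0, 2π]`.
  have hprod : Integrable (Function.uncurry fun (θ : ℝ) (u : Fin n → ℂ) =>
      Q (circleMap 0 1 θ • star u) * gw ℏ u)
      ((volume.restrict (Set.Ioc 0 (2 * Real.pi))).prod (muC n)) := by
    have hcm : Continuous (circleMap 0 1) := continuous_circleMap 0 1
    refine (integrable_prod_iff ?_).2 ⟨.of_forall hrot2, ?_⟩
    · refine Continuous.aestronglyMeasurable ?_
      simp only [Function.uncurry_def]
      fun_prop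
    · simp only [Function.uncurry, hrot3]
      simp
  -- For fixed `u` the average over `θ` is the mean value of an entire function of one variable.
  have hmv : ∀ u : Fin n → ℂ,
      ∫ θ in Set.Ioc 0 (2 * Real.pi), Q (circleMap 0 1 θ • star u) * gw ℏ u =
        2 * Real.pi * (Q 0 * gw ℏ u) := by
    intro u
    have h := (differentiable_line hQ 0 (star u)).diffContOnCl (s := Metric.ball 0 |(1 : ℝ)|)
      |>.circleAverage
    rw [Real.circleAverage, intervalIntegral.integral_of_le Real.two_pi_pos.le] at h
    simp only [zero_smul, add_zero, zero_add] at h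
    rw [integral_mul_const, ← h, Complex.real_smul]
    have hpi : (Real.pi : ℂ) ≠ 0 := by exact_mod_cast Real.pi_ne_zero
    push_cast
    field_simp
  have h1 := integral_integral_swap hprod
  simp only [hrot1, hmv] at h1
  rw [integral_const_mul, integral_const_mul, integral_gw hℏ] at h1
  have hpi : (Real.pi : ℂ) ≠ 0 := by exact_mod_cast Real.pi_ne_zero
  have h2 : (2 * Real.pi : ℂ) * I = 2 * Real.pi * (Q 0 * 1) := by
    rw [← h1]
    simp [Real.pi_pos.le]
  have := mul_left_cancel₀ (mul_ne_zero two_ne_zero hpi) h2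
  simpa using this

theorem differentiable_dot (b : Fin n → ℂ) : Differentiable ℂ fun ζ : Fin n → ℂ => ζ ⬝ᵥ b := by
  unfold dotProduct; fun_prop

theorem norm_exp_dot_div_le {ℏ : ℝ} (hℏ : 0 < ℏ) (b u : Fin n → ℂ) :
    ‖Complex.exp (b ⬝ᵥ u / ℏ)‖ ≤ Real.exp (hnorm b / ℏ * hnorm u) := by
  rw [Complex.norm_exp, Complex.div_ofReal_re]
  refine Real.exp_le_exp.2 ?_
  rw [div_mul_eq_mul_div]
  gcongr
  exact re_dot_le b u

theorem integrable_exp_dot_mul_gw {ℏ : ℝ} (hℏ : 0 < ℏ) {Q : (Fin n → ℂ) → ℂ} (hQ : Continuous Q)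
    {C : ℝ} (hC : ∀ ζ, ‖Q ζ‖ ≤ C * Real.exp (hnorm ζ ^ 2 / (2 * ℏ))) (b : Fin n → ℂ) :
    Integrable (fun u => Complex.exp (b ⬝ᵥ u / ℏ) * Q (star u) * gw ℏ u) (muC n) := by
  have hgc := continuous_gw (n := n) ℏ
  refine integrable_of_gauss_bound (C := C * (ℏ ^ n)⁻¹) (b := hnorm b / ℏ) (c := 1 / (2 * ℏ))
    ?_ (by positivity) fun u => ?_
  · unfold dotProduct; fun_prop
  · rw [norm_mul, norm_mul, norm_gw hℏ]
    have h1 := hC (star u)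
    rw [hnorm_star] at h1
    have h3 : Real.exp (hnorm b / ℏ * hnorm u - 1 / (2 * ℏ) * hnorm u ^ 2) =
        Real.exp (hnorm b / ℏ * hnorm u) * Real.exp (hnorm u ^ 2 / (2 * ℏ)) *
          Real.exp (-(1 / ℏ) * hnorm u ^ 2) := by
      rw [← Real.exp_add, ← Real.exp_add]
      congr 1
      field_simp; ring
    rw [h3]
    calc _ ≤ Real.exp (hnorm b / ℏ * hnorm u) * (C * Real.exp (hnorm u ^ 2 / (2 * ℏ))) *
          ((ℏ ^ n)⁻¹ * Real.exp (-(1 / ℏ) * hnorm u ^ 2)) := by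
          gcongr
          exact norm_exp_dot_div_le hℏ b u
      _ = _ := by ring

/-- The reproducing property of the Bargmann kernel. The translation `u ↦ u + b̄` reduces it to the
mean value property. -/
theorem reproducing {ℏ : ℝ} (hℏ : 0 < ℏ) {Q : (Fin n → ℂ) → ℂ} (hQ : Differentiable ℂ Q)
    {C : ℝ} (hC : ∀ ζ, ‖Q ζ‖ ≤ C * Real.exp (hnorm ζ ^ 2 / (2 * ℏ))) (b : Fin n → ℂ) :
    ∫ u, Complex.exp (b ⬝ᵥ u / ℏ) * Q (star u) * gw ℏ u ∂(muC n) = Q b := by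
  have hint := (integrable_exp_dot_mul_gw hℏ hQ.continuous hC b).comp_add_right (star b)
  rw [← integral_add_right_eq_self _ (star b)]
  have key : ∀ u : Fin n → ℂ,
      Complex.exp (b ⬝ᵥ (u + star b) / ℏ) * Q (star (u + star b)) * gw ℏ (u + star b) =
      (fun ζ => Q (ζ + b) * Complex.exp (-(ζ ⬝ᵥ star b) / ℏ)) (star u) * gw ℏ u := by
    intro u
    simp only [gw_eq, star_add, star_star, dotProduct_add, add_dotProduct]
    have h1 : Complex.exp ((b ⬝ᵥ u + b ⬝ᵥ star b) / ℏ) *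
        Complex.exp (-(star u ⬝ᵥ u + b ⬝ᵥ u + (star u ⬝ᵥ star b + b ⬝ᵥ star b)) / ℏ) =
        Complex.exp (-(star u ⬝ᵥ star b) / ℏ) * Complex.exp (-(star u ⬝ᵥ u) / ℏ) := by
      rw [← Complex.exp_add, ← Complex.exp_add]
      congr 1
      ring
    linear_combination (Q (star u + b) * ((ℏ ^ n)⁻¹ : ℝ)) * h1
  simp only [key] at hint ⊢
  have hd := differentiable_dot (star b)
  have h := integral_antiholomorphic_gw hℏ
    (Q := fun ζ => Q (ζ + b) * Complex.exp (-(ζ ⬝ᵥ star b) / ℏ))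
    ((hQ.comp (by fun_prop)).mul (by fun_prop)) hint
  rw [h]
  simp

end Gauss

/-! ### Taylor expansion along lines -/

section Taylor

/-- If `d/dt g(γ(t)) = ∑_j y_j (D_j g)(γ(t))` on a class of functions stable under the operators
`D_j`, then the `m`-th derivative of `f ∘ γ` is `∑_J y_{J_1}⋯y_{J_m} (D_{J_1}⋯D_{J_m} f) ∘ γ`. -/
theorem iteratedDeriv_comp_eq_sum {𝕜 X ι G : Type*} [NontriviallyNormedField 𝕜] [Fintype ι]
    [NormedAddCommGroup G] [NormedSpace 𝕜 G]
    (D : ι → (X → G) → X → G) (P : (X → G) → Prop) (hP : ∀ j g, P g → P (D j g))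
    (γ : 𝕜 → X) (y : ι → 𝕜)
    (hd : ∀ g, P g → ∀ t, HasDerivAt (fun t => g (γ t)) (∑ j, y j • D j g (γ t)) t)
    {f : X → G} (hf : P f) (m : ℕ) (t : 𝕜) :
    iteratedDeriv m (fun t => f (γ t)) t =
      ∑ J : Fin m → ι, (∏ k, y (J k)) • (List.ofFn J).foldr D f (γ t) := by
  have hPl : ∀ l : List ι, P (l.foldr D f) := by
    intro l
    induction l with
    | nil => exact hf
    | cons j l ih => exact hP j _ ih
  induction m generalizing t with
  | zero => simp
  | succ m ih =>
    rw [iteratedDeriv_succ, funext ih]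
    have h1 : HasDerivAt (fun t => ∑ J : Fin m → ι, (∏ k, y (J k)) • (List.ofFn J).foldr D f (γ t))
        (∑ J : Fin m → ι, (∏ k, y (J k)) •
          ∑ j, y j • D j ((List.ofFn J).foldr D f) (γ t)) t :=
      HasDerivAt.fun_sum fun J _ => (hd _ (hPl _) t).const_smul _
    rw [h1.deriv, ← (Fin.consEquiv fun _ => ι).sum_comp, Fintype.sum_prod_type,
      Finset.sum_comm' (t' := Finset.univ) (s' := fun _ => Finset.univ) (by simp)]
    refine Finset.sum_congr rfl fun J _ => ?_
    rw [Finset.smul_sum]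
    refine Finset.sum_congr rfl fun j _ => ?_
    simp only [Fin.consEquiv_apply, List.ofFn_succ, Fin.cons_zero, Fin.cons_succ, List.foldr_cons,
      Fin.prod_univ_succ, smul_smul]
    rw [mul_comm]

variable {E : Type*} [NormedAddCommGroup E] [NormedSpace ℂ E] [FiniteDimensional ℂ E]

theorem foldr_dirDeriv_differentiable {κ : Type*} (v : κ → E) {F : E → ℂ}
    (hF : Differentiable ℂ F) (l : List κ) :
    Differentiable ℂ (l.foldr (fun j => dirDeriv (v j)) F) := by
  induction l with
  | nil => exact hF
  | cons j l ih => exact dirDeriv_differentiable _ ih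

/-- The term of order `m` of the Taylor series of `F` at `ζ`, evaluated at `∑ y_j v_j`. -/
noncomputable def taylorTerm {κ : Type*} [Fintype κ] (v : κ → E) (F : E → ℂ) (ζ : E) (m : ℕ)
    (y : κ → ℂ) : ℂ :=
  (m.factorial : ℂ)⁻¹ * ∑ J : Fin m → κ, (∏ k, y (J k)) *
    (List.ofFn J).foldr (fun j => dirDeriv (v j)) F ζ

variable {κ : Type*} [Fintype κ]

/-- The Taylor terms are those of the function of one variable `t ↦ F(ζ + t ∑ y_j v_j)`. -/
theorem taylorTerm_eq_iteratedDeriv (v : κ → E) {F : E → ℂ} (hF : Differentiable ℂ F) (ζ : E)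
    (m : ℕ) (y : κ → ℂ) : taylorTerm v F ζ m y = (m.factorial : ℂ)⁻¹ *
      iteratedDeriv m (fun t : ℂ => F (ζ + t • ∑ j, y j • v j)) 0 := by
  rw [iteratedDeriv_comp_eq_sum (fun j => dirDeriv (v j)) (Differentiable ℂ)
    (fun j g hg => dirDeriv_differentiable _ hg) (fun t : ℂ => ζ + t • ∑ j, y j • v j) y ?_ hF]
  · simp [taylorTerm]
  · intro g hg t
    have h := hasDerivAt_line hg ζ (∑ j, y j • v j) t
    rw [map_sum] at h
    simpa [dirDeriv] using h

theorem hasSum_taylorTerm (v : κ → E) {F : E → ℂ} (hF : Differentiable ℂ F) (ζ : E) (y : κ → ℂ) :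
    HasSum (fun m => taylorTerm v F ζ m y) (F (ζ + ∑ j, y j • v j)) := by
  have h := Complex.hasSum_taylorSeries_of_entire
    (differentiable_line hF ζ (∑ j, y j • v j)) 0 1
  simp only [one_smul, sub_zero, one_pow, smul_eq_mul, one_mul] at h
  simpa only [taylorTerm_eq_iteratedDeriv v hF] using h

theorem norm_taylorTerm_le (v : κ → E) {F : E → ℂ} (hF : Differentiable ℂ F) (ζ : E) (m : ℕ)
    (y : κ → ℂ) {M R : ℝ} (hR : 0 < R)
    (hM : ∀ t : ℂ, ‖t‖ = R → ‖F (ζ + t • ∑ j, y j • v j)‖ ≤ M) :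
    ‖taylorTerm v F ζ m y‖ ≤ M / R ^ m := by
  rw [taylorTerm_eq_iteratedDeriv v hF, norm_mul, norm_inv, Complex.norm_natCast]
  have h := Complex.norm_iteratedDeriv_le_of_forall_mem_sphere_norm_le m hR
    (differentiable_line hF ζ (∑ j, y j • v j)).diffContOnCl (C := M) (c := 0)
    (fun t ht => hM t (by simpa using ht))
  have hm : (0 : ℝ) < m.factorial := by exact_mod_cast m.factorial_pos
  calc _ ≤ (m.factorial : ℝ)⁻¹ * (m.factorial * M / R ^ m) := by gcongr
    _ = M / R ^ m := by field_simp

end Taylor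

/-! ### Cauchy estimates for `∂^κ` -/

section Cauchy

variable {ι : Type*} [Fintype ι]

theorem iteratedDeriv_line {E : Type*} [NormedAddCommGroup E] [NormedSpace ℂ E]
    [FiniteDimensional ℂ E] (v : E) {F : E → ℂ} (hF : Differentiable ℂ F) (ζ : E) (k : ℕ) (t : ℂ) :
    iteratedDeriv k (fun t : ℂ => F (ζ + t • v)) t = (dirDeriv v)^[k] F (ζ + t • v) := by
  have hd : ∀ k, Differentiable ℂ ((dirDeriv v)^[k] F) := by
    intro k
    induction k with
    | zero => exact hF
    | succ k ih => rw [Function.iterate_succ_apply']; exact dirDeriv_differentiable _ ih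
  induction k generalizing t with
  | zero => simp
  | succ k ih =>
    rw [iteratedDeriv_succ, funext ih, (hasDerivAt_line (hd k) ζ v t).deriv,
      Function.iterate_succ_apply']
    rfl

theorem iterate_dirDeriv_differentiable {E : Type*} [NormedAddCommGroup E] [NormedSpace ℂ E]
    [FiniteDimensional ℂ E] (v : E) {F : E → ℂ} (hF : Differentiable ℂ F) (k : ℕ) :
    Differentiable ℂ ((dirDeriv v)^[k] F) := by
  induction k with
  | zero => exact hF
  | succ k ih => rw [Function.iterate_succ_apply']; exact dirDeriv_differentiable _ ih

theorem norm_iterate_dirDeriv_le {E : Type*} [NormedAddCommGroup E] [NormedSpace ℂ E]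
    [FiniteDimensional ℂ E] (v : E) {F : E → ℂ} (hF : Differentiable ℂ F) (ζ : E) (k : ℕ)
    {M R : ℝ} (hR : 0 < R) (hM : ∀ t : ℂ, ‖t‖ ≤ R → ‖F (ζ + t • v)‖ ≤ M) :
    ‖(dirDeriv v)^[k] F ζ‖ ≤ k.factorial / R ^ k * M := by
  have h := Complex.norm_iteratedDeriv_le_of_forall_mem_sphere_norm_le k hR
    (differentiable_line hF ζ v).diffContOnCl (C := M) (c := 0)
    (fun t ht => hM t (by simpa using (mem_sphere_zero_iff_norm.1 ht).le))
  rw [iteratedDeriv_line v hF, zero_smul, add_zero] at h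
  rwa [div_mul_eq_mul_div]

variable [DecidableEq ι]

/-- The complex counterpart of `listDeriv`. -/
noncomputable def listDirDeriv (l : List ι) (κ : ι → ℕ) (F : (ι → ℂ) → ℂ) : (ι → ℂ) → ℂ :=
  l.foldr (fun j g => (dirDeriv (Pi.single j 1))^[κ j] g) F

theorem listDirDeriv_differentiable (l : List ι) (κ : ι → ℕ) {F : (ι → ℂ) → ℂ}
    (hF : Differentiable ℂ F) : Differentiable ℂ (listDirDeriv l κ F) := by
  induction l with
  | nil => exact hF
  | cons j l ih => exact iterate_dirDeriv_differentiable _ ih _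

theorem IsExt.iterate_pderiv {F : (ι → ℂ) → ℂ} {f : (ι → ℝ) → ℂ} (hF : IsExt F f) (j : ι) (k : ℕ) :
    IsExt ((dirDeriv (Pi.single j 1))^[k] F) ((WickFock.pderiv j)^[k] f) := by
  induction k with
  | zero => exact hF
  | succ k ih => rw [Function.iterate_succ_apply', Function.iterate_succ_apply']; exact ih.pderiv j

theorem IsExt.listDeriv {F : (ι → ℂ) → ℂ} {f : (ι → ℝ) → ℂ} (hF : IsExt F f) (l : List ι)
    (κ : ι → ℕ) : IsExt (listDirDeriv l κ F) (WickFock.listDeriv l κ f) := by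
  induction l with
  | nil => exact hF
  | cons j l ih => exact ih.iterate_pderiv j (κ j)

/-- Cauchy's estimate on a polydisc of radii `R_j`, where only the coordinates in `l` vary. -/
theorem norm_listDirDeriv_le {F : (ι → ℂ) → ℂ} (hF : Differentiable ℂ F) (κ : ι → ℕ) {R : ι → ℝ}
    (hR : ∀ j, 0 < R j) {M : ℝ} (l : List ι) (hl : l.Nodup) (ζ : ι → ℂ)
    (hM : ∀ η : ι → ℂ, (∀ j ∈ l, ‖η j‖ ≤ R j) → (∀ j ∉ l, η j = 0) → ‖F (ζ + η)‖ ≤ M) :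
    ‖listDirDeriv l κ F ζ‖ ≤ (l.map fun j => ((κ j).factorial / R j ^ κ j : ℝ)).prod * M := by
  induction l generalizing ζ with
  | nil => simpa [listDirDeriv] using hM 0 (by simp) (by simp)
  | cons j l ih =>
    have hjl := (List.nodup_cons.1 hl).1
    rw [List.map_cons, List.prod_cons, mul_assoc]
    refine norm_iterate_dirDeriv_le _ (listDirDeriv_differentiable l κ hF) ζ (κ j) (hR j)
      fun t ht => ?_
    -- The estimate in the variable `j` is applied to the derivative in the other variables.
    refine ih (List.nodup_cons.1 hl).2 _ fun η h1 h2 => ?_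
    rw [add_assoc]
    refine hM _ (fun i hi => ?_) (fun i hi => ?_)
    · rcases List.mem_cons.1 hi with rfl | hil
      · simpa [h2 _ hjl] using ht
      · have : i ≠ j := by rintro rfl; exact hjl hil
        simpa [this] using h1 i hil
    · have h3 := List.mem_cons.not.1 hi
      push Not at h3
      simp [h3.1, h2 i h3.2]

theorem norm_mderiv_le_polydisc {F : (ι → ℂ) → ℂ} {f : (ι → ℝ) → ℂ} (hF : IsExt F f) (κ : ι → ℕ)
    {R : ι → ℝ} (hR : ∀ j, 0 < R j) {M : ℝ} (x : ι → ℝ)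
    (hM : ∀ η : ι → ℂ, (∀ j, ‖η j‖ ≤ R j) → ‖F (toC x + η)‖ ≤ M) :
    ‖mderiv κ f x‖ ≤ (∏ j, ((κ j).factorial / R j ^ κ j : ℝ)) * M := by
  rw [mderiv, ← (hF.listDeriv _ κ).2 x]
  refine (norm_listDirDeriv_le hF.1 κ hR _ (Finset.nodup_toList _) _
    fun η h _ => hM η fun j => h j (by simp)).trans (le_of_eq ?_)
  rw [Finset.prod_map_toList]

omit [Fintype ι] [DecidableEq ι] in
/-- The contribution of one variable to Cauchy's estimate with the radius `e L max(k, 1)^{1/ρ}`: the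
factor `exp(k + 1)`, which bounds the growth of the function, is absorbed by the `e` in the radius. -/
theorem factorial_div_pow_le {ρ L : ℝ} (hρ : 1 < ρ) (hL : 0 < L) (k : ℕ) :
    (k.factorial : ℝ) / (Real.exp 1 * L * (max k 1 : ℝ) ^ (1 / ρ)) ^ k * Real.exp (k + 1) ≤
      Real.exp 1 * ((L ^ k)⁻¹ * (k.factorial : ℝ) ^ (1 - 1 / ρ)) := by
  have hk : (0 : ℝ) < k.factorial := by exact_mod_cast k.factorial_pos
  have hm : (0 : ℝ) < max (k : ℝ) 1 := lt_max_of_lt_right one_pos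
  have h1 : (k.factorial : ℝ) = (k.factorial : ℝ) ^ (1 / ρ) * (k.factorial : ℝ) ^ (1 - 1 / ρ) := by
    rw [← Real.rpow_add hk]; simp
  have h2 : (k.factorial : ℝ) ^ (1 / ρ) ≤ ((max k 1 : ℝ) ^ (1 / ρ)) ^ k := by
    rw [← Real.rpow_natCast, ← Real.rpow_mul hm.le, mul_comm, Real.rpow_mul hm.le,
      Real.rpow_natCast]
    refine Real.rpow_le_rpow hk.le ?_ (by positivity)
    calc (k.factorial : ℝ) ≤ (k : ℝ) ^ k := by exact_mod_cast Nat.factorial_le_pow k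
      _ ≤ _ := by gcongr; exact le_max_left _ _
  have hp : 0 < ((max k 1 : ℝ) ^ (1 / ρ)) ^ k := by positivity
  have he : Real.exp (k + 1) = Real.exp 1 ^ k * Real.exp 1 := by
    rw [Real.exp_add, ← Real.exp_nat_mul, mul_one]
  rw [mul_pow, mul_pow, he]
  calc _ = Real.exp 1 * (L ^ k)⁻¹ * ((k.factorial : ℝ) / ((max k 1 : ℝ) ^ (1 / ρ)) ^ k) := by
        field_simp
    _ ≤ Real.exp 1 * (L ^ k)⁻¹ * (k.factorial : ℝ) ^ (1 - 1 / ρ) := by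
        gcongr
        rw [div_le_iff₀ hp]
        nth_rewrite 1 [h1]
        rw [mul_comm]
        gcongr
    _ = _ := by ring

/-- Growth of order `ρ` and type `ε` of the entire extension near a real point `x` bounds the
derivatives `∂^κ f(x)`: Cauchy's estimate with the radii `R_j = e L max(κ_j, 1)^{1/ρ}`. -/
theorem exists_norm_mderiv_le {ρ : ℝ} (hρ : 1 < ρ) {L : ℝ} (hL : 0 < L) :
    ∃ ε K : ℝ, 0 < ε ∧ 0 < K ∧ ∀ (F : (ι → ℂ) → ℂ) (f : (ι → ℝ) → ℂ), IsExt F f →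
      ∀ (x : ι → ℝ) (M : ℝ), 0 ≤ M → (∀ ζ, ‖F (toC x + ζ)‖ ≤ M * Real.exp (ε * ‖ζ‖ ^ ρ)) →
      ∀ κ : ι → ℕ, ‖mderiv κ f x‖ ≤ K * M * (L ^ mabs κ)⁻¹ * (mfact κ : ℝ) ^ (1 - 1 / ρ) := by
  have hρ0 : 0 < ρ := by linarith
  set T : ℝ := (Real.exp 1 * L) ^ ρ with hT
  have hT0 : 0 < T := by positivity
  refine ⟨T⁻¹, ∏ _j : ι, Real.exp 1, by positivity, by positivity, fun F f hF x M hM0 hM κ => ?_⟩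
  have hm : ∀ j, (0 : ℝ) < max (κ j : ℝ) 1 := fun j => lt_max_of_lt_right one_pos
  set R : ι → ℝ := fun j => Real.exp 1 * L * (max (κ j) 1 : ℝ) ^ (1 / ρ) with hR
  have hR0 : ∀ j, 0 < R j := fun j => by have := hm j; positivity
  have hRρ : ∀ j, R j ^ ρ = T * max (κ j : ℝ) 1 := by
    intro j
    rw [hR]
    simp only
    rw [Real.mul_rpow (by positivity) (by have := hm j; positivity), ← Real.rpow_mul (hm j).le,
      one_div_mul_cancel hρ0.ne', Real.rpow_one]
  -- On the polydisc the growth factor `exp(ε‖η‖^ρ)` is at most `∏ exp(κ_j + 1)`.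
  have hsum : ∀ η : ι → ℂ, (∀ j, ‖η j‖ ≤ R j) → T⁻¹ * ‖η‖ ^ ρ ≤ ∑ j, ((κ j : ℝ) + 1) := by
    intro η hη
    have h0 : 0 ≤ T * ∑ j, ((κ j : ℝ) + 1) :=
      mul_nonneg hT0.le (Finset.sum_nonneg fun j _ => by positivity)
    rw [inv_mul_le_iff₀ hT0]
    have h1 : ‖η‖ ≤ (T * ∑ j, ((κ j : ℝ) + 1)) ^ (1 / ρ) := by
      refine (pi_norm_le_iff_of_nonneg (by positivity)).2 fun j => (hη j).trans ?_
      rw [one_div, Real.le_rpow_inv_iff_of_pos (hR0 j).le h0 hρ0, hRρ]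
      gcongr
      refine (max_le (by linarith) (by linarith [(Nat.cast_nonneg (κ j) : (0 : ℝ) ≤ _)])
        : max (κ j : ℝ) 1 ≤ κ j + 1).trans ?_
      exact Finset.single_le_sum (f := fun j => (κ j : ℝ) + 1) (fun i _ => by positivity)
        (Finset.mem_univ j)
    calc ‖η‖ ^ ρ ≤ ((T * ∑ j, ((κ j : ℝ) + 1)) ^ (1 / ρ)) ^ ρ := by gcongr
      _ = _ := by rw [← Real.rpow_mul h0, one_div_mul_cancel hρ0.ne', Real.rpow_one]
  have h := norm_mderiv_le_polydisc hF κ hR0 (M := M * Real.exp (∑ j, ((κ j : ℝ) + 1))) x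
    fun η hη => (hM η).trans (by gcongr; exact hsum η hη)
  refine h.trans ?_
  rw [Real.exp_sum, mul_left_comm, ← Finset.prod_mul_distrib]
  have hfac : (mfact κ : ℝ) ^ (1 - 1 / ρ) = ∏ j, ((κ j).factorial : ℝ) ^ (1 - 1 / ρ) := by
    rw [mfact]
    push_cast
    exact (Real.finsetProd_rpow _ _ (fun j _ => by positivity) _).symm
  have hL' : (L ^ mabs κ)⁻¹ = ∏ j, (L ^ κ j)⁻¹ := by
    rw [mabs, ← Finset.prod_pow_eq_pow_sum, Finset.prod_inv_distrib]
  calc M * ∏ j, ((κ j).factorial / R j ^ κ j * Real.exp (κ j + 1))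
      ≤ M * ∏ j, (Real.exp 1 * ((L ^ κ j)⁻¹ * ((κ j).factorial : ℝ) ^ (1 - 1 / ρ))) := by
        refine mul_le_mul_of_nonneg_left (Finset.prod_le_prod (fun j _ => ?_) fun j _ => ?_) hM0
        · have := hR0 j; positivity
        · exact factorial_div_pow_le hρ hL (κ j)
    _ = _ := by
        rw [Finset.prod_mul_distrib, Finset.prod_mul_distrib, hfac, hL']
        ring

/-- `(a + b)^ρ ≤ 2^ρ (a^ρ + b^ρ)`. -/
theorem add_rpow_le {a b ρ : ℝ} (ha : 0 ≤ a) (hb : 0 ≤ b) (hρ : 0 < ρ) :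
    (a + b) ^ ρ ≤ 2 ^ ρ * (a ^ ρ + b ^ ρ) := by
  have h1 : a + b ≤ 2 * max a b := by linarith [le_max_left a b, le_max_right a b]
  calc (a + b) ^ ρ ≤ (2 * max a b) ^ ρ := by gcongr
    _ = 2 ^ ρ * (max a b) ^ ρ := Real.mul_rpow (by norm_num) (le_max_of_le_left ha)
    _ ≤ _ := by
      gcongr
      have := Real.rpow_nonneg ha ρ
      have := Real.rpow_nonneg hb ρ
      rcases max_choice a b with h | h <;> rw [h] <;> linarith

/-- The seminorms of `𝓔^ρ` are dominated by the norms `sup |F(ζ)| exp(-ε‖ζ‖^ρ)` of entire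
extensions. -/
theorem exists_norm_mderiv_le_of_growth {ρ : ℝ} (hρ : 1 < ρ) {L : ℝ} (hL : 0 < L) :
    ∃ ε K : ℝ, 0 < ε ∧ 0 < K ∧ ∀ (F : (ι → ℂ) → ℂ) (f : (ι → ℝ) → ℂ), IsExt F f →
      ∀ C : ℝ, 0 ≤ C → (∀ ζ, ‖F ζ‖ ≤ C * Real.exp (ε * ‖ζ‖ ^ ρ)) →
      ∀ (κ : ι → ℕ) (x : ι → ℝ), ‖mderiv κ f x‖ ≤
        K * C * (L ^ mabs κ)⁻¹ * (mfact κ : ℝ) ^ (1 - 1 / ρ) * Real.exp ((‖x‖ / L) ^ ρ) := by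
  have hρ0 : 0 < ρ := by linarith
  obtain ⟨ε, K, hε, hK, h⟩ := exists_norm_mderiv_le (ι := ι) hρ hL
  have hL' : 0 < (L ^ ρ)⁻¹ := by positivity
  have h2 : (0 : ℝ) < 2 ^ ρ := by positivity
  refine ⟨min ε (L ^ ρ)⁻¹ / 2 ^ ρ, K, by positivity, hK, fun F f hF C hC hg κ x => ?_⟩
  have h1 := h F f hF x (C * Real.exp ((‖x‖ / L) ^ ρ)) (by positivity) (fun ζ => ?_) κ
  · refine h1.trans (le_of_eq ?_)
    ring
  · refine (hg _).trans ?_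
    rw [mul_assoc, ← Real.exp_add]
    gcongr
    calc min ε (L ^ ρ)⁻¹ / 2 ^ ρ * ‖toC x + ζ‖ ^ ρ
        ≤ min ε (L ^ ρ)⁻¹ / 2 ^ ρ * (‖x‖ + ‖ζ‖) ^ ρ := by
          gcongr
          exact (norm_add_le _ _).trans (by rw [norm_toC])
      _ ≤ min ε (L ^ ρ)⁻¹ / 2 ^ ρ * (2 ^ ρ * (‖x‖ ^ ρ + ‖ζ‖ ^ ρ)) := by
          gcongr
          exact add_rpow_le (norm_nonneg _) (norm_nonneg _) hρ0
      _ = min ε (L ^ ρ)⁻¹ * ‖x‖ ^ ρ + min ε (L ^ ρ)⁻¹ * ‖ζ‖ ^ ρ := by field_simp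
      _ ≤ (L ^ ρ)⁻¹ * ‖x‖ ^ ρ + ε * ‖ζ‖ ^ ρ := by
          gcongr
          · exact min_le_right _ _
          · exact min_le_left _ _
      _ = (‖x‖ / L) ^ ρ + ε * ‖ζ‖ ^ ρ := by
          rw [Real.div_rpow (norm_nonneg _) hL.le]; ring

/-- Growth of order `ρ` and minimal type. The entire functions with this property are the entire
extensions of the functions of class `𝓔^ρ`. -/
def MinType (ρ : ℝ) (F : (ι → ℂ) → ℂ) : Prop :=
  ∀ ε : ℝ, 0 < ε → ∃ C : ℝ, 0 ≤ C ∧ ∀ ζ, ‖F ζ‖ ≤ C * Real.exp (ε * ‖ζ‖ ^ ρ)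

theorem IsExt.memE {ρ : ℝ} (hρ : 1 < ρ) {F : (ι → ℂ) → ℂ} {f : (ι → ℝ) → ℂ} (hF : IsExt F f)
    (hg : MinType ρ F) : MemE ρ f := by
  refine ⟨hF.contDiff, fun L hL => ?_⟩
  obtain ⟨ε, K, hε, -, h⟩ := exists_norm_mderiv_le_of_growth (ι := ι) hρ hL
  obtain ⟨C, hC0, hC⟩ := hg ε hε
  exact ⟨K * C, fun κ x => h F f hF C hC0 hC κ x⟩

end Cauchy

/-! ### Functions of class `𝓔^ρ` extend to entire functions -/

section Extension

variable {ι : Type*} [Fintype ι] [DecidableEq ι]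

theorem pderiv_comm (i j : ι) {f : (ι → ℝ) → ℂ} (hf : ContDiff ℝ ∞ f) :
    pderiv i (pderiv j f) = pderiv j (pderiv i f) := by
  funext x
  have hd : Differentiable ℝ (fderiv ℝ f) :=
    (hf.fderiv_right (m := ∞) (by simp)).differentiable (by simp)
  have h : ∀ v w, fderiv ℝ (fun y => fderiv ℝ f y v) x w = fderiv ℝ (fderiv ℝ f) x w v := by
    intro v w
    rw [fderiv_clm_apply (hd x) (by fun_prop)]
    simp
  have hs : IsSymmSndFDerivAt ℝ f x := by
    refine hf.contDiffAt.isSymmSndFDerivAt ?_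
    rw [minSmoothness_of_isRCLikeNormedField]
    exact WithTop.coe_le_coe.2 (le_top : (2 : ℕ∞) ≤ ⊤)
  change fderiv ℝ (fun y => fderiv ℝ f y _) x _ = fderiv ℝ (fun y => fderiv ℝ f y _) x _
  rw [h, h]
  exact hs _ _

theorem foldr_pderiv_smooth (l : List ι) {f : (ι → ℝ) → ℂ} (hf : ContDiff ℝ ∞ f) :
    ContDiff ℝ ∞ (l.foldr pderiv f) := by
  induction l with
  | nil => exact hf
  | cons j l ih => exact pderiv_smooth j ih

theorem foldr_pderiv_perm {l l' : List ι} (h : l.Perm l') {f : (ι → ℝ) → ℂ}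
    (hf : ContDiff ℝ ∞ f) : l.foldr pderiv f = l'.foldr pderiv f := by
  induction h with
  | nil => rfl
  | cons j _ ih => simp only [List.foldr_cons, ih]
  | swap i j l => exact pderiv_comm _ _ (foldr_pderiv_smooth l hf)
  | trans _ _ ih1 ih2 => exact ih1.trans ih2

omit [Fintype ι] in
theorem listDeriv_eq_foldr (l : List ι) (κ : ι → ℕ) (f : (ι → ℝ) → ℂ) :
    listDeriv l κ f = (l.flatMap fun j => List.replicate (κ j) j).foldr pderiv f := by
  have hrep : ∀ (j : ι) (k : ℕ) (g : (ι → ℝ) → ℂ),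
      (List.replicate k j).foldr pderiv g = (pderiv j)^[k] g := by
    intro j k g
    induction k with
    | zero => rfl
    | succ k ih => rw [List.replicate_succ, List.foldr_cons, ih, Function.iterate_succ_apply']
  induction l with
  | nil => rfl
  | cons j l ih =>
    rw [List.flatMap_cons, List.foldr_append, ← ih, hrep]
    rfl

/-- Iterated partial derivatives in any order are multi-index derivatives. -/
theorem foldr_pderiv_eq_mderiv (l : List ι) {f : (ι → ℝ) → ℂ} (hf : ContDiff ℝ ∞ f) :
    l.foldr pderiv f = mderiv (fun j => l.count j) f := by
  rw [mderiv, listDeriv_eq_foldr]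
  refine foldr_pderiv_perm (List.perm_iff_count.2 fun a => ?_) hf
  rw [List.count_flatMap, Finset.sum_map_toList]
  simp [List.count_replicate]

theorem mabs_count (l : List ι) : mabs (fun j => l.count j) = l.length := by
  rw [mabs]
  simpa using Multiset.sum_count_eq_card (s := Finset.univ) (m := (l : Multiset ι)) (by simp)

/-- The bounds of `𝓔^ρ` for iterated derivatives: the multinomial coefficients are integers, so
`κ! ≤ |κ|!`. -/
theorem norm_foldr_pderiv_le {ρ L B : ℝ} (hρ : 1 < ρ) (hL : 0 < L) (hB0 : 0 ≤ B)
    {f : (ι → ℝ) → ℂ} (hf : ContDiff ℝ ∞ f) {x : ι → ℝ}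
    (hB : ∀ κ : ι → ℕ, ‖mderiv κ f x‖ ≤ B * (L ^ mabs κ)⁻¹ * (mfact κ : ℝ) ^ (1 - 1 / ρ))
    (l : List ι) : ‖l.foldr pderiv f x‖ ≤
      B * (L ^ l.length)⁻¹ * (l.length.factorial : ℝ) ^ (1 - 1 / ρ) := by
  rw [foldr_pderiv_eq_mderiv l hf]
  refine (hB _).trans ?_
  rw [mabs_count]
  have h1 : mfact (fun j => l.count j) ≤ l.length.factorial := by
    rw [← mabs_count l]
    exact Nat.le_of_dvd (Nat.factorial_pos _) (Nat.prod_factorial_dvd_factorial_sum _ _)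
  have h2 : 0 ≤ 1 - 1 / ρ := by
    rw [sub_nonneg, div_le_one (by linarith)]; exact hρ.le
  gcongr

omit [Fintype ι] [DecidableEq ι] in
/-- The elementary inequality that gives a geometric majorant of order `ρ` for Taylor series:
`(2y)^m / m!^{1/ρ} = ((2y)^{ρm} / m!)^{1/ρ}`, which is at most `exp((2y)^ρ)`. -/
theorem pow_mul_factorial_rpow_le {ρ y : ℝ} (hρ : 1 < ρ) (hy : 0 ≤ y) (m : ℕ) :
    y ^ m * (m.factorial : ℝ) ^ (1 - 1 / ρ) / m.factorial ≤ (1 / 2) ^ m * Real.exp ((2 * y) ^ ρ) := by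
  have hm : (0 : ℝ) < m.factorial := by exact_mod_cast m.factorial_pos
  have hρ0 : 0 < ρ := by linarith
  have h1 : (2 * y) ^ m / (m.factorial : ℝ) ^ (1 / ρ) ≤ Real.exp ((2 * y) ^ ρ) := by
    have h2 : ((2 * y) ^ m / (m.factorial : ℝ) ^ (1 / ρ)) =
        (((2 * y) ^ ρ) ^ m / m.factorial) ^ (1 / ρ) := by
      rw [Real.div_rpow (by positivity) hm.le, ← Real.rpow_natCast, ← Real.rpow_natCast,
        ← Real.rpow_mul (by positivity), ← Real.rpow_mul (by positivity)]
      congr 2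
      field_simp
    rw [h2]
    calc (((2 * y) ^ ρ) ^ m / m.factorial) ^ (1 / ρ) ≤ (Real.exp ((2 * y) ^ ρ)) ^ (1 / ρ) := by
          gcongr
          exact Real.pow_div_factorial_le_exp _ (by positivity) m
      _ ≤ (Real.exp ((2 * y) ^ ρ)) ^ (1 : ℝ) := by
          refine Real.rpow_le_rpow_of_exponent_le (Real.one_le_exp (by positivity)) ?_
          rw [div_le_one hρ0]; exact hρ.le
      _ = _ := Real.rpow_one _
  calc _ = (1 / 2) ^ m * ((2 * y) ^ m / (m.factorial : ℝ) ^ (1 / ρ)) := by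
        rw [Real.rpow_sub hm, Real.rpow_one, mul_pow]
        field_simp
        rw [mul_assoc, ← mul_pow]
        norm_num
    _ ≤ _ := by gcongr

/-- A geometric bound for the homogeneous parts of the Taylor series at a real point, with growth of
order `ρ` in `ζ` whose type tends to `0` as `L` tends to infinity. -/
theorem norm_taylor_sum_le {ρ L B : ℝ} (hρ : 1 < ρ) (hL : 0 < L) (hB0 : 0 ≤ B)
    {f : (ι → ℝ) → ℂ} (hf : ContDiff ℝ ∞ f) {x : ι → ℝ}
    (hB : ∀ κ : ι → ℕ, ‖mderiv κ f x‖ ≤ B * (L ^ mabs κ)⁻¹ * (mfact κ : ℝ) ^ (1 - 1 / ρ))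
    (m : ℕ) (ζ : ι → ℂ) :
    ‖(m.factorial : ℂ)⁻¹ * ∑ J : Fin m → ι, (∏ k, ζ (J k)) * (List.ofFn J).foldr pderiv f x‖ ≤
      (1 / 2) ^ m * (B * Real.exp ((2 * (Fintype.card ι * ‖ζ‖ / L)) ^ ρ)) := by
  have hm : (0 : ℝ) < m.factorial := by exact_mod_cast m.factorial_pos
  have h1 : ‖∑ J : Fin m → ι, (∏ k, ζ (J k)) * (List.ofFn J).foldr pderiv f x‖ ≤
      ∑ _J : Fin m → ι, ‖ζ‖ ^ m * (B * (L ^ m)⁻¹ * (m.factorial : ℝ) ^ (1 - 1 / ρ)) := by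
    refine norm_sum_le_of_le _ fun J _ => ?_
    rw [norm_mul]
    gcongr
    · rw [norm_prod]
      refine (Finset.prod_le_prod (fun _ _ => norm_nonneg _)
        (fun k _ => norm_le_pi_norm ζ (J k))).trans ?_
      simp
    · simpa using norm_foldr_pderiv_le hρ hL hB0 hf hB (List.ofFn J)
  rw [norm_mul, norm_inv, Complex.norm_natCast]
  calc _ ≤ (m.factorial : ℝ)⁻¹ *
        ∑ _J : Fin m → ι, ‖ζ‖ ^ m * (B * (L ^ m)⁻¹ * (m.factorial : ℝ) ^ (1 - 1 / ρ)) := by gcongr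
    _ = B * ((Fintype.card ι * ‖ζ‖ / L) ^ m * (m.factorial : ℝ) ^ (1 - 1 / ρ) / m.factorial) := by
        simp only [Finset.sum_const, Finset.card_univ, Fintype.card_pi, Finset.prod_const,
          Fintype.card_fin, nsmul_eq_mul, div_pow, mul_pow]
        push_cast
        field_simp
    _ ≤ B * ((1 / 2) ^ m * Real.exp ((2 * (Fintype.card ι * ‖ζ‖ / L)) ^ ρ)) := by
        gcongr
        exact pow_mul_factorial_rpow_le hρ (by positivity) m
    _ = _ := by ring

/-- The homogeneous part of degree `m` of the Taylor series of `f` at the origin, as a polynomial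
on `ℂ^d`. -/
noncomputable def taylorPoly (f : (ι → ℝ) → ℂ) (m : ℕ) (ζ : ι → ℂ) : ℂ :=
  (m.factorial : ℂ)⁻¹ * ∑ J : Fin m → ι, (∏ k, ζ (J k)) * (List.ofFn J).foldr pderiv f 0

theorem taylorPoly_differentiable (f : (ι → ℝ) → ℂ) (m : ℕ) :
    Differentiable ℂ (taylorPoly f m) := by
  unfold taylorPoly; fun_prop

variable {ρ L C : ℝ} {f : (ι → ℝ) → ℂ}

theorem norm_taylorPoly_le (hρ : 1 < ρ) (hL : 0 < L) (hC0 : 0 ≤ C) (hf : ContDiff ℝ ∞ f)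
    (hC : ∀ (κ : ι → ℕ) (x : ι → ℝ), ‖mderiv κ f x‖ ≤
      C * (L ^ mabs κ)⁻¹ * (mfact κ : ℝ) ^ (1 - 1 / ρ) * Real.exp ((‖x‖ / L) ^ ρ))
    (m : ℕ) (ζ : ι → ℂ) : ‖taylorPoly f m ζ‖ ≤
      (1 / 2) ^ m * (C * Real.exp ((2 * (Fintype.card ι * ‖ζ‖ / L)) ^ ρ)) := by
  have hρ0 : ρ ≠ 0 := by linarith
  exact norm_taylor_sum_le hρ hL hC0 hf
    (fun κ => by simpa [Real.zero_rpow hρ0] using hC κ 0) m ζ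

theorem hasDerivAt_smul_line {g : (ι → ℝ) → ℂ} (hg : ContDiff ℝ ∞ g) (x : ι → ℝ) (t : ℝ) :
    HasDerivAt (fun t : ℝ => g (t • x)) (∑ j, x j • pderiv j g (t • x)) t := by
  have h1 : HasDerivAt (fun t : ℝ => t • x) x t := by
    simpa using (hasDerivAt_id t).smul_const x
  have h2 := ((hg.differentiable (by simp)) (t • x)).hasFDerivAt.comp_hasDerivAt t h1
  have h3 : ∀ y, fderiv ℝ g y x = ∑ j, x j • pderiv j g y := by
    intro y
    conv_lhs => rw [← (Pi.basisFun ℝ ι).sum_repr x, map_sum]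
    simp [pderiv]
  rwa [h3] at h2

/-- On `ℝ^d` the function is the sum of its Taylor series. -/
theorem tsum_taylorPoly (hρ : 1 < ρ) (hL : 0 < L) (hC0 : 0 ≤ C) (hf : ContDiff ℝ ∞ f)
    (hC : ∀ (κ : ι → ℕ) (x : ι → ℝ), ‖mderiv κ f x‖ ≤
      C * (L ^ mabs κ)⁻¹ * (mfact κ : ℝ) ^ (1 - 1 / ρ) * Real.exp ((‖x‖ / L) ^ ρ))
    (x : ι → ℝ) : ∑' m, taylorPoly f m (toC x) = f x := by
  have hρ0 : 0 < ρ := by linarith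
  have hsum : Summable fun m => taylorPoly f m (toC x) :=
    Summable.of_norm_bounded
      ((summable_geometric_of_lt_one (by norm_num) (by norm_num)).mul_right _)
      (norm_taylorPoly_le hρ hL hC0 hf hC · (toC x))
  set h : ℝ → ℂ := fun t => f (t • x) with hh
  have hhs : ContDiff ℝ ∞ h := hf.comp (by fun_prop)
  have hder : ∀ (m : ℕ) (t : ℝ), iteratedDeriv m h t =
      ∑ J : Fin m → ι, (∏ k, x (J k)) • (List.ofFn J).foldr pderiv f (t • x) := fun m t =>
    iteratedDeriv_comp_eq_sum pderiv (ContDiff ℝ ∞) (fun j _ hg => pderiv_smooth j hg)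
      (fun t : ℝ => t • x) x (fun g hg t => hasDerivAt_smul_line hg x t) hf m t
  have hwithin : ∀ (m : ℕ) (t : ℝ), t ∈ Set.Icc (0 : ℝ) 1 →
      iteratedDerivWithin m h (Set.Icc 0 1) t = iteratedDeriv m h t := fun m t ht =>
    iteratedDerivWithin_eq_iteratedDeriv (uniqueDiffOn_Icc one_pos)
      (hhs.contDiffAt.of_le (by exact_mod_cast le_top)) ht
  set d : ℝ := ((Fintype.card ι : ℕ) : ℝ) with hd
  set B : ℝ := C * Real.exp ((‖x‖ / L) ^ ρ) * Real.exp ((2 * (d * ‖x‖ / L)) ^ ρ) with hB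
  -- The derivatives of `t ↦ f(t x)` on `[0, 1]` grow slowly enough for the Taylor remainder to vanish.
  have hbound : ∀ (m : ℕ) (t : ℝ), t ∈ Set.Icc (0 : ℝ) 1 →
      ‖iteratedDeriv m h t‖ ≤ (1 / 2) ^ m * B * m.factorial := by
    intro m t ht
    have hm : (0 : ℝ) < m.factorial := by exact_mod_cast m.factorial_pos
    have htx : ‖t • x‖ ≤ ‖x‖ := by
      rw [norm_smul, Real.norm_eq_abs, abs_of_nonneg ht.1]
      exact mul_le_of_le_one_left (norm_nonneg _) ht.2
    rw [hder]
    calc _ ≤ ∑ _J : Fin m → ι, ‖x‖ ^ m * (C * (L ^ m)⁻¹ * (m.factorial : ℝ) ^ (1 - 1 / ρ) *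
          Real.exp ((‖x‖ / L) ^ ρ)) := by
          refine norm_sum_le_of_le _ fun J _ => ?_
          rw [norm_smul]
          gcongr
          · rw [norm_prod]
            refine (Finset.prod_le_prod (fun _ _ => norm_nonneg _)
              (fun k _ => norm_le_pi_norm x (J k))).trans ?_
            simp
          · have := norm_foldr_pderiv_le hρ hL (B := C * Real.exp ((‖x‖ / L) ^ ρ)) (by positivity)
              hf (x := t • x) (fun κ => (hC κ (t • x)).trans ?_) (List.ofFn J)
            · rw [List.length_ofFn] at this
              exact this.trans (le_of_eq (by ring))
            · calc _ ≤ C * (L ^ mabs κ)⁻¹ * (mfact κ : ℝ) ^ (1 - 1 / ρ) *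
                    Real.exp ((‖x‖ / L) ^ ρ) := by gcongr
                _ = _ := by ring
      _ = C * Real.exp ((‖x‖ / L) ^ ρ) * ((d * ‖x‖ / L) ^ m *
          (m.factorial : ℝ) ^ (1 - 1 / ρ) / m.factorial) * m.factorial := by
          simp only [Finset.sum_const, Finset.card_univ, Fintype.card_pi, Finset.prod_const,
            Fintype.card_fin, nsmul_eq_mul, div_pow, mul_pow, hd]
          push_cast
          field_simp
      _ ≤ C * Real.exp ((‖x‖ / L) ^ ρ) * ((1 / 2) ^ m * Real.exp ((2 * (d * ‖x‖ / L)) ^ ρ)) *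
          m.factorial := by
          gcongr
          exact pow_mul_factorial_rpow_le hρ (by positivity) m
      _ = _ := by rw [hB]; ring
  have hrem : ∀ N : ℕ, ‖f x - ∑ m ∈ Finset.range (N + 1), taylorPoly f m (toC x)‖ ≤
      B * (((N + 1 : ℕ) : ℝ) * (1 / 2) ^ (N + 1)) := by
    intro N
    have hT := taylor_mean_remainder_bound (f := h) (a := 0) (b := 1) (x := 1) (n := N)
      (C := (1 / 2) ^ (N + 1) * B * (N + 1).factorial) zero_le_one
      (hhs.contDiffOn.of_le (by exact_mod_cast le_top)) (by simp)
      (fun t ht => by rw [hwithin _ t ht]; exact hbound _ t ht)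
    rw [taylor_within_apply] at hT
    have h1 : h 1 = f x := by simp [hh]
    have h2 : ∀ m, (((m.factorial : ℝ))⁻¹ * (1 - 0) ^ m) • iteratedDerivWithin m h (Set.Icc 0 1) 0 =
        taylorPoly f m (toC x) := by
      intro m
      rw [hwithin m 0 (by simp), hder, taylorPoly]
      simp
    simp only [h1, h2] at hT
    refine hT.trans (le_of_eq ?_)
    rw [Nat.factorial_succ]
    have hm : (N.factorial : ℝ) ≠ 0 := by exact_mod_cast N.factorial_ne_zero
    push_cast
    field_simp
    simp
  refine hsum.hasSum_iff.1 ?_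
  refine (hsum.hasSum_iff_tendsto_nat).2 ?_
  rw [← Filter.tendsto_add_atTop_iff_nat 1, tendsto_iff_norm_sub_tendsto_zero]
  have hlim : Filter.Tendsto (fun N : ℕ => B * (((N + 1 : ℕ) : ℝ) * (1 / 2) ^ (N + 1)))
      Filter.atTop (nhds 0) := by
    have := (tendsto_self_mul_const_pow_of_lt_one (r := 1 / 2) (by norm_num)
      (by norm_num)).comp (Filter.tendsto_add_atTop_nat 1)
    simpa using this.const_mul B
  refine squeeze_zero (fun _ => norm_nonneg _) (fun N => ?_) hlim
  rw [norm_sub_rev]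
  exact hrem N

/-- A series of entire functions with a locally bounded geometric majorant is entire. -/
theorem differentiable_tsum_geometric {E : Type*} [NormedAddCommGroup E] [NormedSpace ℂ E]
    {T : ℕ → E → ℂ} (hT : ∀ m, Differentiable ℂ (T m)) {B : ℝ → ℝ}
    (hB : ∀ R m ζ, ‖ζ‖ ≤ R → ‖T m ζ‖ ≤ (1 / 2) ^ m * B R) :
    Differentiable ℂ fun ζ => ∑' m, T m ζ := by
  intro ζ
  have hgeo : Summable fun m : ℕ => (1 / 2 : ℝ) ^ m * B (‖ζ‖ + 2) :=
    (summable_geometric_of_lt_one (by norm_num) (by norm_num)).mul_right _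
  refine (hasFDerivAt_tsum_of_isPreconnected (s := Metric.ball ζ 1) (x₀ := ζ)
    (f' := fun m => fderiv ℂ (T m)) hgeo Metric.isOpen_ball
    ((convex_ball ζ 1).isPreconnected) (fun m y _ => (hT m y).hasFDerivAt) (fun m y hy => ?_)
    (Metric.mem_ball_self one_pos) ?_ (Metric.mem_ball_self one_pos)).differentiableAt
  · have hy1 : ‖y - ζ‖ < 1 := by simpa [dist_eq_norm] using hy
    refine (norm_fderiv_le_of_ball (hT m) one_pos (fun w hw => hB (‖ζ‖ + 2) m w ?_)).trans
      (by simp)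
    have h1 : w = (w - y) + (y - ζ) + ζ := by abel
    calc ‖w‖ = ‖(w - y) + (y - ζ) + ζ‖ := by rw [← h1]
      _ ≤ ‖w - y‖ + ‖y - ζ‖ + ‖ζ‖ := norm_add₃_le
      _ ≤ _ := by linarith
  · exact Summable.of_norm_bounded hgeo fun m => hB _ m ζ (by linarith)

/-- Functions with the bounds of `𝓔^ρ` for a single `L` have an entire extension, given by the
Taylor series at the origin. -/
theorem isExt_tsum_taylorPoly (hρ : 1 < ρ) (hL : 0 < L) (hC0 : 0 ≤ C) (hf : ContDiff ℝ ∞ f)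
    (hC : ∀ (κ : ι → ℕ) (x : ι → ℝ), ‖mderiv κ f x‖ ≤
      C * (L ^ mabs κ)⁻¹ * (mfact κ : ℝ) ^ (1 - 1 / ρ) * Real.exp ((‖x‖ / L) ^ ρ)) :
    IsExt (fun ζ => ∑' m, taylorPoly f m ζ) f := by
  refine ⟨differentiable_tsum_geometric (taylorPoly_differentiable f)
    (B := fun R => C * Real.exp ((2 * (Fintype.card ι * R / L)) ^ ρ)) fun R m ζ hζ =>
      (norm_taylorPoly_le hρ hL hC0 hf hC m ζ).trans ?_, tsum_taylorPoly hρ hL hC0 hf hC⟩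
  have : 0 ≤ ρ := by linarith
  gcongr

variable (ι) in
omit [DecidableEq ι] in
/-- For large `L` the type in the growth bounds of Taylor series is as small as desired. -/
theorem exists_rpow_div_le {ρ ε : ℝ} (hρ0 : 0 < ρ) (hε : 0 < ε) :
    ∃ L : ℝ, 0 < L ∧ (2 * Fintype.card ι / L) ^ ρ ≤ ε := by
  refine ⟨(2 * Fintype.card ι + 1) / ε ^ (1 / ρ), by positivity, ?_⟩
  calc (2 * Fintype.card ι / ((2 * Fintype.card ι + 1) / ε ^ (1 / ρ)) : ℝ) ^ ρ
      ≤ (ε ^ (1 / ρ)) ^ ρ := by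
        gcongr
        rw [div_div_eq_mul_div, div_le_iff₀ (by positivity), mul_comm]
        gcongr
        linarith
    _ = ε := by rw [← Real.rpow_mul hε.le, one_div_mul_cancel hρ0.ne', Real.rpow_one]

/-- The bounds on the derivatives of `f` at a real point control the entire extension on the whole
complex space, with that point as origin. -/
theorem IsExt.norm_le_of_mderiv {B : ℝ} {F : (ι → ℂ) → ℂ} (hF : IsExt F f) (hρ : 1 < ρ)
    (hL : 0 < L) (hB0 : 0 ≤ B) {x : ι → ℝ}
    (hB : ∀ κ : ι → ℕ, ‖mderiv κ f x‖ ≤ B * (L ^ mabs κ)⁻¹ * (mfact κ : ℝ) ^ (1 - 1 / ρ))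
    (ζ : ι → ℂ) :
    ‖F (toC x + ζ)‖ ≤ 2 * B * Real.exp ((2 * Fintype.card ι / L) ^ ρ * ‖ζ‖ ^ ρ) := by
  have hder : ∀ l : List ι, IsExt (l.foldr (fun j => dirDeriv (Pi.single j 1)) F)
      (l.foldr WickFock.pderiv f) := by
    intro l
    induction l with
    | nil => exact hF
    | cons j l ih => exact ih.pderiv j
  have hs := hasSum_taylorTerm (fun j : ι => (Pi.single j 1 : ι → ℂ)) hF.1 (toC x) ζ
  have hζ : ∑ j, ζ j • (Pi.single j 1 : ι → ℂ) = ζ := by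
    funext i
    simp [Finset.sum_apply, Pi.single_apply]
  have hb : ∀ m, ‖taylorTerm (fun j : ι => (Pi.single j 1 : ι → ℂ)) F (toC x) m ζ‖ ≤
      (1 / 2) ^ m * (B * Real.exp ((2 * (Fintype.card ι * ‖ζ‖ / L)) ^ ρ)) := by
    intro m
    have h := norm_taylor_sum_le hρ hL hB0 hF.contDiff hB m ζ
    simpa only [taylorTerm, (hder _).2 x] using h
  rw [hζ] at hs
  rw [← hs.tsum_eq]
  refine (tsum_of_norm_bounded (HasSum.mul_right _
    (hasSum_geometric_of_lt_one (r := 1 / 2) (by norm_num) (by norm_num))) hb).trans (le_of_eq ?_)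
  rw [← Real.mul_rpow (by positivity) (norm_nonneg _)]
  ring_nf

/-- The norm `‖f‖_L` controls the growth of the entire extension of `f`. -/
theorem IsExt.norm_le_of_memE {F : (ι → ℂ) → ℂ} (hF : IsExt F f) (hρ : 1 < ρ)
    (hL : 0 < L) (hC0 : 0 ≤ C) (hC : ∀ (κ : ι → ℕ) (x : ι → ℝ), ‖mderiv κ f x‖ ≤
      C * (L ^ mabs κ)⁻¹ * (mfact κ : ℝ) ^ (1 - 1 / ρ) * Real.exp ((‖x‖ / L) ^ ρ)) (ζ : ι → ℂ) :
    ‖F ζ‖ ≤ 2 * C * Real.exp ((2 * Fintype.card ι / L) ^ ρ * ‖ζ‖ ^ ρ) := by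
  have hρ0 : ρ ≠ 0 := by linarith
  have h0 : toC (0 : ι → ℝ) + ζ = ζ := by funext j; simp
  have h := hF.norm_le_of_mderiv hρ hL hC0 (x := 0)
    (fun κ => by simpa [Real.zero_rpow hρ0] using hC κ 0) ζ
  rwa [h0] at h

theorem MemE.exists_nonneg_bound (hf : MemE ρ f) (hL : 0 < L) :
    ∃ C : ℝ, 0 ≤ C ∧ ∀ (κ : ι → ℕ) (x : ι → ℝ), ‖mderiv κ f x‖ ≤
      C * (L ^ mabs κ)⁻¹ * (mfact κ : ℝ) ^ (1 - 1 / ρ) * Real.exp ((‖x‖ / L) ^ ρ) := by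
  obtain ⟨C, hC⟩ := hf.2 L hL
  refine ⟨|C|, abs_nonneg C, fun κ x => (hC κ x).trans ?_⟩
  gcongr
  exact le_abs_self C

/-- Functions of class `𝓔^ρ` have entire extensions of order `ρ` and minimal type. The Taylor series
at the origin is the same for all `L`, so the bounds for all `L` hold for a single extension. -/
theorem MemE.exists_isExt (hρ : 1 < ρ) (hf : MemE ρ f) : ∃ F, IsExt F f ∧ MinType ρ F := by
  obtain ⟨C, hC0, hC⟩ := hf.exists_nonneg_bound one_pos
  have hF := isExt_tsum_taylorPoly hρ one_pos hC0 hf.1 hC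
  refine ⟨_, hF, fun ε hε => ?_⟩
  obtain ⟨L, hL, hLε⟩ := exists_rpow_div_le ι (by linarith : 0 < ρ) hε
  obtain ⟨C', hC0', hC'⟩ := hf.exists_nonneg_bound hL
  refine ⟨2 * C', by positivity, fun ζ => (hF.norm_le_of_memE hρ hL hC0' hC' ζ).trans ?_⟩
  gcongr

end Extension

/-! ### Holomorphic coordinates on the complexified phase space -/

section Coordinates

variable {n : ℕ}

/-- The point of the complexified phase space with holomorphic coordinates `z = u`, `z̄ = 0`, where
`z` and `z̄` are treated as independent variables. -/
noncomputable def zPart (ς : ℝ) : (Fin n → ℂ) →L[ℂ] (PQ n → ℂ) :=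
  LinearMap.toContinuousLinearMap
    { toFun := fun u => Sum.elim (fun j => -(Complex.I * ς / Real.sqrt 2) * u j)
        (fun j => (ς : ℂ)⁻¹ / Real.sqrt 2 * u j)
      map_add' := fun u w => by ext (j | j) <;> simp [mul_add]
      map_smul' := fun c u => by ext (j | j) <;> simp <;> ring }

/-- The point of the complexified phase space with holomorphic coordinates `z = 0`, `z̄ = w`. -/
noncomputable def zbarPart (ς : ℝ) : (Fin n → ℂ) →L[ℂ] (PQ n → ℂ) :=
  LinearMap.toContinuousLinearMap
    { toFun := fun w => Sum.elim (fun j => Complex.I * ς / Real.sqrt 2 * w j)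
        (fun j => (ς : ℂ)⁻¹ / Real.sqrt 2 * w j)
      map_add' := fun u w => by ext (j | j) <;> simp [mul_add]
      map_smul' := fun c u => by ext (j | j) <;> simp <;> ring }

theorem zPart_apply (ς : ℝ) (u : Fin n → ℂ) : zPart ς u =
    Sum.elim (fun j => -(Complex.I * ς / Real.sqrt 2) * u j)
      (fun j => (ς : ℂ)⁻¹ / Real.sqrt 2 * u j) := rfl

theorem zbarPart_apply (ς : ℝ) (w : Fin n → ℂ) : zbarPart ς w =
    Sum.elim (fun j => Complex.I * ς / Real.sqrt 2 * w j)
      (fun j => (ς : ℂ)⁻¹ / Real.sqrt 2 * w j) := rfl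

theorem toC_ofZ (ς : ℝ) (z : Fin n → ℂ) : toC (ofZ ς z) = zPart ς z + zbarPart ς (star z) := by
  have h2 : ((Real.sqrt 2 : ℝ) : ℂ) * (Real.sqrt 2 : ℝ) = 2 := by
    rw [← Complex.ofReal_mul, Real.mul_self_sqrt (by norm_num)]; norm_num
  have h0 : ((Real.sqrt 2 : ℝ) : ℂ) ≠ 0 := by intro h; rw [h] at h2; norm_num at h2
  ext (j | j)
  · simp only [toC_apply, ofZ, Sum.elim_inl, Pi.add_apply, zPart_apply, zbarPart_apply,
      Pi.star_apply, RCLike.star_def]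
    have h3 : z j - (starRingEnd ℂ) (z j) = 2 * (z j).im * Complex.I := by
      rw [Complex.sub_conj]; push_cast; ring
    push_cast
    field_simp
    linear_combination (Complex.I * ς) * h3 + (ς * (z j).im) * h2 + 2 * ς * (z j).im * Complex.I_sq
  · simp only [toC_apply, ofZ, Sum.elim_inr, Pi.add_apply, zPart_apply, zbarPart_apply,
      Pi.star_apply, RCLike.star_def]
    have h3 : z j + (starRingEnd ℂ) (z j) = 2 * (z j).re := by
      rw [Complex.add_conj]; push_cast; ring
    push_cast
    rw [← mul_add, h3]
    field_simp
    linear_combination ((ς : ℂ)⁻¹ * (z j).re) * h2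

theorem ofZ_surjective {ς : ℝ} (hς : 0 < ς) : Function.Surjective (ofZ (n := n) ς) := by
  intro x
  have h2 : (0 : ℝ) < Real.sqrt 2 := by positivity
  refine ⟨fun j => ⟨ς / Real.sqrt 2 * x (Sum.inr j), (Real.sqrt 2 * ς)⁻¹ * x (Sum.inl j)⟩, ?_⟩
  ext (j | j)
  · simp only [ofZ, Sum.elim_inl]
    field_simp
  · simp only [ofZ, Sum.elim_inr]
    field_simp

theorem continuous_ofZ (ς : ℝ) : Continuous (ofZ (n := n) ς) := by
  refine continuous_pi fun i => ?_
  rcases i with j | j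
  · simp only [ofZ, Sum.elim_inl]; fun_prop
  · simp only [ofZ, Sum.elim_inr]; fun_prop

/-- A common bound for the operator norms of `zPart` and `zbarPart`, relative to `hnorm`. -/
noncomputable def coordBound (n : ℕ) (ς : ℝ) : ℝ := ‖zPart (n := n) ς‖ + ‖zbarPart (n := n) ς‖ + 1

theorem coordBound_pos (ς : ℝ) : 0 < coordBound n ς := by unfold coordBound; positivity

theorem norm_zPart_le (ς : ℝ) (u : Fin n → ℂ) : ‖zPart ς u‖ ≤ coordBound n ς * hnorm u := by
  have h := norm_nonneg (zbarPart (n := n) ς)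
  refine ((zPart ς).le_opNorm u).trans
    (mul_le_mul ?_ (norm_le_hnorm u) (norm_nonneg _) (coordBound_pos ς).le)
  unfold coordBound
  linarith

theorem norm_zbarPart_le (ς : ℝ) (u : Fin n → ℂ) : ‖zbarPart ς u‖ ≤ coordBound n ς * hnorm u := by
  have h := norm_nonneg (zPart (n := n) ς)
  refine ((zbarPart ς).le_opNorm u).trans
    (mul_le_mul ?_ (norm_le_hnorm u) (norm_nonneg _) (coordBound_pos ς).le)
  unfold coordBound
  linarith

theorem rpow_le_one_add_sq {ρ t : ℝ} (hρ : 0 ≤ ρ) (hρ' : ρ ≤ 2) (ht : 0 ≤ t) :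
    t ^ ρ ≤ 1 + t ^ 2 := by
  rcases le_total t 1 with h | h
  · have := Real.rpow_le_one ht h hρ
    nlinarith [sq_nonneg t]
  · have := Real.rpow_le_rpow_of_exponent_le h hρ'
    rw [Real.rpow_two] at this
    linarith

/-- A function of order at most `2` and minimal type is dominated by every Gaussian. -/
theorem MinType.exists_gauss {ρ : ℝ} (hρ : 0 ≤ ρ) (hρ' : ρ ≤ 2) (ς : ℝ) {F : (PQ n → ℂ) → ℂ}
    (hF : MinType ρ F) {ε : ℝ} (hε : 0 < ε) : ∃ C : ℝ, 0 ≤ C ∧ ∀ u b : Fin n → ℂ,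
      ‖F (zPart ς u + zbarPart ς b)‖ ≤ C * Real.exp (ε * (hnorm u ^ 2 + hnorm b ^ 2)) := by
  have hc := coordBound_pos (n := n) ς
  set c := coordBound n ς
  obtain ⟨C, hC0, hC⟩ := hF (ε / (2 * c ^ 2)) (by positivity)
  refine ⟨C * Real.exp (ε / (2 * c ^ 2)), by positivity, fun u b => (hC _).trans ?_⟩
  rw [mul_assoc, ← Real.exp_add]
  gcongr
  have h1 : ‖zPart ς u + zbarPart ς b‖ ≤ c * (hnorm u + hnorm b) := by
    refine (norm_add_le _ _).trans ?_
    rw [mul_add]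
    exact add_le_add (norm_zPart_le ς u) (norm_zbarPart_le ς b)
  calc ε / (2 * c ^ 2) * ‖zPart ς u + zbarPart ς b‖ ^ ρ
      ≤ ε / (2 * c ^ 2) * (1 + ‖zPart ς u + zbarPart ς b‖ ^ 2) := by
        gcongr
        exact rpow_le_one_add_sq hρ hρ' (norm_nonneg _)
    _ ≤ ε / (2 * c ^ 2) * (1 + (c * (hnorm u + hnorm b)) ^ 2) := by gcongr
    _ = ε / (2 * c ^ 2) + ε / 2 * (hnorm u + hnorm b) ^ 2 := by field_simp
    _ ≤ ε / (2 * c ^ 2) + ε * (hnorm u ^ 2 + hnorm b ^ 2) := by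
        have : (hnorm u + hnorm b) ^ 2 ≤ 2 * (hnorm u ^ 2 + hnorm b ^ 2) := by
          nlinarith [sq_nonneg (hnorm u - hnorm b)]
        have h3 : ε / 2 * (hnorm u + hnorm b) ^ 2 ≤ ε / 2 * (2 * (hnorm u ^ 2 + hnorm b ^ 2)) := by
          gcongr
        linarith

end Coordinates

/-! ### Operators with a given Wick symbol -/

section Operator

variable {n : ℕ} {ℏ ς ρ : ℝ}

/-- The operator with Wick symbol `F`, as an integral operator with kernel
`F(u, b) exp(b·u/ℏ)`. The argument `b` stands for `z̄`. -/
noncomputable def wop (ℏ ς : ℝ) (F : (PQ n → ℂ) → ℂ) (Φ : (Fin n → ℂ) → ℂ) (b : Fin n → ℂ) : ℂ :=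
  ∫ u, F (zPart ς u + zbarPart ς b) * Complex.exp (b ⬝ᵥ u / ℏ) * Φ u * gw ℏ u ∂(muC n)

/-- Functions dominated by `exp(‖u‖²/(2ℏ))`, to which the operators `wop` can be applied. -/
def FockBound (ℏ C : ℝ) (Φ : (Fin n → ℂ) → ℂ) : Prop :=
  ∀ u, ‖Φ u‖ ≤ C * Real.exp (hnorm u ^ 2 / (2 * ℏ))

theorem FockBound.nonneg {C : ℝ} {Φ : (Fin n → ℂ) → ℂ} (h : FockBound ℏ C Φ) : 0 ≤ C := by
  have := (norm_nonneg _).trans (h 0)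
  simpa [hnorm_zero] using this

theorem continuous_wop_integrand {F : (PQ n → ℂ) → ℂ} (hF : Continuous F) {Φ : (Fin n → ℂ) → ℂ}
    (hΦ : Continuous Φ) : Continuous fun p : (Fin n → ℂ) × (Fin n → ℂ) =>
      F (zPart ς p.2 + zbarPart ς p.1) * Complex.exp (p.1 ⬝ᵥ p.2 / ℏ) * Φ p.2 * gw ℏ p.2 := by
  have hg := continuous_gw (n := n) ℏ
  unfold dotProduct
  fun_prop

/-- The Gaussian weight leaves the factor `exp(-‖u‖²/(4ℏ))`: half of its exponent is used up by `Φ`,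
and a quarter by the symbol. -/
theorem norm_wop_integrand_le (hℏ : 0 < ℏ) {F : (PQ n → ℂ) → ℂ} {C D : ℝ} (hC0 : 0 ≤ C)
    (hF : ∀ u b : Fin n → ℂ, ‖F (zPart ς u + zbarPart ς b)‖ ≤
      C * Real.exp (1 / (4 * ℏ) * (hnorm u ^ 2 + hnorm b ^ 2)))
    {Φ : (Fin n → ℂ) → ℂ} (hΦ : FockBound ℏ D Φ) (u b : Fin n → ℂ) :
    ‖F (zPart ς u + zbarPart ς b) * Complex.exp (b ⬝ᵥ u / ℏ) * Φ u * gw ℏ u‖ ≤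
      C * D * (ℏ ^ n)⁻¹ * Real.exp (hnorm b ^ 2 / (4 * ℏ)) *
        Real.exp (hnorm b / ℏ * hnorm u - 1 / (4 * ℏ) * hnorm u ^ 2) := by
  have hD := hΦ.nonneg
  rw [norm_mul, norm_mul, norm_mul, norm_gw hℏ]
  calc _ ≤ C * Real.exp (1 / (4 * ℏ) * (hnorm u ^ 2 + hnorm b ^ 2)) *
        Real.exp (hnorm b / ℏ * hnorm u) * (D * Real.exp (hnorm u ^ 2 / (2 * ℏ))) *
        ((ℏ ^ n)⁻¹ * Real.exp (-(1 / ℏ) * hnorm u ^ 2)) := by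
        gcongr
        · exact hF u b
        · exact norm_exp_dot_div_le hℏ b u
        · exact hΦ u
    _ = C * D * (ℏ ^ n)⁻¹ * (Real.exp (1 / (4 * ℏ) * (hnorm u ^ 2 + hnorm b ^ 2)) *
        Real.exp (hnorm b / ℏ * hnorm u) * Real.exp (hnorm u ^ 2 / (2 * ℏ)) *
        Real.exp (-(1 / ℏ) * hnorm u ^ 2)) := by ring
    _ = _ := by
        rw [mul_assoc _ (Real.exp (hnorm b ^ 2 / (4 * ℏ))), ← Real.exp_add, ← Real.exp_add,
          ← Real.exp_add, ← Real.exp_add]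
        congr 2
        field_simp
        ring

theorem hnorm_le_of_norm_sub_le {b b₀ : Fin n → ℂ} (h : ‖b - b₀‖ ≤ 2) :
    hnorm b ≤ hnorm b₀ + n * 2 := by
  have h1 : hnorm b ≤ hnorm b₀ + hnorm (b - b₀) := by
    simpa using hnorm_add_le b₀ (b - b₀)
  have h2 := hnorm_le (b - b₀)
  have h3 : (n : ℝ) * ‖b - b₀‖ ≤ n * 2 := by gcongr
  linarith

theorem wop_integrable (hℏ : 0 < ℏ) (hρ : 0 ≤ ρ) (hρ' : ρ ≤ 2) {F : (PQ n → ℂ) → ℂ}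
    (hF : Continuous F) (hF' : MinType ρ F) {Φ : (Fin n → ℂ) → ℂ} (hΦ : Continuous Φ) {D : ℝ}
    (hD : FockBound ℏ D Φ) (b : Fin n → ℂ) :
    Integrable (fun u => F (zPart ς u + zbarPart ς b) * Complex.exp (b ⬝ᵥ u / ℏ) * Φ u * gw ℏ u)
      (muC n) := by
  obtain ⟨C, hC0, hC⟩ := hF'.exists_gauss hρ hρ' ς (ε := 1 / (4 * ℏ)) (by positivity)
  have hc : Continuous fun u =>
      F (zPart ς u + zbarPart ς b) * Complex.exp (b ⬝ᵥ u / ℏ) * Φ u * gw ℏ u := by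
    have hb : Continuous fun u : Fin n → ℂ => (b, u) := by fun_prop
    simpa only [Function.comp_def] using (continuous_wop_integrand hF hΦ).comp hb
  have hℏ' : 0 < 1 / (4 * ℏ) := by positivity
  exact integrable_of_gauss_bound hc hℏ' fun u => norm_wop_integrand_le hℏ hC0 hC hD u b

/-- `wop` with a varying argument function `Φ_w`, holomorphic in `w`. -/
theorem wop_differentiable_param (hℏ : 0 < ℏ) (hρ : 0 ≤ ρ) (hρ' : ρ ≤ 2) {F : (PQ n → ℂ) → ℂ}
    (hF : Differentiable ℂ F) (hF' : MinType ρ F) {Φ : (Fin n → ℂ) → (Fin n → ℂ) → ℂ}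
    (hΦc : Continuous (Function.uncurry Φ)) (hΦd : ∀ u, Differentiable ℂ fun w => Φ w u)
    {D a : ℝ} (ha : 0 ≤ a) (hD : ∀ w, FockBound ℏ (D * Real.exp (a * hnorm w ^ 2)) (Φ w)) :
    Differentiable ℂ fun p : (Fin n → ℂ) × (Fin n → ℂ) => wop ℏ ς F (Φ p.1) p.2 := by
  obtain ⟨C, hC0, hC⟩ := hF'.exists_gauss hρ hρ' ς (ε := 1 / (4 * ℏ)) (by positivity)
  have hFc := hF.continuous
  have hg := continuous_gw (n := n) ℏ
  have hD0 : 0 ≤ D := by simpa [hnorm_zero] using (hD 0).nonneg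
  unfold wop
  refine differentiable_integral_of_locally_dominated ?_ ?_ fun p₀ => ?_
  · simp only [Function.uncurry_def] at hΦc ⊢
    have h1 : Continuous fun q : ((Fin n → ℂ) × (Fin n → ℂ)) × (Fin n → ℂ) => Φ q.1.1 q.2 :=
      hΦc.comp (by fun_prop : Continuous fun q : ((Fin n → ℂ) × (Fin n → ℂ)) × (Fin n → ℂ) =>
        (q.1.1, q.2))
    unfold dotProduct
    fun_prop
  · intro u
    have h1 : Differentiable ℂ fun p : (Fin n → ℂ) × (Fin n → ℂ) =>
        F (zPart ς u + zbarPart ς p.2) := hF.comp (by fun_prop)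
    have h2 : Differentiable ℂ fun p : (Fin n → ℂ) × (Fin n → ℂ) => Φ p.1 u :=
      (hΦd u).comp (by fun_prop)
    have h3 : Differentiable ℂ fun p : (Fin n → ℂ) × (Fin n → ℂ) => p.2 ⬝ᵥ u :=
      (differentiable_dot u).comp (by fun_prop)
    fun_prop
  · set H1 := hnorm p₀.1 + n * 2
    set H2 := hnorm p₀.2 + n * 2
    refine ⟨fun u => C * (D * Real.exp (a * H1 ^ 2)) * (ℏ ^ n)⁻¹ * Real.exp (H2 ^ 2 / (4 * ℏ)) *
        Real.exp (H2 / ℏ * hnorm u - 1 / (4 * ℏ) * hnorm u ^ 2),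
      integrable_exp_linear_sub_sq (by positivity) _ _, fun p hp u => ?_⟩
    have hp1 : hnorm p.1 ≤ H1 := hnorm_le_of_norm_sub_le ((norm_fst_le (p - p₀)).trans hp)
    have hp2 : hnorm p.2 ≤ H2 := hnorm_le_of_norm_sub_le ((norm_snd_le (p - p₀)).trans hp)
    have h1 := hnorm_nonneg p.1
    have h2 := hnorm_nonneg p.2
    have h3 := hnorm_nonneg u
    refine (norm_wop_integrand_le hℏ hC0 hC (hD p.1) u p.2).trans ?_
    beta_reduce
    gcongr

/-- The operator with Wick symbol `F` produces antiholomorphic functions. -/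
theorem wop_differentiable (hℏ : 0 < ℏ) (hρ : 0 ≤ ρ) (hρ' : ρ ≤ 2) {F : (PQ n → ℂ) → ℂ}
    (hF : Differentiable ℂ F) (hF' : MinType ρ F) {Φ : (Fin n → ℂ) → ℂ} (hΦ : Continuous Φ)
    {D : ℝ} (hD : FockBound ℏ D Φ) : Differentiable ℂ (wop ℏ ς F Φ) := by
  have h := wop_differentiable_param (ς := ς) hℏ hρ hρ' hF hF' (Φ := fun _ => Φ)
    (hΦ.comp continuous_snd) (fun u => differentiable_const _) (a := 0) (D := D) le_rfl
    (fun w => by simpa using hD)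
  have h2 : Differentiable ℂ fun b : Fin n → ℂ => ((0 : Fin n → ℂ), b) := by fun_prop
  simpa only [Function.comp_def] using h.comp h2

/-- The operator with Wick symbol `F` maps `Ē^{2,A}_ρ` into itself, with uniform bounds. The
exponent `A = 1/(2ℏ)` enters through
`|exp(z̄·u/ℏ - ‖u‖²/(2ℏ))| = exp(‖z‖²/(2ℏ) - ‖u - z‖²/(2ℏ))`. -/
theorem exists_wop_bound (hℏ : 0 < ℏ) (hρ : 0 < ρ) (hρ' : ρ ≤ 2) (ς : ℝ) {r : ℝ} (hr : 0 < r) :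
    ∃ ε r' K : ℝ, 0 < ε ∧ 0 < r' ∧ 0 ≤ K ∧ ∀ (F : (PQ n → ℂ) → ℂ) (M : ℝ), 0 ≤ M →
      (∀ ζ, ‖F ζ‖ ≤ M * Real.exp (ε * ‖ζ‖ ^ ρ)) → ∀ (Φ : (Fin n → ℂ) → ℂ) (C : ℝ), 0 ≤ C →
      EbarBound ρ (1 / (2 * ℏ)) r C Φ →
      EbarBound ρ (1 / (2 * ℏ)) r' (K * M * C) fun z => wop ℏ ς F Φ (star z) := by
  have hc := coordBound_pos (n := n) ς
  set c := coordBound n ς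
  set s := min (r / 2) (1 / (4 * ℏ)) with hs
  have hs0 : 0 < s := lt_min (by positivity) (by positivity)
  have h2 : (0 : ℝ) < 2 ^ ρ := by positivity
  have h2' : (1 : ℝ) ≤ 2 ^ ρ := Real.one_le_rpow (by norm_num) hρ.le
  set δ := s / 2 ^ ρ / 2 with hδ
  have hδ0 : 0 < δ := by positivity
  set K₀ := ∫ u : Fin n → ℂ, Real.exp (-(1 / (4 * ℏ)) * hnorm u ^ 2) ∂(muC n) with hK₀
  have hK₀0 : 0 ≤ K₀ := integral_nonneg fun u => (Real.exp_pos _).le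
  refine ⟨δ / (2 ^ ρ * c ^ ρ), δ, (ℏ ^ n)⁻¹ * Real.exp s * K₀, by positivity, hδ0, by positivity,
    fun F M hM hF Φ C hC hΦ z => ?_⟩
  have hgi : Integrable (fun u : Fin n → ℂ => Real.exp (-(1 / (4 * ℏ)) * hnorm u ^ 2)) (muC n) :=
    integrable_exp_neg_hnorm_sq (by positivity)
  have hgi' := hgi.comp_add_right (-z)
  set E := Real.exp (1 / (2 * ℏ) * hnorm z ^ 2 - δ * hnorm z ^ ρ) with hE
  have hpt : ∀ u, ‖F (zPart ς u + zbarPart ς (star z)) * Complex.exp (star z ⬝ᵥ u / ℏ) * Φ u *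
      gw ℏ u‖ ≤ M * C * (ℏ ^ n)⁻¹ * Real.exp s * E *
        Real.exp (-(1 / (4 * ℏ)) * hnorm (u + -z) ^ 2) := by
    intro u
    rw [norm_mul, norm_mul, norm_mul, norm_gw hℏ, Complex.norm_exp, Complex.div_ofReal_re]
    have hu := hnorm_nonneg u
    have hz := hnorm_nonneg z
    have hy := hnorm_nonneg (u + -z)
    have huρ := Real.rpow_nonneg hu ρ
    have hzρ := Real.rpow_nonneg hz ρ
    -- The growth of the symbol, in terms of `‖u‖` and `‖z‖`.
    have e1 : δ / (2 ^ ρ * c ^ ρ) * ‖zPart ς u + zbarPart ς (star z)‖ ^ ρ ≤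
        δ * (hnorm u ^ ρ + hnorm z ^ ρ) := by
      have h3 : ‖zPart ς u + zbarPart ς (star z)‖ ≤ c * (hnorm u + hnorm z) := by
        refine (norm_add_le _ _).trans ?_
        rw [mul_add, ← hnorm_star z]
        exact add_le_add (norm_zPart_le ς u) (norm_zbarPart_le ς (star z))
      calc _ ≤ δ / (2 ^ ρ * c ^ ρ) * (c * (hnorm u + hnorm z)) ^ ρ := by gcongr
        _ = δ / 2 ^ ρ * (hnorm u + hnorm z) ^ ρ := by
            rw [Real.mul_rpow hc.le (by positivity)]; field_simp
        _ ≤ δ / 2 ^ ρ * (2 ^ ρ * (hnorm u ^ ρ + hnorm z ^ ρ)) := by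
            gcongr; exact add_rpow_le hu hz hρ
        _ = _ := by field_simp
    -- The decay of `φ` in `‖u‖` becomes decay in `‖z‖`, at the cost of a Gaussian in `u - z`.
    have e2 : hnorm z ^ ρ ≤ 2 ^ ρ * (hnorm u ^ ρ + (1 + hnorm (u + -z) ^ 2)) := by
      have h3 : hnorm z ≤ hnorm u + hnorm (u + -z) := by
        have := hnorm_add_le u (-(u + -z))
        rw [hnorm_neg] at this
        simpa using this
      calc hnorm z ^ ρ ≤ (hnorm u + hnorm (u + -z)) ^ ρ := by gcongr
        _ ≤ 2 ^ ρ * (hnorm u ^ ρ + hnorm (u + -z) ^ ρ) := add_rpow_le hu hy hρ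
        _ ≤ _ := by gcongr; exact rpow_le_one_add_sq hρ.le hρ' hy
    have e2' : 2 * δ * hnorm z ^ ρ ≤ s * (hnorm u ^ ρ + (1 + hnorm (u + -z) ^ 2)) := by
      calc 2 * δ * hnorm z ^ ρ = s / 2 ^ ρ * hnorm z ^ ρ := by rw [hδ]; ring
        _ ≤ s / 2 ^ ρ * (2 ^ ρ * (hnorm u ^ ρ + (1 + hnorm (u + -z) ^ 2))) := by gcongr
        _ = _ := by field_simp
    have e3 : δ ≤ r / 2 := by
      have : s / 2 ^ ρ ≤ s := div_le_self hs0.le h2'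
      have := min_le_left (r / 2) (1 / (4 * ℏ))
      rw [hδ]; linarith
    have e4 : δ * hnorm u ^ ρ ≤ r / 2 * hnorm u ^ ρ := by gcongr
    have e5 : s * hnorm u ^ ρ ≤ r / 2 * hnorm u ^ ρ := by gcongr; exact min_le_left _ _
    have e6 : s * hnorm (u + -z) ^ 2 ≤ 1 / (4 * ℏ) * hnorm (u + -z) ^ 2 := by
      gcongr; exact min_le_right _ _
    -- The quadratic terms of the exponent.
    have e7 : (star z ⬝ᵥ u).re / ℏ + 1 / (2 * ℏ) * hnorm u ^ 2 - 1 / ℏ * hnorm u ^ 2 =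
        1 / (2 * ℏ) * hnorm z ^ 2 - 2 * (1 / (4 * ℏ) * hnorm (u + -z) ^ 2) := by
      rw [← sub_eq_add_neg, hnorm_sub_sq]
      field_simp
      ring
    calc _ ≤ M * Real.exp (δ * (hnorm u ^ ρ + hnorm z ^ ρ)) * Real.exp ((star z ⬝ᵥ u).re / ℏ) *
          (C * Real.exp (1 / (2 * ℏ) * hnorm u ^ 2 - r * hnorm u ^ ρ)) *
          ((ℏ ^ n)⁻¹ * Real.exp (-(1 / ℏ) * hnorm u ^ 2)) := by
          gcongr
          · exact (hF _).trans (by gcongr)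
          · exact hΦ u
      _ = M * C * (ℏ ^ n)⁻¹ * Real.exp (δ * (hnorm u ^ ρ + hnorm z ^ ρ) +
          (star z ⬝ᵥ u).re / ℏ + (1 / (2 * ℏ) * hnorm u ^ 2 - r * hnorm u ^ ρ) +
          -(1 / ℏ) * hnorm u ^ 2) := by
          simp only [Real.exp_add]; ring
      _ ≤ M * C * (ℏ ^ n)⁻¹ * Real.exp (s + (1 / (2 * ℏ) * hnorm z ^ 2 - δ * hnorm z ^ ρ) +
          -(1 / (4 * ℏ)) * hnorm (u + -z) ^ 2) := by
          refine mul_le_mul_of_nonneg_left (Real.exp_le_exp.2 ?_) (by positivity)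
          linarith
      _ = _ := by rw [hE]; simp only [Real.exp_add]; ring
  refine (norm_integral_le_of_norm_le (hgi'.const_mul _) (.of_forall hpt)).trans (le_of_eq ?_)
  rw [integral_const_mul, integral_add_right_eq_self
    (fun u => Real.exp (-(1 / (4 * ℏ)) * hnorm u ^ 2)), ← hK₀, hE]
  ring

end Operator

/-! ### The Wick star product as an integral -/

section Star

variable {n : ℕ} {ℏ ς ρ : ℝ}

/-- The Wick star product of entire functions on the complexified phase space, as the Gaussian
integral `∫ F(ζ + u) G(ζ + ū)` with `u` in the holomorphic and `ū` in the antiholomorphic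
directions. Its expansion in powers of `ℏ` is the series that defines the product, because the
Gaussian integral of `u_{j_1}⋯u_{j_m} ū_{k_1}⋯ū_{k_m}` is a sum over the pairings of the indices. -/
noncomputable def starInt (ℏ ς : ℝ) (F G : (PQ n → ℂ) → ℂ) (ζ : PQ n → ℂ) : ℂ :=
  ∫ u, F (ζ + zPart ς u) * G (ζ + zbarPart ς (star u)) * gw ℏ u ∂(muC n)

theorem continuous_starInt_integrand {F G : (PQ n → ℂ) → ℂ} (hF : Continuous F)
    (hG : Continuous G) : Continuous fun p : (PQ n → ℂ) × (Fin n → ℂ) =>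
      F (p.1 + zPart ς p.2) * G (p.1 + zbarPart ς (star p.2)) * gw ℏ p.2 := by
  have hg := continuous_gw (n := n) ℏ
  fun_prop

/-- Shifting the argument of a function of minimal type costs an arbitrarily small Gaussian. -/
theorem MinType.exists_shift (hρ : 0 < ρ) (hρ' : ρ ≤ 2) {F : (PQ n → ℂ) → ℂ} (hF : MinType ρ F)
    {η : ℝ} (hη : 0 < η) (c : ℝ) (hc : 0 < c) : ∃ C : ℝ, 0 ≤ C ∧ ∀ (ζ ξ : PQ n → ℂ) (t : ℝ), 0 ≤ t →
      ‖ξ‖ ≤ c * t → ‖F (ζ + ξ)‖ ≤ C * Real.exp (η * ‖ζ‖ ^ ρ) * Real.exp (η * t ^ 2) := by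
  have h2 : (0 : ℝ) < 2 ^ ρ := by positivity
  have hcρ : 0 < c ^ ρ := by positivity
  set ε := η / 2 ^ ρ / (1 + c ^ ρ) with hε
  have hε0 : 0 < ε := by positivity
  have e1 : ε * 2 ^ ρ * (1 + c ^ ρ) = η := by rw [hε]; field_simp
  have e2 : ε * 2 ^ ρ ≤ η := by
    rw [← e1]; exact le_mul_of_one_le_right (by positivity) (by linarith)
  have e3 : ε * 2 ^ ρ * c ^ ρ ≤ η := by rw [← e1]; gcongr; linarith
  obtain ⟨C, hC0, hC⟩ := hF ε hε0
  refine ⟨C * Real.exp η, by positivity, fun ζ ξ t ht hξ => (hC _).trans ?_⟩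
  rw [mul_assoc, mul_assoc, ← Real.exp_add, ← Real.exp_add]
  gcongr
  calc ε * ‖ζ + ξ‖ ^ ρ ≤ ε * (‖ζ‖ + c * t) ^ ρ := by
        gcongr
        exact (norm_add_le _ _).trans (by gcongr)
    _ ≤ ε * (2 ^ ρ * (‖ζ‖ ^ ρ + (c * t) ^ ρ)) := by
        gcongr
        exact add_rpow_le (norm_nonneg _) (by positivity) hρ
    _ = ε * 2 ^ ρ * ‖ζ‖ ^ ρ + ε * 2 ^ ρ * c ^ ρ * t ^ ρ := by
        rw [Real.mul_rpow hc.le ht]; ring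
    _ ≤ η * ‖ζ‖ ^ ρ + η * (1 + t ^ 2) := by
        gcongr
        exact rpow_le_one_add_sq hρ.le hρ' ht
    _ = _ := by ring

theorem exists_starInt_integrand_le (hℏ : 0 < ℏ) (hρ : 0 < ρ) (hρ' : ρ ≤ 2) (ς : ℝ)
    {F G : (PQ n → ℂ) → ℂ} (hF : MinType ρ F) (hG : MinType ρ G) {η : ℝ} (hη : 0 < η) :
    ∃ C : ℝ, 0 ≤ C ∧ ∀ (ζ : PQ n → ℂ) (u : Fin n → ℂ),
      ‖F (ζ + zPart ς u) * G (ζ + zbarPart ς (star u)) * gw ℏ u‖ ≤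
        C * Real.exp (η * ‖ζ‖ ^ ρ) * Real.exp (-(1 / (2 * ℏ)) * hnorm u ^ 2) := by
  set η' := min (η / 2) (1 / (4 * ℏ)) with hη'
  have h0 : 0 < η' := lt_min (by positivity) (by positivity)
  have h1 : η' ≤ η / 2 := min_le_left _ _
  have h2 : η' ≤ 1 / (4 * ℏ) := min_le_right _ _
  have hc := coordBound_pos (n := n) ς
  obtain ⟨C, hC0, hC⟩ := hF.exists_shift hρ hρ' h0 _ hc
  obtain ⟨D, hD0, hD⟩ := hG.exists_shift hρ hρ' h0 _ hc
  refine ⟨C * D * (ℏ ^ n)⁻¹, by positivity, fun ζ u => ?_⟩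
  have hu := hnorm_nonneg u
  have hD' := hD ζ (zbarPart ς (star u)) (hnorm u) hu (by
    rw [← hnorm_star u]; exact norm_zbarPart_le ς (star u))
  rw [norm_mul, norm_mul, norm_gw hℏ]
  calc _ ≤ C * Real.exp (η' * ‖ζ‖ ^ ρ) * Real.exp (η' * hnorm u ^ 2) *
        (D * Real.exp (η' * ‖ζ‖ ^ ρ) * Real.exp (η' * hnorm u ^ 2)) *
        ((ℏ ^ n)⁻¹ * Real.exp (-(1 / ℏ) * hnorm u ^ 2)) := by
        gcongr
        exact hC ζ _ _ hu (norm_zPart_le ς u)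
    _ = C * D * (ℏ ^ n)⁻¹ * Real.exp (2 * η' * ‖ζ‖ ^ ρ + (2 * η' - 1 / ℏ) * hnorm u ^ 2) := by
        have : 2 * η' * ‖ζ‖ ^ ρ + (2 * η' - 1 / ℏ) * hnorm u ^ 2 = η' * ‖ζ‖ ^ ρ +
          η' * hnorm u ^ 2 + (η' * ‖ζ‖ ^ ρ + η' * hnorm u ^ 2) + -(1 / ℏ) * hnorm u ^ 2 := by ring
        rw [this]
        simp only [Real.exp_add]
        ring
    _ ≤ C * D * (ℏ ^ n)⁻¹ * Real.exp (η * ‖ζ‖ ^ ρ + -(1 / (2 * ℏ)) * hnorm u ^ 2) := by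
        have h3 : 2 * η' ≤ η := by linarith
        have h4 : 2 * η' - 1 / ℏ ≤ -(1 / (2 * ℏ)) := by
          have : 1 / ℏ = 2 * (1 / (4 * ℏ)) + 1 / (2 * ℏ) := by field_simp; norm_num
          linarith
        gcongr
    _ = _ := by rw [Real.exp_add]; ring

theorem starInt_differentiable (hℏ : 0 < ℏ) (hρ : 0 < ρ) (hρ' : ρ ≤ 2) (ς : ℝ)
    {F G : (PQ n → ℂ) → ℂ} (hFd : Differentiable ℂ F) (hF : MinType ρ F)
    (hGd : Differentiable ℂ G) (hG : MinType ρ G) : Differentiable ℂ (starInt ℏ ς F G) := by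
  obtain ⟨C, hC0, hC⟩ := exists_starInt_integrand_le hℏ hρ hρ' ς hF hG one_pos
  unfold starInt
  refine differentiable_integral_of_locally_dominated
    (continuous_starInt_integrand hFd.continuous hGd.continuous) (fun u => ?_) fun ζ₀ => ?_
  · have h1 : Differentiable ℂ fun ζ => F (ζ + zPart ς u) := hFd.comp (by fun_prop)
    have h2 : Differentiable ℂ fun ζ => G (ζ + zbarPart ς (star u)) := hGd.comp (by fun_prop)
    fun_prop
  · refine ⟨fun u => C * Real.exp (1 * (‖ζ₀‖ + 2) ^ ρ) * Real.exp (-(1 / (2 * ℏ)) * hnorm u ^ 2),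
      (integrable_exp_neg_hnorm_sq (by positivity)).const_mul _, fun ζ hζ u =>
        (hC ζ u).trans ?_⟩
    have : ‖ζ‖ ≤ ‖ζ₀‖ + 2 := by
      have := norm_le_norm_add_norm_sub' ζ ζ₀
      linarith
    beta_reduce
    gcongr

theorem starInt_minType (hℏ : 0 < ℏ) (hρ : 0 < ρ) (hρ' : ρ ≤ 2) (ς : ℝ)
    {F G : (PQ n → ℂ) → ℂ} (hF : MinType ρ F) (hG : MinType ρ G) :
    MinType ρ (starInt ℏ ς F G) := by
  intro η hη
  obtain ⟨C, hC0, hC⟩ := exists_starInt_integrand_le hℏ hρ hρ' ς hF hG hη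
  refine ⟨C * ∫ u : Fin n → ℂ, Real.exp (-(1 / (2 * ℏ)) * hnorm u ^ 2) ∂(muC n),
    mul_nonneg hC0 (integral_nonneg fun u => (Real.exp_pos _).le), fun ζ => ?_⟩
  refine (norm_integral_le_of_norm_le ((integrable_exp_neg_hnorm_sq (by positivity)).const_mul _)
    (.of_forall (hC ζ))).trans (le_of_eq ?_)
  rw [integral_const_mul]
  ring

/-- The function `Φ_w(u) = G(w, ū) exp(ū·w/ℏ)`: the kernel of the operator with Wick symbol `G`,
as a function of its first argument. -/
noncomputable def kernelFun (ℏ ς : ℝ) (G : (PQ n → ℂ) → ℂ) (w u : Fin n → ℂ) : ℂ :=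
  G (zPart ς w + zbarPart ς (star u)) * Complex.exp (star u ⬝ᵥ w / ℏ)

theorem continuous_kernelFun {G : (PQ n → ℂ) → ℂ} (hG : Continuous G) :
    Continuous (Function.uncurry (kernelFun ℏ ς G)) := by
  unfold kernelFun dotProduct
  simp only [Function.uncurry_def]
  fun_prop

theorem kernelFun_differentiable {G : (PQ n → ℂ) → ℂ} (hG : Differentiable ℂ G) (u : Fin n → ℂ) :
    Differentiable ℂ fun w => kernelFun ℏ ς G w u := by
  unfold kernelFun dotProduct
  have h1 : Differentiable ℂ fun w => G (zPart ς w + zbarPart ς (star u)) := hG.comp (by fun_prop)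
  fun_prop

theorem mul_div_le (hℏ : 0 < ℏ) (s t : ℝ) : s / ℏ * t ≤ 1 / ℏ * s ^ 2 + t ^ 2 / (4 * ℏ) := by
  have h : 1 / ℏ * s ^ 2 + t ^ 2 / (4 * ℏ) - s / ℏ * t = (2 * s - t) ^ 2 / (4 * ℏ) := by
    field_simp; ring
  have : 0 ≤ (2 * s - t) ^ 2 / (4 * ℏ) := by positivity
  linarith

theorem exists_kernelFun_bound (hℏ : 0 < ℏ) (hρ : 0 ≤ ρ) (hρ' : ρ ≤ 2) (ς : ℝ)
    {G : (PQ n → ℂ) → ℂ} (hG : MinType ρ G) : ∃ D : ℝ, ∀ w,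
      FockBound ℏ (D * Real.exp (5 / (4 * ℏ) * hnorm w ^ 2)) (kernelFun ℏ ς G w) := by
  obtain ⟨C, hC0, hC⟩ := hG.exists_gauss hρ hρ' ς (ε := 1 / (4 * ℏ)) (by positivity)
  refine ⟨C, fun w u => ?_⟩
  rw [kernelFun, norm_mul]
  have h1 := norm_exp_dot_div_le hℏ w (star u)
  rw [dotProduct_comm, hnorm_star] at h1
  have h2 := hC w (star u)
  rw [hnorm_star] at h2
  calc _ ≤ C * Real.exp (1 / (4 * ℏ) * (hnorm w ^ 2 + hnorm u ^ 2)) *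
        Real.exp (hnorm w / ℏ * hnorm u) := by gcongr
    _ ≤ C * Real.exp (1 / (4 * ℏ) * (hnorm w ^ 2 + hnorm u ^ 2)) *
        Real.exp (1 / ℏ * hnorm w ^ 2 + hnorm u ^ 2 / (4 * ℏ)) := by
        gcongr; exact mul_div_le hℏ _ _
    _ = _ := by
        rw [mul_assoc, mul_assoc, ← Real.exp_add, ← Real.exp_add]
        congr 2
        field_simp
        ring

/-- Entire functions of `(w, b)` that agree for `b = w̄` are equal: `(w, b)` is the value at `t = i`
of the line `(c + t d, c̄ + t d̄)`, which consists of pairs `(w, w̄)` for real `t`. -/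
theorem eq_of_eq_conj {n : ℕ} {R S : (Fin n → ℂ) × (Fin n → ℂ) → ℂ} (hR : Differentiable ℂ R)
    (hS : Differentiable ℂ S) (h : ∀ w : Fin n → ℂ, R (w, star w) = S (w, star w)) : R = S := by
  funext ⟨w, b⟩
  set c : Fin n → ℂ := (1 / 2 : ℂ) • (w + star b) with hc
  set d : Fin n → ℂ := (-Complex.I / 2) • (w - star b) with hd
  have hw : c + Complex.I • d = w := by
    funext j
    simp only [hc, hd, Pi.add_apply, Pi.smul_apply, Pi.sub_apply, smul_eq_mul]
    linear_combination (-(1 / 2) * (w j - star b j)) * Complex.I_sq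
  have hb : star c + Complex.I • star d = b := by
    funext j
    simp only [hc, hd, Pi.add_apply, Pi.smul_apply, Pi.sub_apply, smul_eq_mul, Pi.star_apply,
      star_mul', star_add, star_sub, RCLike.star_def, Complex.conj_conj, map_div₀, map_neg,
      Complex.conj_I, map_one, map_ofNat]
    linear_combination ((1 / 2) * ((starRingEnd ℂ) (w j) - b j)) * Complex.I_sq
  have key := eq_of_eq_real (differentiable_line hR (c, star c) (d, star d))
    (differentiable_line hS (c, star c) (d, star d)) (fun t => ?_) Complex.I
  · simpa only [Prod.smul_mk, Prod.mk_add_mk, hw, hb] using key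
  · have : star c + (t : ℂ) • star d = star (c + (t : ℂ) • d) := by
      rw [star_add, star_smul]
      simp
    simp only [Prod.smul_mk, Prod.mk_add_mk, this]
    exact h _

/-- The kernel of the composition of two operators is given by the star product of their symbols.
For `b = w̄` this is a translation of the integration variable, and both sides are entire in
`(w, b)`. -/
theorem starInt_mul_exp (hℏ : 0 < ℏ) (hρ : 0 < ρ) (hρ' : ρ ≤ 2) (ς : ℝ)
    {F G : (PQ n → ℂ) → ℂ} (hFd : Differentiable ℂ F) (hF : MinType ρ F)
    (hGd : Differentiable ℂ G) (hG : MinType ρ G) (w b : Fin n → ℂ) :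
    starInt ℏ ς F G (zPart ς w + zbarPart ς b) * Complex.exp (b ⬝ᵥ w / ℏ) =
      wop ℏ ς F (kernelFun ℏ ς G w) b := by
  -- For `b = w̄` both sides are integrals, related by the translation `u ↦ u + w`.
  have hdiag : ∀ w : Fin n → ℂ, starInt ℏ ς F G (zPart ς w + zbarPart ς (star w)) *
      Complex.exp (star w ⬝ᵥ w / ℏ) = wop ℏ ς F (kernelFun ℏ ς G w) (star w) := by
    intro w
    unfold starInt wop
    rw [← integral_mul_const, eq_comm, ← integral_add_right_eq_self _ w]
    refine integral_congr_ae (.of_forall fun u => Eq.symm ?_)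
    simp only [kernelFun, gw_eq, star_add, map_add, dotProduct_add, add_dotProduct]
    have h1 : zPart ς w + zbarPart ς (star w) + zPart ς u =
      zPart ς u + zPart ς w + zbarPart ς (star w) := by abel
    have h2 : zPart ς w + zbarPart ς (star w) + zbarPart ς (star u) =
      zPart ς w + (zbarPart ς (star u) + zbarPart ς (star w)) := by abel
    rw [h1, h2]
    have h3 : Complex.exp (-(star u ⬝ᵥ u) / ℏ) * Complex.exp (star w ⬝ᵥ w / ℏ) =
        Complex.exp ((star w ⬝ᵥ u + star w ⬝ᵥ w) / ℏ) *
        Complex.exp ((star u ⬝ᵥ w + star w ⬝ᵥ w) / ℏ) *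
        Complex.exp (-(star u ⬝ᵥ u + star w ⬝ᵥ u + (star u ⬝ᵥ w + star w ⬝ᵥ w)) / ℏ) := by
      rw [← Complex.exp_add, ← Complex.exp_add, ← Complex.exp_add]
      congr 1
      ring
    linear_combination (F (zPart ς u + zPart ς w + zbarPart ς (star w)) *
      G (zPart ς w + (zbarPart ς (star u) + zbarPart ς (star w))) * ((ℏ ^ n)⁻¹ : ℝ)) * h3
  obtain ⟨D, hD⟩ := exists_kernelFun_bound hℏ hρ.le hρ' ς hG
  have hR : Differentiable ℂ fun p : (Fin n → ℂ) × (Fin n → ℂ) =>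
      wop ℏ ς F (kernelFun ℏ ς G p.1) p.2 :=
    wop_differentiable_param hℏ hρ.le hρ' hFd hF (continuous_kernelFun hGd.continuous)
      (kernelFun_differentiable hGd) (by positivity) hD
  have hS := starInt_differentiable hℏ hρ hρ' ς hFd hF hGd hG
  have hf1 : Differentiable ℂ (Prod.fst : (Fin n → ℂ) × (Fin n → ℂ) → _) := differentiable_fst
  have hf2 : Differentiable ℂ (Prod.snd : (Fin n → ℂ) × (Fin n → ℂ) → _) := differentiable_snd
  have hL : Differentiable ℂ fun p : (Fin n → ℂ) × (Fin n → ℂ) =>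
      starInt ℏ ς F G (zPart ς p.1 + zbarPart ς p.2) * Complex.exp (p.2 ⬝ᵥ p.1 / ℏ) := by
    have h1 : Differentiable ℂ fun p : (Fin n → ℂ) × (Fin n → ℂ) =>
      starInt ℏ ς F G (zPart ς p.1 + zbarPart ς p.2) := hS.comp (by fun_prop)
    unfold dotProduct
    fun_prop
  exact congrFun (eq_of_eq_conj hL hR hdiag) (w, b)

/-- The exponent that remains in the double integral for the composition of two operators is a
negative definite quadratic form. -/
theorem sq_combination_le (hℏ : 0 < ℏ) (s t : ℝ) :
    1 / (16 * ℏ) * (t ^ 2 + s ^ 2) + s / ℏ * t + t ^ 2 / (2 * ℏ) - 1 / ℏ * t ^ 2 - 1 / ℏ * s ^ 2 +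
      1 / (16 * ℏ) * s ^ 2 ≤ -(1 / (8 * ℏ)) * s ^ 2 - 1 / (16 * ℏ) * t ^ 2 := by
  have h : -(1 / (8 * ℏ)) * s ^ 2 - 1 / (16 * ℏ) * t ^ 2 -
      (1 / (16 * ℏ) * (t ^ 2 + s ^ 2) + s / ℏ * t + t ^ 2 / (2 * ℏ) - 1 / ℏ * t ^ 2 -
      1 / ℏ * s ^ 2 + 1 / (16 * ℏ) * s ^ 2) = (12 * s ^ 2 - 16 * s * t + 6 * t ^ 2) / (16 * ℏ) := by
    field_simp; ring
  have : 0 ≤ (12 * s ^ 2 - 16 * s * t + 6 * t ^ 2) / (16 * ℏ) := by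
    refine div_nonneg ?_ (by positivity)
    nlinarith [sq_nonneg (4 * s - 3 * t), sq_nonneg s, sq_nonneg t]
  linarith

/-- Composition of operators corresponds to the star product of symbols, by Fubini's theorem and
the formula `starInt_mul_exp` for the kernel. -/
theorem wop_wop (hℏ : 0 < ℏ) (hρ : 0 < ρ) (hρ' : ρ ≤ 2) (ς : ℝ)
    {F G : (PQ n → ℂ) → ℂ} (hFd : Differentiable ℂ F) (hF : MinType ρ F)
    (hGd : Differentiable ℂ G) (hG : MinType ρ G) {Φ : (Fin n → ℂ) → ℂ} (hΦ : Continuous Φ)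
    {D : ℝ} (hD : FockBound ℏ D Φ) (b : Fin n → ℂ) :
    wop ℏ ς F (fun u => wop ℏ ς G Φ (star u)) b = wop ℏ ς (starInt ℏ ς F G) Φ b := by
  have hg := continuous_gw (n := n) ℏ
  have hFc := hFd.continuous
  have hGc := hGd.continuous
  have hD0 := hD.nonneg
  set K : (Fin n → ℂ) → (Fin n → ℂ) → ℂ := fun u w =>
    F (zPart ς u + zbarPart ς b) * Complex.exp (b ⬝ᵥ u / ℏ) *
      (G (zPart ς w + zbarPart ς (star u)) * Complex.exp (star u ⬝ᵥ w / ℏ) * Φ w * gw ℏ w) *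
        gw ℏ u with hK
  have hε : 0 < 1 / (16 * ℏ) := by positivity
  have hε' : 0 < 1 / (8 * ℏ) := by positivity
  obtain ⟨C₁, hC₁0, hC₁⟩ := hF.exists_gauss hρ.le hρ' ς hε
  obtain ⟨C₂, hC₂0, hC₂⟩ := hG.exists_gauss hρ.le hρ' ς hε
  have hint : Integrable (Function.uncurry K) ((muC n).prod (muC n)) := by
    have hb1 := (integrable_exp_linear_sub_sq (n := n) hε'
      (C₁ * C₂ * D * (ℏ ^ n)⁻¹ * (ℏ ^ n)⁻¹ * Real.exp (1 / (16 * ℏ) * hnorm b ^ 2))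
      (hnorm b / ℏ)).mul_prod (integrable_exp_neg_hnorm_sq (n := n) hε)
    refine hb1.mono' (Continuous.aestronglyMeasurable ?_) (.of_forall fun p => ?_)
    · simp only [Function.uncurry_def, hK]
      unfold dotProduct
      fun_prop
    · obtain ⟨u, w⟩ := p
      simp only [Function.uncurry, hK, norm_mul, norm_gw hℏ]
      have h2 := hC₂ w (star u)
      rw [hnorm_star] at h2
      have h3 := norm_exp_dot_div_le hℏ (star u) w
      rw [hnorm_star] at h3
      calc _ ≤ C₁ * Real.exp (1 / (16 * ℏ) * (hnorm u ^ 2 + hnorm b ^ 2)) *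
            Real.exp (hnorm b / ℏ * hnorm u) *
            (C₂ * Real.exp (1 / (16 * ℏ) * (hnorm w ^ 2 + hnorm u ^ 2)) *
              Real.exp (hnorm u / ℏ * hnorm w) * (D * Real.exp (hnorm w ^ 2 / (2 * ℏ))) *
              ((ℏ ^ n)⁻¹ * Real.exp (-(1 / ℏ) * hnorm w ^ 2))) *
            ((ℏ ^ n)⁻¹ * Real.exp (-(1 / ℏ) * hnorm u ^ 2)) := by
            gcongr
            · exact hC₁ u b
            · exact norm_exp_dot_div_le hℏ b u
            · exact hD w
        _ = C₁ * C₂ * D * (ℏ ^ n)⁻¹ * (ℏ ^ n)⁻¹ * Real.exp (1 / (16 * ℏ) * hnorm b ^ 2) *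
            Real.exp (hnorm b / ℏ * hnorm u + (1 / (16 * ℏ) * (hnorm w ^ 2 + hnorm u ^ 2) +
              hnorm u / ℏ * hnorm w + hnorm w ^ 2 / (2 * ℏ) - 1 / ℏ * hnorm w ^ 2 -
              1 / ℏ * hnorm u ^ 2 + 1 / (16 * ℏ) * hnorm u ^ 2)) := by
            simp only [mul_add, sub_eq_add_neg, Real.exp_add, neg_mul]
            ring
        _ ≤ C₁ * C₂ * D * (ℏ ^ n)⁻¹ * (ℏ ^ n)⁻¹ * Real.exp (1 / (16 * ℏ) * hnorm b ^ 2) *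
            Real.exp (hnorm b / ℏ * hnorm u + (-(1 / (8 * ℏ)) * hnorm u ^ 2 -
              1 / (16 * ℏ) * hnorm w ^ 2)) := by
            gcongr _ * Real.exp (_ + ?_)
            exact sq_combination_le hℏ (hnorm u) (hnorm w)
        _ = _ := by
            simp only [sub_eq_add_neg, Real.exp_add, neg_mul]
            ring
  have hswap := integral_integral_swap hint
  calc _ = ∫ u, ∫ w, K u w ∂(muC n) ∂(muC n) := by
        unfold wop
        refine integral_congr_ae (.of_forall fun u => ?_)
        simp only [hK]
        rw [← integral_const_mul, ← integral_mul_const]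
    _ = ∫ w, ∫ u, K u w ∂(muC n) ∂(muC n) := hswap
    _ = _ := by
        conv_rhs => unfold wop
        refine integral_congr_ae (.of_forall fun w => ?_)
        beta_reduce
        rw [starInt_mul_exp hℏ hρ hρ' ς hFd hF hGd hG w b, wop, ← integral_mul_const,
          ← integral_mul_const]
        refine integral_congr_ae (.of_forall fun u => ?_)
        simp only [hK, kernelFun]
        ring

/-- Associativity of the star product follows from that of the composition of operators, since
`Φ_w ↦ F Φ_w` maps the kernel function of `H` to that of `F ⋆ H`. -/
theorem starInt_assoc (hℏ : 0 < ℏ) (hρ : 0 < ρ) (hρ' : ρ ≤ 2) (ς : ℝ)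
    {F G H : (PQ n → ℂ) → ℂ} (hFd : Differentiable ℂ F) (hF : MinType ρ F)
    (hGd : Differentiable ℂ G) (hG : MinType ρ G) (hHd : Differentiable ℂ H) (hH : MinType ρ H)
    (w b : Fin n → ℂ) :
    starInt ℏ ς (starInt ℏ ς F G) H (zPart ς w + zbarPart ς b) =
      starInt ℏ ς F (starInt ℏ ς G H) (zPart ς w + zbarPart ς b) := by
  have hFGd := starInt_differentiable hℏ hρ hρ' ς hFd hF hGd hG
  have hFG := starInt_minType hℏ hρ hρ' ς hF hG
  have hGHd := starInt_differentiable hℏ hρ hρ' ς hGd hG hHd hH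
  have hGH := starInt_minType hℏ hρ hρ' ς hG hH
  obtain ⟨D, hD⟩ := exists_kernelFun_bound hℏ hρ.le hρ' ς hH
  have hk : Continuous (kernelFun ℏ ς H w) :=
    (continuous_kernelFun hHd.continuous).comp (by fun_prop : Continuous fun u => (w, u))
  have h1 := starInt_mul_exp hℏ hρ hρ' ς hFGd hFG hHd hH w b
  have h2 := starInt_mul_exp hℏ hρ hρ' ς hFd hF hGHd hGH w b
  rw [← wop_wop hℏ hρ hρ' ς hFd hF hGd hG hk (hD w) b] at h1
  have h3 : kernelFun ℏ ς (starInt ℏ ς G H) w =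
      fun u => wop ℏ ς G (kernelFun ℏ ς H w) (star u) := by
    funext u
    exact starInt_mul_exp hℏ hρ hρ' ς hGd hG hHd hH w (star u)
  rw [h3, ← h1] at h2
  exact (mul_right_cancel₀ (Complex.exp_ne_zero _) h2).symm

/-- The operator with Wick symbol `1` is the identity. -/
theorem wop_one (hℏ : 0 < ℏ) (ς : ℝ) {Q : (Fin n → ℂ) → ℂ} (hQ : Differentiable ℂ Q) {C : ℝ}
    (hC : ∀ ζ, ‖Q ζ‖ ≤ C * Real.exp (hnorm ζ ^ 2 / (2 * ℏ))) (b : Fin n → ℂ) :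
    wop ℏ ς (fun _ => 1) (fun u => Q (star u)) b = Q b := by
  rw [wop, ← reproducing hℏ hQ hC b]
  simp

end Star

/-! ### The Wick star product as a series -/

section Series

variable {n : ℕ} {ℏ ς ρ : ℝ}

theorem sum_smul_single {κ E : Type*} [Fintype κ] [DecidableEq κ] [NormedAddCommGroup E]
    [NormedSpace ℂ E] (T : (κ → ℂ) →L[ℂ] E) (u : κ → ℂ) :
    ∑ j, u j • T (Pi.single j 1) = T u := by
  conv_rhs => rw [← (Pi.basisFun ℂ κ).sum_repr u, map_sum]
  simp

theorem zPart_single (ς : ℝ) (j : Fin n) : zPart ς (Pi.single j 1) = (1 / (Real.sqrt 2 : ℂ)) •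
    ((ς : ℂ)⁻¹ • Pi.single (Sum.inr j) 1 - (Complex.I * ς) • Pi.single (Sum.inl j) 1) := by
  rw [zPart_apply]
  ext (i | i)
  · by_cases h : i = j
    · subst h; simp; ring
    · simp [h]
  · by_cases h : i = j
    · subst h; simp; ring
    · simp [h]

theorem zbarPart_single (ς : ℝ) (j : Fin n) : zbarPart ς (Pi.single j 1) =
    (1 / (Real.sqrt 2 : ℂ)) •
    ((ς : ℂ)⁻¹ • Pi.single (Sum.inr j) 1 + (Complex.I * ς) • Pi.single (Sum.inl j) 1) := by
  rw [zbarPart_apply]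
  ext (i | i)
  · by_cases h : i = j
    · subst h; simp; ring
    · simp [h]
  · by_cases h : i = j
    · subst h; simp; ring
    · simp [h]

theorem IsExt.dz {F : (PQ n → ℂ) → ℂ} {f : (PQ n → ℝ) → ℂ} (hF : IsExt F f) (ς : ℝ) (j : Fin n) :
    IsExt (dirDeriv (zPart ς (Pi.single j 1)) F) (WickFock.dz ς j f) := by
  refine ⟨dirDeriv_differentiable _ hF.1, fun x => ?_⟩
  rw [WickFock.dz, ← (hF.pderiv (Sum.inr j)).2, ← (hF.pderiv (Sum.inl j)).2, zPart_single]
  simp [dirDeriv]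

theorem IsExt.dzbar {F : (PQ n → ℂ) → ℂ} {f : (PQ n → ℝ) → ℂ} (hF : IsExt F f) (ς : ℝ)
    (j : Fin n) : IsExt (dirDeriv (zbarPart ς (Pi.single j 1)) F) (WickFock.dzbar ς j f) := by
  refine ⟨dirDeriv_differentiable _ hF.1, fun x => ?_⟩
  rw [WickFock.dzbar, ← (hF.pderiv (Sum.inr j)).2, ← (hF.pderiv (Sum.inl j)).2, zbarPart_single]
  simp [dirDeriv]
  ring

theorem IsExt.foldr_dz {F : (PQ n → ℂ) → ℂ} {f : (PQ n → ℝ) → ℂ} (hF : IsExt F f) (ς : ℝ)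
    (l : List (Fin n)) : IsExt (l.foldr (fun j => dirDeriv (zPart ς (Pi.single j 1))) F)
      (l.foldr (WickFock.dz ς) f) := by
  induction l with
  | nil => exact hF
  | cons j l ih => exact ih.dz ς j

theorem IsExt.foldr_dzbar {F : (PQ n → ℂ) → ℂ} {f : (PQ n → ℝ) → ℂ} (hF : IsExt F f) (ς : ℝ)
    (l : List (Fin n)) : IsExt (l.foldr (fun j => dirDeriv (zbarPart ς (Pi.single j 1))) F)
      (l.foldr (WickFock.dzbar ς) f) := by
  induction l with
  | nil => exact hF
  | cons j l ih => exact ih.dzbar ς j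

theorem norm_list_prod_le (l : List (Fin n)) (u : Fin n → ℂ) :
    ‖(l.map u).prod‖ ≤ l.length.factorial * Real.exp (hnorm u) := by
  have h1 : ‖(l.map u).prod‖ ≤ hnorm u ^ l.length := by
    induction l with
    | nil => simp
    | cons j l ih =>
      rw [List.map_cons, List.prod_cons, norm_mul, List.length_cons, pow_succ']
      exact mul_le_mul ((norm_le_pi_norm u j).trans (norm_le_hnorm u)) ih (norm_nonneg _)
        (hnorm_nonneg u)
  refine h1.trans ?_
  have h2 := Real.pow_div_factorial_le_exp _ (hnorm_nonneg u) l.length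
  rwa [div_le_iff₀ (by exact_mod_cast Nat.factorial_pos _), mul_comm] at h2

theorem continuous_list_prod (l : List (Fin n)) :
    Continuous fun u : Fin n → ℂ => (l.map u).prod := by
  induction l with
  | nil => simpa using continuous_const
  | cons j l ih =>
    simp only [List.map_cons, List.prod_cons]
    fun_prop

theorem norm_moment_integrand_le (hℏ : 0 < ℏ) {Q : (Fin n → ℂ) → ℂ} {C : ℝ}
    (hC : ∀ ξ, ‖Q ξ‖ ≤ C * Real.exp (1 / (4 * ℏ) * hnorm ξ ^ 2)) (l : List (Fin n))
    (b u : Fin n → ℂ) :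
    ‖(l.map u).prod * Complex.exp (b ⬝ᵥ u / ℏ) * Q (star u) * gw ℏ u‖ ≤
      l.length.factorial * C * (ℏ ^ n)⁻¹ *
        Real.exp ((1 + hnorm b / ℏ) * hnorm u - 3 / (4 * ℏ) * hnorm u ^ 2) := by
  rw [norm_mul, norm_mul, norm_mul, norm_gw hℏ]
  have h1 := hC (star u)
  rw [hnorm_star] at h1
  calc _ ≤ l.length.factorial * Real.exp (hnorm u) * Real.exp (hnorm b / ℏ * hnorm u) *
        (C * Real.exp (1 / (4 * ℏ) * hnorm u ^ 2)) *
        ((ℏ ^ n)⁻¹ * Real.exp (-(1 / ℏ) * hnorm u ^ 2)) := by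
        gcongr
        · exact norm_list_prod_le l u
        · exact norm_exp_dot_div_le hℏ b u
    _ = l.length.factorial * C * (ℏ ^ n)⁻¹ * (Real.exp (hnorm u) *
        Real.exp (hnorm b / ℏ * hnorm u) * Real.exp (1 / (4 * ℏ) * hnorm u ^ 2) *
        Real.exp (-(1 / ℏ) * hnorm u ^ 2)) := by ring
    _ = _ := by
        rw [← Real.exp_add, ← Real.exp_add, ← Real.exp_add]
        congr 2
        field_simp
        ring

/-- Gaussian moments against an antiholomorphic function compute its derivatives. This follows from
the reproducing property by differentiation in `b`. -/
theorem integral_moment (hℏ : 0 < ℏ) {Q : (Fin n → ℂ) → ℂ} (hQ : Differentiable ℂ Q) {C : ℝ}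
    (hC0 : 0 ≤ C) (hC : ∀ ξ, ‖Q ξ‖ ≤ C * Real.exp (1 / (4 * ℏ) * hnorm ξ ^ 2))
    (l : List (Fin n)) (b : Fin n → ℂ) :
    ∫ u, (l.map u).prod * Complex.exp (b ⬝ᵥ u / ℏ) * Q (star u) * gw ℏ u ∂(muC n) =
      (ℏ : ℂ) ^ l.length * l.foldr (fun j => dirDeriv (Pi.single j 1)) Q b := by
  have hQc := hQ.continuous
  have hg := continuous_gw (n := n) ℏ
  induction l generalizing b with
  | nil =>
    have h := reproducing hℏ hQ (C := C) (fun ξ => (hC ξ).trans (by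
      gcongr
      rw [div_mul_eq_mul_div, one_mul]
      gcongr
      norm_num)) b
    simpa using h
  | cons j l ih =>
    have hl := continuous_list_prod (n := n) l
    set f : (Fin n → ℂ) → (Fin n → ℂ) → ℂ := fun b u =>
      (l.map u).prod * Complex.exp (b ⬝ᵥ u / ℏ) * Q (star u) * gw ℏ u with hf
    have hfc : Continuous (Function.uncurry f) := by
      simp only [Function.uncurry_def, hf]
      unfold dotProduct
      fun_prop
    have hfd : ∀ u, Differentiable ℂ fun b => f b u := by
      intro u
      have := differentiable_dot u
      simp only [hf]
      fun_prop
    have hc : (0 : ℝ) < 3 / (4 * ℏ) := by positivity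
    obtain ⟨hi, hD⟩ := hasFDerivAt_integral_of_locally_dominated (μ := muC n) hfc hfd b
      (integrable_exp_linear_sub_sq hc (l.length.factorial * C * (ℏ ^ n)⁻¹)
        (1 + (hnorm b + n * 2) / ℏ)) (fun b' hb' u => by
          refine (norm_moment_integrand_le hℏ hC l b' u).trans ?_
          have := hnorm_le_of_norm_sub_le hb'
          have := hnorm_nonneg u
          gcongr)
    have h1 : dirDeriv (Pi.single j 1) (fun b => ∫ u, f b u ∂(muC n)) b =
        ∫ u, fderiv ℂ (fun b => f b u) b (Pi.single j 1) ∂(muC n) := by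
      rw [dirDeriv, hD.fderiv, ContinuousLinearMap.integral_apply hi]
    have h2 : ∀ u, fderiv ℂ (fun b => f b u) b (Pi.single j 1) = (ℏ : ℂ)⁻¹ * (u j * f b u) := by
      intro u
      have hdot : HasDerivAt (fun t : ℂ => (b + t • Pi.single j 1) ⬝ᵥ u / ℏ) (u j / ℏ) 0 := by
        simp only [add_dotProduct, smul_dotProduct, single_one_dotProduct, smul_eq_mul]
        simpa using ((hasDerivAt_mul_const (u j)).const_add (b ⬝ᵥ u)).div_const (ℏ : ℂ)
      have h3 := hasDerivAt_line (hfd u) b (Pi.single j 1) 0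
      have h4 := (((hdot.cexp).const_mul (l.map u).prod).mul_const (Q (star u))).mul_const (gw ℏ u)
      have h5 := h3.unique h4
      simp only [zero_smul, add_zero] at h5
      rw [h5]
      simp only [hf]
      ring
    have h6 : (fun b => ∫ u, f b u ∂(muC n)) = fun b =>
        (ℏ : ℂ) ^ l.length * l.foldr (fun j => dirDeriv (Pi.single j 1)) Q b := funext ih
    simp only [h2] at h1
    rw [h6, dirDeriv_const_mul _ _ (foldr_dirDeriv_differentiable _ hQ l), integral_const_mul] at h1
    have hℏ' : (ℏ : ℂ) ≠ 0 := by exact_mod_cast hℏ.ne'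
    beta_reduce at h1
    rw [List.length_cons, List.foldr_cons, pow_succ', mul_assoc, h1, mul_inv_cancel_left₀ hℏ']
    refine integral_congr_ae (.of_forall fun u => ?_)
    simp only [hf, List.map_cons, List.prod_cons]
    ring

theorem foldr_dirDeriv_comp {κ E E' : Type*} [NormedAddCommGroup E] [NormedSpace ℂ E]
    [NormedAddCommGroup E'] [NormedSpace ℂ E'] [FiniteDimensional ℂ E'] (T : E →L[ℂ] E')
    (v : κ → E) {G : E' → ℂ} (hG : Differentiable ℂ G) (ζ : E') (l : List κ) :
    l.foldr (fun j => dirDeriv (v j)) (fun ξ => G (ζ + T ξ)) =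
      fun ξ => l.foldr (fun j => dirDeriv (T (v j))) G (ζ + T ξ) := by
  induction l with
  | nil => rfl
  | cons j l ih =>
    rw [List.foldr_cons, ih, List.foldr_cons]
    funext ξ
    have h1 := (foldr_dirDeriv_differentiable (fun j => T (v j)) hG l) (ζ + T ξ)
    have h2 : HasFDerivAt (fun ξ => ζ + T ξ) T ξ := T.hasFDerivAt.const_add ζ
    have h3 := h1.hasFDerivAt.comp ξ h2
    rw [dirDeriv]
    exact congrArg (fun A => A (v j)) h3.fderiv

/-- The series of the Wick star product converges to the Gaussian integral. The first factor is
expanded in its Taylor series in `u`, and the Gaussian moments of the second one are its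
derivatives. -/
theorem hasSum_wickTerm (hℏ : 0 < ℏ) (hρ : 0 < ρ) (hρ' : ρ ≤ 2) (ς : ℝ)
    {F G : (PQ n → ℂ) → ℂ} {f g : (PQ n → ℝ) → ℂ} (hFf : IsExt F f) (hF : MinType ρ F)
    (hGg : IsExt G g) (hG : MinType ρ G) (x : PQ n → ℝ) :
    HasSum (fun m => wickTerm ℏ ς f g m x) (starInt ℏ ς F G (toC x)) := by
  set ζ := toC x
  have hgc := continuous_gw (n := n) ℏ
  have hFc := hFf.1.continuous
  have hGc := hGg.1.continuous
  have hc := coordBound_pos (n := n) ς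
  have hη : 0 < 1 / (16 * ℏ) := by positivity
  have hη' : 0 < 1 / (4 * ℏ) := by positivity
  obtain ⟨C, hC0, hC⟩ := hF.exists_shift hρ hρ' hη _ hc
  obtain ⟨D, hD0, hD⟩ := hG.exists_shift hρ hρ' hη' _ hc
  set Q : (Fin n → ℂ) → ℂ := fun ξ => G (ζ + zbarPart ς ξ) with hQ
  have hQd : Differentiable ℂ Q := hGg.1.comp (by fun_prop)
  set D' := D * Real.exp (1 / (4 * ℏ) * ‖ζ‖ ^ ρ) with hD'
  have hQb : ∀ ξ, ‖Q ξ‖ ≤ D' * Real.exp (1 / (4 * ℏ) * hnorm ξ ^ 2) := fun ξ =>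
    hD ζ _ _ (hnorm_nonneg ξ) (norm_zbarPart_le ς ξ)
  set v : Fin n → (PQ n → ℂ) := fun j => zPart ς (Pi.single j 1) with hv
  set C' := C * Real.exp (1 / (16 * ℏ) * ‖ζ‖ ^ ρ) with hC'
  -- Cauchy's estimate on the circle of radius `2` makes the Taylor series a geometric one. The
  -- constant `1/(16ℏ)` becomes `1/(4ℏ)` there.
  have hTb : ∀ (m : ℕ) (u : Fin n → ℂ), ‖taylorTerm v F ζ m u‖ ≤
      (1 / 2) ^ m * (C' * Real.exp (1 / (4 * ℏ) * hnorm u ^ 2)) := by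
    intro m u
    have h := norm_taylorTerm_le v hFf.1 ζ m u (M := C' * Real.exp (1 / (4 * ℏ) * hnorm u ^ 2))
      two_pos fun t ht => by
        have h1 := hC ζ (t • zPart ς u) (2 * hnorm u) (by have := hnorm_nonneg u; positivity) (by
          rw [norm_smul, ht]
          have := norm_zPart_le ς u
          linarith)
        rw [hv, sum_smul_single]
        refine h1.trans (le_of_eq ?_)
        rw [hC']
        congr 2
        field_simp
        ring
    refine h.trans (le_of_eq ?_)
    rw [one_div_pow]
    ring
  have hGc' : Continuous fun u => G (ζ + zbarPart ς (star u)) := by fun_prop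
  -- The terms of the series, integrated.
  have hint : ∀ m, ∫ u, taylorTerm v F ζ m u * Q (star u) * gw ℏ u ∂(muC n) =
      wickTerm ℏ ς f g m x := by
    intro m
    have hJi : ∀ J : Fin m → Fin n, Integrable (fun u : Fin n → ℂ =>
        ((List.ofFn J).map u).prod * Q (star u) * gw ℏ u) (muC n) := by
      intro J
      have hl := continuous_list_prod (n := n) (List.ofFn J)
      have h3 : (0 : ℝ) < 3 / (4 * ℏ) := by positivity
      have hb := fun u => norm_moment_integrand_le hℏ hQb (List.ofFn J) 0 u
      simp only [zero_dotProduct, zero_div, Complex.exp_zero, mul_one] at hb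
      exact integrable_of_gauss_bound (by fun_prop) h3 hb
    have hJ : ∀ J : Fin m → Fin n, ∫ u, ((List.ofFn J).map u).prod * Q (star u) * gw ℏ u ∂(muC n) =
        (ℏ : ℂ) ^ m * (List.ofFn J).foldr (dzbar ς) g x := by
      intro J
      have h := integral_moment hℏ hQd (by positivity) hQb (List.ofFn J) 0
      rw [hQ, foldr_dirDeriv_comp (zbarPart ς) _ hGg.1] at h
      simp only [zero_dotProduct, zero_div, Complex.exp_zero, mul_one, map_zero, add_zero,
        List.length_ofFn] at h
      rw [h, (hGg.foldr_dzbar ς (List.ofFn J)).2 x]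
    have h1 : ∀ u, taylorTerm v F ζ m u * Q (star u) * gw ℏ u = ∑ J : Fin m → Fin n,
        ((m.factorial : ℂ)⁻¹ * (List.ofFn J).foldr (dz ς) f x) *
          (((List.ofFn J).map u).prod * Q (star u) * gw ℏ u) := by
      intro u
      rw [taylorTerm, mul_assoc, mul_assoc, Finset.sum_mul, Finset.mul_sum]
      refine Finset.sum_congr rfl fun J _ => ?_
      have h2 : ((List.ofFn J).map u).prod = ∏ k, u (J k) := by
        rw [List.map_ofFn, List.prod_ofFn]; rfl
      rw [h2, ← (hFf.foldr_dz ς (List.ofFn J)).2 x]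
      ring
    simp only [h1]
    rw [integral_finsetSum _ fun J _ => (hJi J).const_mul _, wickTerm, Finset.mul_sum]
    refine Finset.sum_congr rfl fun J _ => ?_
    rw [integral_const_mul, hJ]
    ring
  simp only [← hint]
  have hbi : Integrable (fun u : Fin n → ℂ => C' * D' * (ℏ ^ n)⁻¹ *
      Real.exp (-(1 / (2 * ℏ)) * hnorm u ^ 2)) (muC n) :=
    (integrable_exp_neg_hnorm_sq (by positivity)).const_mul _
  refine hasSum_integral_of_dominated_convergence (fun m u => (1 / 2 : ℝ) ^ m *
    (C' * D' * (ℏ ^ n)⁻¹ * Real.exp (-(1 / (2 * ℏ)) * hnorm u ^ 2))) (fun m => ?_)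
    (fun m => .of_forall fun u => ?_) (.of_forall fun u => ?_) ?_ (.of_forall fun u => ?_)
  · refine Continuous.aestronglyMeasurable ?_
    unfold taylorTerm
    fun_prop
  · rw [norm_mul, norm_mul, norm_gw hℏ]
    have h1 := hQb (star u)
    rw [hnorm_star] at h1
    calc _ ≤ (1 / 2) ^ m * (C' * Real.exp (1 / (4 * ℏ) * hnorm u ^ 2)) *
          (D' * Real.exp (1 / (4 * ℏ) * hnorm u ^ 2)) *
          ((ℏ ^ n)⁻¹ * Real.exp (-(1 / ℏ) * hnorm u ^ 2)) := by
          gcongr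
          exact hTb m u
      _ = (1 / 2) ^ m * (C' * D' * (ℏ ^ n)⁻¹ * (Real.exp (1 / (4 * ℏ) * hnorm u ^ 2) *
          Real.exp (1 / (4 * ℏ) * hnorm u ^ 2) * Real.exp (-(1 / ℏ) * hnorm u ^ 2))) := by ring
      _ = _ := by
          rw [← Real.exp_add, ← Real.exp_add]
          congr 3
          field_simp
          ring
  · exact (summable_geometric_of_lt_one (by norm_num) (by norm_num)).mul_right _
  · simp only [tsum_mul_right]
    exact hbi.const_mul _
  · have h := hasSum_taylorTerm v hFf.1 ζ u
    rw [hv, sum_smul_single] at h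
    exact (h.mul_right _).mul_right _

end Series

/-! ### The symplectic Fourier transform on `𝓦^ρ` -/

section Fourier

variable {n : ℕ} {ℏ ς ρ : ℝ}

/-- The entire extension of a function of class `𝓦^ρ` decreases rapidly along the real directions. -/
theorem MemW.exists_norm_le {ι : Type*} [Fintype ι] [DecidableEq ι] (hρ : 1 < ρ)
    {f : (ι → ℝ) → ℂ} (hf : MemW ρ f) {F : (ι → ℂ) → ℂ} (hF : IsExt F f) (N : ℕ) {ε : ℝ}
    (hε : 0 < ε) : ∃ C : ℝ, 0 ≤ C ∧ ∀ (x : ι → ℝ) (ζ : ι → ℂ),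
      ‖F (toC x + ζ)‖ ≤ C * ((1 + ‖x‖) ^ N)⁻¹ * Real.exp (ε * ‖ζ‖ ^ ρ) := by
  obtain ⟨L, hL, hLε⟩ := exists_rpow_div_le ι (by linarith : 0 < ρ) hε
  obtain ⟨C, hC⟩ := hf.2 L hL N
  refine ⟨2 * |C|, by positivity, fun x ζ => ?_⟩
  have h := hF.norm_le_of_mderiv hρ hL (B := |C| * ((1 + ‖x‖) ^ N)⁻¹) (by positivity) (x := x)
    (fun κ => (hC κ x).trans ?_) ζ
  · refine h.trans ?_
    rw [← mul_assoc]
    gcongr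
  · calc _ ≤ |C| * (L ^ mabs κ)⁻¹ * (mfact κ : ℝ) ^ (1 - 1 / ρ) * ((1 + ‖x‖) ^ N)⁻¹ := by
          gcongr; exact le_abs_self C
      _ = _ := by ring

theorem norm_le_norm_ofZ (hς : 0 < ς) (z : Fin n → ℂ) : ‖z‖ ≤ (ς + ς⁻¹) * ‖ofZ ς z‖ := by
  refine (pi_norm_le_iff_of_nonneg (by positivity)).2 fun j => ?_
  have h2 : (1 : ℝ) ≤ Real.sqrt 2 := Real.one_le_sqrt.2 (by norm_num)
  have hre := norm_le_pi_norm (ofZ ς z) (Sum.inr j)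
  have him := norm_le_pi_norm (ofZ ς z) (Sum.inl j)
  simp only [ofZ, Sum.elim_inl, Sum.elim_inr, Real.norm_eq_abs, abs_mul, abs_inv,
    abs_of_pos hς, abs_of_pos (zero_lt_one.trans_le h2)] at hre him
  have h3 : |(z j).re| ≤ ς * ‖ofZ ς z‖ := by
    calc |(z j).re| = ς * (1 * ς⁻¹ * |(z j).re|) := by field_simp
      _ ≤ ς * (Real.sqrt 2 * ς⁻¹ * |(z j).re|) := by gcongr
      _ ≤ _ := by gcongr; exact hre
  have h4 : |(z j).im| ≤ ς⁻¹ * ‖ofZ ς z‖ := by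
    calc |(z j).im| = ς⁻¹ * (1 * ς * |(z j).im|) := by field_simp
      _ ≤ ς⁻¹ * (Real.sqrt 2 * ς * |(z j).im|) := by gcongr
      _ ≤ _ := by gcongr; exact him
  have := Complex.norm_le_abs_re_add_abs_im (z j)
  linarith

theorem integrable_one_add_norm_ofZ (hς : 0 < ς) :
    Integrable (fun z : Fin n → ℂ => ((1 + ‖ofZ ς z‖) ^ (2 * n + 1))⁻¹) (muC n) := by
  refine integrable_muC_of_volume ?_
  have h := integrable_one_add_norm (E := Fin n → ℂ) (μ := volume) (r := ((2 * n + 1 : ℕ) : ℝ)) (by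
    simp [Module.finrank_pi_fintype, mul_comm])
  have hc : (1 : ℝ) ≤ 1 + (ς + ς⁻¹) := by
    have : 0 < ς + ς⁻¹ := by positivity
    linarith
  refine (h.const_mul ((1 + (ς + ς⁻¹)) ^ (2 * n + 1))).mono' ?_ (.of_forall fun z => ?_)
  · have := continuous_ofZ (n := n) ς
    refine Continuous.aestronglyMeasurable (Continuous.inv₀ (by fun_prop) fun z => by positivity)
  · rw [Real.norm_of_nonneg (by positivity), Real.rpow_neg (by positivity), Real.rpow_natCast,
      ← div_eq_mul_inv, le_div_iff₀ (by positivity), ← div_eq_inv_mul, ← div_pow]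
    gcongr
    rw [div_le_iff₀ (by positivity)]
    have := norm_le_norm_ofZ hς z
    have := norm_nonneg (ofZ ς z)
    nlinarith

/-- The character `exp(z·w̄ - z̄·w)` is unimodular. -/
theorem norm_exp_dot_sub (z w : Fin n → ℂ) : ‖Complex.exp (z ⬝ᵥ star w - star z ⬝ᵥ w)‖ = 1 := by
  have h : z ⬝ᵥ star w = star (star z ⬝ᵥ w) := by rw [star_dot, star_star]
  rw [Complex.norm_exp, h]
  simp

theorem MemW.integrable_ofZ (hς : 0 < ς) (hρ : 1 < ρ) {f : (PQ n → ℝ) → ℂ} (hf : MemW ρ f)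
    {F : (PQ n → ℂ) → ℂ} (hF : IsExt F f) :
    Integrable (fun z => f (ofZ ς z)) (muC n) := by
  obtain ⟨C, hC0, hC⟩ := hf.exists_norm_le hρ hF (2 * n + 1) one_pos
  have hfc := hf.1.continuous
  have ho := continuous_ofZ (n := n) ς
  have hρ0 : ρ ≠ 0 := by linarith
  refine ((integrable_one_add_norm_ofZ hς).const_mul C).mono'
    (Continuous.aestronglyMeasurable (by fun_prop)) (.of_forall fun z => ?_)
  simpa [hF.2, Real.zero_rpow hρ0] using hC (ofZ ς z) 0

theorem continuous_sympFourier (hς : 0 < ς) (hρ : 1 < ρ) {f : (PQ n → ℝ) → ℂ} (hf : MemW ρ f)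
    {F : (PQ n → ℂ) → ℂ} (hF : IsExt F f) : Continuous (sympFourier ς f) := by
  have hfc := hf.1.continuous
  have ho := continuous_ofZ (n := n) ς
  refine continuous_of_dominated (bound := fun z => ‖f (ofZ ς z)‖) (fun w => ?_)
    (fun w => .of_forall fun z => ?_) (hf.integrable_ofZ hς hρ hF).norm
    (.of_forall fun z => ?_)
  · refine Continuous.aestronglyMeasurable ?_
    unfold dotProduct; fun_prop
  · rw [norm_mul, norm_exp_dot_sub, mul_one]
  · unfold dotProduct; fun_prop

/-- The Fourier transform of a function of class `𝓦^ρ` decays faster than every Gaussian. The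
contour of integration is shifted by the imaginary multiple `i v`, `v = i S w`, of a real vector;
the shifted integral does not depend on the size of the shift, since it does not for real shifts. -/
theorem exists_norm_sympFourier_le (hς : 0 < ς) (hρ : 1 < ρ) (hρ' : ρ ≤ 2) {f : (PQ n → ℝ) → ℂ}
    (hf : MemW ρ f) {F : (PQ n → ℂ) → ℂ} (hF : IsExt F f) {S : ℝ} (hS : 0 < S) :
    ∃ C : ℝ, 0 ≤ C ∧ ∀ w, ‖sympFourier ς f w‖ ≤ C * Real.exp (-S * hnorm w ^ 2) := by
  have hc := coordBound_pos (n := n) ς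
  have hFc := hF.1.continuous
  have ho := continuous_ofZ (n := n) ς
  have hoC := continuous_toC (ι := PQ n)
  set c := coordBound n ς
  -- The shift by `i S w` gains `exp(-2S‖w‖²)` from the character, and the growth of `F` in the
  -- imaginary directions costs at most `exp(S‖w‖²)` for this `ε`.
  set ε := 1 / (4 * c ^ 2 * S) with hε
  have hε0 : 0 < ε := by positivity
  obtain ⟨C, hC0, hC⟩ := hf.exists_norm_le hρ hF (2 * n + 1) hε0
  have hint := integrable_one_add_norm_ofZ (n := n) hς
  set I := ∫ z : Fin n → ℂ, ((1 + ‖ofZ ς z‖) ^ (2 * n + 1))⁻¹ ∂(muC n) with hI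
  have hI0 : 0 ≤ I := integral_nonneg fun z => by positivity
  refine ⟨C * Real.exp ε * I, by positivity, fun w => ?_⟩
  set v : Fin n → ℂ := (Complex.I * S) • w with hv
  set a : ℂ := v ⬝ᵥ star w - star v ⬝ᵥ w with ha
  have ha' : a = 2 * Complex.I * S * ((hnorm w ^ 2 : ℝ) : ℂ) := by
    rw [ha, hv, star_smul, smul_dotProduct, smul_dotProduct, dotProduct_comm w, star_dot_self]
    simp
    ring
  set k : ℂ → (Fin n → ℂ) → ℂ := fun t z => F (toC (ofZ ς z) + t • toC (ofZ ς v)) *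
    Complex.exp (z ⬝ᵥ star w - star z ⬝ᵥ w + t * a) with hk
  have hkb : ∀ t z, ‖k t z‖ ≤ C * Real.exp (ε * (‖t‖ * ‖ofZ ς v‖) ^ ρ) *
      Real.exp (t * a).re * ((1 + ‖ofZ ς z‖) ^ (2 * n + 1))⁻¹ := by
    intro t z
    simp only [hk]
    rw [Complex.exp_add, norm_mul, norm_mul, norm_exp_dot_sub, one_mul, Complex.norm_exp]
    have h := hC (ofZ ς z) (t • toC (ofZ ς v))
    rw [norm_smul, norm_toC] at h
    calc _ ≤ C * ((1 + ‖ofZ ς z‖) ^ (2 * n + 1))⁻¹ * Real.exp (ε * (‖t‖ * ‖ofZ ς v‖) ^ ρ) *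
          Real.exp (t * a).re := by gcongr
      _ = _ := by ring
  have hkd : Differentiable ℂ fun t => ∫ z, k t z ∂(muC n) := by
    refine differentiable_integral_of_locally_dominated ?_ (fun z => ?_) fun t₀ => ?_
    · simp only [Function.uncurry_def, hk]
      unfold dotProduct
      fun_prop
    · have := differentiable_line hF.1 (toC (ofZ ς z)) (toC (ofZ ς v))
      exact this.mul (by fun_prop)
    · refine ⟨fun z => C * Real.exp (ε * ((‖t₀‖ + 2) * ‖ofZ ς v‖) ^ ρ) *
        Real.exp ((‖t₀‖ + 2) * ‖a‖) * ((1 + ‖ofZ ς z‖) ^ (2 * n + 1))⁻¹, hint.const_mul _,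
        fun t ht z => (hkb t z).trans ?_⟩
      have h1 : ‖t‖ ≤ ‖t₀‖ + 2 := by
        have := norm_le_norm_add_norm_sub' t t₀
        linarith
      have h2 : (t * a).re ≤ (‖t₀‖ + 2) * ‖a‖ :=
        (Complex.re_le_norm _).trans (by rw [norm_mul]; gcongr)
      have : 0 ≤ ρ := by linarith
      beta_reduce
      gcongr
  -- For real `t` the integral is a translate of the Fourier integral.
  have hreal : ∀ t : ℝ, ∫ z, k t z ∂(muC n) = sympFourier ς f w := by
    intro t
    rw [sympFourier, eq_comm, ← integral_add_right_eq_self _ ((t : ℂ) • v)]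
    refine integral_congr_ae (.of_forall fun z => ?_)
    have h1 : ofZ ς (z + (t : ℂ) • v) = ofZ ς z + t • ofZ ς v := by
      ext (j | j) <;> simp [ofZ] <;> ring
    have h2 : star ((t : ℂ) • v) = (t : ℂ) • star v := by simp
    simp only [hk, h1, h2, star_add, add_dotProduct, smul_dotProduct, ← hF.2, toC_add, toC_smul, ha,
      smul_eq_mul]
    congr 2
    ring
  have h1 := eq_of_eq_real hkd (differentiable_const (sympFourier ς f w)) hreal Complex.I
  rw [← h1]
  refine (norm_integral_le_of_norm_le (hint.const_mul _) (.of_forall (hkb Complex.I))).trans ?_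
  rw [integral_const_mul, ← hI]
  have h2 : (Complex.I * a).re = -(2 * S) * hnorm w ^ 2 := by
    have : Complex.I * a = ((-(2 * S) * hnorm w ^ 2 : ℝ) : ℂ) := by
      rw [ha']; push_cast
      linear_combination (2 * S * (hnorm w : ℂ) ^ 2) * Complex.I_sq
    rw [this, Complex.ofReal_re]
  have h3 : ‖ofZ ς v‖ ≤ 2 * c * (S * hnorm w) := by
    have e : hnorm v = S * hnorm w := by
      rw [hv, hnorm_smul, norm_mul, Complex.norm_I, one_mul, Complex.norm_real,
        Real.norm_of_nonneg hS.le]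
    have e1 := norm_zPart_le ς v
    have e2 := norm_zbarPart_le ς (star v)
    rw [hnorm_star] at e2
    rw [← norm_toC, toC_ofZ, ← e]
    refine (norm_add_le _ _).trans ?_
    linarith
  have h4 : ε * (‖Complex.I‖ * ‖ofZ ς v‖) ^ ρ ≤ ε + S * hnorm w ^ 2 := by
    rw [Complex.norm_I, one_mul]
    calc ε * ‖ofZ ς v‖ ^ ρ ≤ ε * (1 + ‖ofZ ς v‖ ^ 2) := by
          gcongr
          exact rpow_le_one_add_sq (by linarith) hρ' (norm_nonneg _)
      _ ≤ ε * (1 + (2 * c * (S * hnorm w)) ^ 2) := by gcongr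
      _ = ε + S * hnorm w ^ 2 := by rw [hε]; field_simp; ring
  calc _ ≤ C * Real.exp (ε + S * hnorm w ^ 2) * Real.exp (-(2 * S) * hnorm w ^ 2) * I := by
        rw [h2]; gcongr
    _ = C * (Real.exp (ε + S * hnorm w ^ 2) * Real.exp (-(2 * S) * hnorm w ^ 2)) * I := by ring
    _ = C * (Real.exp ε * Real.exp (-S * hnorm w ^ 2)) * I := by
        rw [← Real.exp_add, ← Real.exp_add]; ring_nf
    _ = _ := by ring

/-- The Fourier transform of a Gaussian is a Gaussian: the reproducing property for an exponential
function. -/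
theorem integral_character_mul_gauss {ε : ℝ} (hε : 0 < ε) (d : Fin n → ℂ) :
    ∫ w, Complex.exp (d ⬝ᵥ star w - star d ⬝ᵥ w) * Real.exp (-ε * hnorm w ^ 2) ∂(muC n) =
      gw ε d := by
  have hε' : 0 < ε⁻¹ := by positivity
  have hεc : (ε : ℂ) ≠ 0 := by exact_mod_cast hε.ne'
  have hQ : Differentiable ℂ fun ξ : Fin n → ℂ => Complex.exp (d ⬝ᵥ ξ) := by
    unfold dotProduct; fun_prop
  have h := reproducing hε' hQ (C := Real.exp (hnorm d ^ 2 / (2 * ε))) (fun ξ => by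
    rw [Complex.norm_exp, ← Real.exp_add]
    refine Real.exp_le_exp.2 ((re_dot_le d ξ).trans ?_)
    have h1 : hnorm d ^ 2 / (2 * ε) + hnorm ξ ^ 2 / (2 * ε⁻¹) - hnorm d * hnorm ξ =
        (hnorm d - ε * hnorm ξ) ^ 2 / (2 * ε) := by field_simp; ring
    have : 0 ≤ (hnorm d - ε * hnorm ξ) ^ 2 / (2 * ε) := by positivity
    linarith) (-(ε : ℂ)⁻¹ • star d)
  rw [dotProduct_smul, dotProduct_comm d, star_dot_self] at h
  have h2 : ∀ w : Fin n → ℂ, Complex.exp (d ⬝ᵥ star w - star d ⬝ᵥ w) *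
      Real.exp (-ε * hnorm w ^ 2) = (ε⁻¹ : ℂ) ^ n * (Complex.exp ((-(ε : ℂ)⁻¹ • star d) ⬝ᵥ w /
        (ε⁻¹ : ℝ)) * Complex.exp (d ⬝ᵥ star w) * gw ε⁻¹ w) := by
    intro w
    have e1 : (-(ε : ℂ)⁻¹ • star d) ⬝ᵥ w / (ε⁻¹ : ℝ) = -(star d ⬝ᵥ w) := by
      rw [smul_dotProduct]; push_cast; field_simp; rw [smul_eq_mul]; field_simp
    rw [e1, sub_eq_add_neg, Complex.exp_add, gw]
    push_cast
    have e2 : (ε : ℂ) ^ n ≠ 0 := pow_ne_zero _ hεc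
    field_simp
  simp only [h2]
  rw [integral_const_mul, h, gw]
  push_cast
  rw [smul_eq_mul, inv_pow]
  congr 2
  field_simp

theorem integral_comp_smul_gw {s : ℝ} (hs : 0 < s) (g : (Fin n → ℂ) → ℂ) :
    ∫ u, g (s • u) * gw 1 u ∂(muC n) = ∫ u, g u * gw (s ^ 2) u ∂(muC n) := by
  have h := Measure.integral_comp_smul volume (fun u : Fin n → ℂ => g u * gw 1 (s⁻¹ • u)) s
  have h1 : ∀ u : Fin n → ℂ, s⁻¹ • s • u = u := fun u => by
    rw [smul_smul, inv_mul_cancel₀ hs.ne', one_smul]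
  simp only [h1] at h
  rw [integral_muC, integral_muC, h, ← integral_smul]
  congr 2
  funext u
  have h2 : hnorm (s⁻¹ • u) = s⁻¹ * hnorm u := by
    have : s⁻¹ • u = ((s⁻¹ : ℝ) : ℂ) • u := by ext; simp
    rw [this, hnorm_smul, Complex.norm_real, Real.norm_of_nonneg (by positivity)]
  have h3 : Module.finrank ℝ (Fin n → ℂ) = 2 * n := by
    simp [Module.finrank_pi_fintype, mul_comm]
  rw [gw, gw, h2, h3, abs_of_pos (by positivity), pow_mul, Complex.real_smul]
  push_cast
  have e : -(1 / 1) * ((s : ℂ)⁻¹ * hnorm u) ^ 2 = -(1 / (s : ℂ) ^ 2) * hnorm u ^ 2 := by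
    field_simp
  rw [e]
  simp
  ring

/-- Fourier inversion, by Gaussian regularization. -/
theorem integral_sympFourier (hς : 0 < ς) (hρ : 1 < ρ) (hρ' : ρ ≤ 2) {f : (PQ n → ℝ) → ℂ}
    (hf : MemW ρ f) {F : (PQ n → ℂ) → ℂ} (hF : IsExt F f) (z : Fin n → ℂ) :
    ∫ w, sympFourier ς f w * Complex.exp (w ⬝ᵥ star z - star w ⬝ᵥ z) ∂(muC n) = f (ofZ ς z) := by
  have hfc := hf.1.continuous
  have ho := continuous_ofZ (n := n) ς
  have hh := continuous_hnorm (n := n)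
  have hg := continuous_gw (n := n) 1
  have hi := hf.integrable_ofZ hς hρ hF
  have hsc := continuous_sympFourier hς hρ hf hF
  obtain ⟨C, hC0, hC⟩ := exists_norm_sympFourier_le hς hρ hρ' hf hF one_pos
  have hfb : ∃ B, ∀ x, ‖f x‖ ≤ B := by
    obtain ⟨B, -, hB⟩ := hf.exists_norm_le hρ hF 0 one_pos
    have hρ0 : ρ ≠ 0 := by linarith
    exact ⟨B, fun x => by simpa [hF.2, Real.zero_rpow hρ0] using hB x 0⟩
  obtain ⟨B, hB⟩ := hfb
  set s : ℕ → ℝ := fun k => 1 / ((k : ℝ) + 1) with hs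
  have hs0 : ∀ k, 0 < s k := fun k => by simp only [hs]; positivity
  have hst : Filter.Tendsto s Filter.atTop (nhds 0) := tendsto_one_div_add_atTop_nhds_zero_nat
  -- The regularized inversion integral is the average of `f` over a Gaussian of width `s k` about `z`.
  have hreg : ∀ k, ∫ w, sympFourier ς f w * Complex.exp (w ⬝ᵥ star z - star w ⬝ᵥ z) *
      Real.exp (-(s k ^ 2) * hnorm w ^ 2) ∂(muC n) =
      ∫ u, f (ofZ ς (s k • u + z)) * gw 1 u ∂(muC n) := by
    intro k
    have hk : 0 < s k ^ 2 := pow_pos (hs0 k) 2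
    have hprod : Integrable (Function.uncurry fun (w z' : Fin n → ℂ) =>
        f (ofZ ς z') * Complex.exp (z' ⬝ᵥ star w - star z' ⬝ᵥ w) *
          Complex.exp (w ⬝ᵥ star z - star w ⬝ᵥ z) * Real.exp (-(s k ^ 2) * hnorm w ^ 2))
        ((muC n).prod (muC n)) := by
      refine ((integrable_exp_neg_hnorm_sq hk).mul_prod hi.norm).mono'
        (Continuous.aestronglyMeasurable ?_) (.of_forall fun p => ?_)
      · simp only [Function.uncurry_def]
        unfold dotProduct
        fun_prop
      · simp only [Function.uncurry, norm_mul, norm_exp_dot_sub, mul_one, Complex.norm_real,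
          Real.norm_of_nonneg (Real.exp_pos _).le]
        rw [mul_comm]
    rw [integral_comp_smul_gw (hs0 k) fun u => f (ofZ ς (u + z)),
      ← integral_sub_right_eq_self (fun u => f (ofZ ς (u + z)) * gw (s k ^ 2) u) z]
    simp only [sub_add_cancel]
    have hsw := integral_integral_swap hprod
    calc _ = _ := integral_congr_ae (.of_forall fun w => by
            rw [sympFourier, ← integral_mul_const, ← integral_mul_const])
      _ = _ := hsw
      _ = _ := by
          refine integral_congr_ae (.of_forall fun z' => ?_)
          beta_reduce
          rw [← integral_character_mul_gauss hk, ← integral_const_mul]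
          refine integral_congr_ae (.of_forall fun w => ?_)
          beta_reduce
          rw [mul_assoc (f _), ← Complex.exp_add, mul_assoc]
          congr 3
          rw [star_sub, sub_dotProduct, sub_dotProduct, dotProduct_comm w, dotProduct_comm (star w)]
          ring
  have hL : Filter.Tendsto (fun k => ∫ w, sympFourier ς f w *
      Complex.exp (w ⬝ᵥ star z - star w ⬝ᵥ z) * Real.exp (-(s k ^ 2) * hnorm w ^ 2) ∂(muC n))
      Filter.atTop (nhds (∫ w, sympFourier ς f w *
        Complex.exp (w ⬝ᵥ star z - star w ⬝ᵥ z) ∂(muC n))) := by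
    refine tendsto_integral_of_dominated_convergence (fun w => C * Real.exp (-1 * hnorm w ^ 2))
      (fun k => ?_) ((integrable_exp_neg_hnorm_sq one_pos).const_mul C)
      (fun k => .of_forall fun w => ?_) (.of_forall fun w => ?_)
    · refine Continuous.aestronglyMeasurable ?_
      unfold dotProduct
      fun_prop
    · rw [norm_mul, norm_mul, norm_exp_dot_sub, mul_one, Complex.norm_real,
        Real.norm_of_nonneg (Real.exp_pos _).le]
      refine (mul_le_of_le_one_right (norm_nonneg _) ?_).trans (hC w)
      rw [Real.exp_le_one_iff]
      have : 0 ≤ s k ^ 2 * hnorm w ^ 2 := by positivity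
      linarith
    · have h1 : Continuous fun t : ℝ => sympFourier ς f w *
          Complex.exp (w ⬝ᵥ star z - star w ⬝ᵥ z) * Real.exp (-(t ^ 2) * hnorm w ^ 2) := by
        fun_prop
      have h2 := (h1.tendsto 0).comp hst
      simpa [Function.comp_def] using h2
  have hR : Filter.Tendsto (fun k => ∫ u, f (ofZ ς (s k • u + z)) * gw 1 u ∂(muC n))
      Filter.atTop (nhds (∫ u, f (ofZ ς z) * gw 1 u ∂(muC n))) := by
    refine tendsto_integral_of_dominated_convergence (fun u => B * ‖gw 1 u‖)
      (fun k => Continuous.aestronglyMeasurable (by fun_prop)) ?_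
      (fun k => .of_forall fun u => ?_) (.of_forall fun u => ?_)
    · simp only [norm_gw one_pos]
      exact ((integrable_exp_neg_hnorm_sq (by norm_num)).const_mul _).const_mul _
    · rw [norm_mul]
      gcongr
      exact hB _
    · have h1 : Continuous fun t : ℝ => f (ofZ ς (t • u + z)) * gw 1 u := by fun_prop
      have h2 := (h1.tendsto 0).comp hst
      simpa [Function.comp_def] using h2
  simp only [hreg] at hL
  rw [tendsto_nhds_unique hL hR, integral_const_mul, integral_gw one_pos, mul_one]

end Fourier

/-! ### The Wick correspondence on `𝓦^ρ` -/

section Correspondence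

variable {n : ℕ} {ℏ ς ρ : ℝ}

theorem norm_exp_dot_le (b u : Fin n → ℂ) :
    ‖Complex.exp (b ⬝ᵥ u)‖ ≤ Real.exp (hnorm b * hnorm u) := by
  rw [Complex.norm_exp]
  exact Real.exp_le_exp.2 (re_dot_le b u)

theorem norm_exp_dot_sub_dot_le (w b u : Fin n → ℂ) :
    ‖Complex.exp (w ⬝ᵥ b - star w ⬝ᵥ u)‖ ≤ Real.exp ((hnorm b + hnorm u) * hnorm w) := by
  rw [Complex.norm_exp, Complex.sub_re]
  refine Real.exp_le_exp.2 ?_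
  have h1 := re_dot_le w b
  have h2 := re_dot_le (-star w) u
  rw [neg_dotProduct, hnorm_neg, hnorm_star, Complex.neg_re] at h2
  linarith

/-- Fourier inversion for the entire extension. The Gaussian decay of the Fourier transform makes
the integral entire in `(u, b)`. -/
theorem isExt_eq_integral (hς : 0 < ς) (hρ : 1 < ρ) (hρ' : ρ ≤ 2) {f : (PQ n → ℝ) → ℂ}
    (hf : MemW ρ f) {F : (PQ n → ℂ) → ℂ} (hF : IsExt F f) (u b : Fin n → ℂ) :
    F (zPart ς u + zbarPart ς b) =
      ∫ w, sympFourier ς f w * Complex.exp (w ⬝ᵥ b - star w ⬝ᵥ u) ∂(muC n) := by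
  have hsc := continuous_sympFourier hς hρ hf hF
  obtain ⟨C, hC0, hC⟩ := exists_norm_sympFourier_le hς hρ hρ' hf hF one_pos
  have hL : Differentiable ℂ fun p : (Fin n → ℂ) × (Fin n → ℂ) =>
      F (zPart ς p.1 + zbarPart ς p.2) := hF.1.comp (by fun_prop)
  have hR : Differentiable ℂ fun p : (Fin n → ℂ) × (Fin n → ℂ) =>
      ∫ w, sympFourier ς f w * Complex.exp (w ⬝ᵥ p.2 - star w ⬝ᵥ p.1) ∂(muC n) := by
    refine differentiable_integral_of_locally_dominated ?_ (fun w => ?_) fun p₀ => ?_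
    · simp only [Function.uncurry_def]
      unfold dotProduct
      fun_prop
    · unfold dotProduct
      fun_prop
    · refine ⟨fun w => C * Real.exp ((hnorm p₀.2 + n * 2 + (hnorm p₀.1 + n * 2)) * hnorm w -
        1 * hnorm w ^ 2), integrable_exp_linear_sub_sq one_pos _ _, fun p hp w => ?_⟩
      have h1 := hnorm_le_of_norm_sub_le ((norm_fst_le (p - p₀)).trans hp)
      have h2 := hnorm_le_of_norm_sub_le ((norm_snd_le (p - p₀)).trans hp)
      have hw := hnorm_nonneg w
      rw [norm_mul]
      calc _ ≤ C * Real.exp (-1 * hnorm w ^ 2) *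
            Real.exp ((hnorm p.2 + hnorm p.1) * hnorm w) := by
            gcongr
            · exact hC w
            · exact norm_exp_dot_sub_dot_le w p.2 p.1
        _ ≤ C * Real.exp (-1 * hnorm w ^ 2) *
            Real.exp ((hnorm p₀.2 + n * 2 + (hnorm p₀.1 + n * 2)) * hnorm w) := by gcongr
        _ = _ := by
            rw [mul_assoc, ← Real.exp_add]
            ring_nf
  refine congrFun (eq_of_eq_conj hL hR fun w => ?_) (u, b)
  rw [← toC_ofZ, hF.2]
  exact (integral_sympFourier hς hρ hρ' hf hF w).symm

theorem hnorm_sub_smul_sq_le (hℏ : 0 < ℏ) (z w : Fin n → ℂ) :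
    hnorm (z - (ℏ : ℂ) • w) ^ 2 / (2 * ℏ) ≤ hnorm z ^ 2 / ℏ + ℏ * hnorm w ^ 2 := by
  have h1 : hnorm (z - (ℏ : ℂ) • w) ≤ hnorm z + ℏ * hnorm w := by
    have := hnorm_add_le z (-((ℏ : ℂ) • w))
    rwa [hnorm_neg, hnorm_smul, Complex.norm_real, Real.norm_of_nonneg hℏ.le,
      ← sub_eq_add_neg] at this
  have h2 : hnorm z ^ 2 / ℏ + ℏ * hnorm w ^ 2 =
      (2 * (hnorm z ^ 2 + (ℏ * hnorm w) ^ 2)) / (2 * ℏ) := by field_simp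
  rw [h2]
  have h0 := hnorm_nonneg (z - (ℏ : ℂ) • w)
  gcongr
  nlinarith [sq_nonneg (hnorm z - ℏ * hnorm w)]

/-- The integral of the Wick correspondence converges absolutely. The decay of `f̃` beats the growth
`exp(ℏ‖w‖²)` of the shifted function. -/
theorem integrable_wickIntegrand (hℏ : 0 < ℏ) (hς : 0 < ς) (hρ : 1 < ρ) (hρ' : ρ ≤ 2)
    {f : (PQ n → ℝ) → ℂ} (hf : MemW ρ f) {F : (PQ n → ℂ) → ℂ} (hF : IsExt F f)
    {Φ : (Fin n → ℂ) → ℂ} (hΦ : Continuous Φ) {D : ℝ} (hD : FockBound ℏ D Φ) (z : Fin n → ℂ) :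
    Integrable (wickIntegrand ℏ ς f Φ z) (muC n) := by
  have hsc := continuous_sympFourier hς hρ hf hF
  have hD0 := hD.nonneg
  obtain ⟨C, hC0, hC⟩ := exists_norm_sympFourier_le hς hρ hρ' hf hF (S := 1 + ℏ) (by positivity)
  refine integrable_of_gauss_bound (C := C * D * Real.exp (hnorm z ^ 2 / ℏ)) (b := hnorm z)
    (c := 1) ?_ one_pos fun w => ?_
  · unfold wickIntegrand dotProduct
    fun_prop
  · rw [wickIntegrand, norm_mul, norm_mul]
    have h1 := norm_exp_dot_le w (star z)
    rw [hnorm_star] at h1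
    calc _ ≤ C * Real.exp (-(1 + ℏ) * hnorm w ^ 2) * (Real.exp (hnorm w * hnorm z) *
          (D * Real.exp (hnorm (z - (ℏ : ℂ) • w) ^ 2 / (2 * ℏ)))) := by
          gcongr
          · exact hC w
          · exact hD _
      _ ≤ C * Real.exp (-(1 + ℏ) * hnorm w ^ 2) * (Real.exp (hnorm w * hnorm z) *
          (D * Real.exp (hnorm z ^ 2 / ℏ + ℏ * hnorm w ^ 2))) := by
          gcongr
          exact hnorm_sub_smul_sq_le hℏ z w
      _ = C * D * Real.exp (hnorm z ^ 2 / ℏ) * (Real.exp (-(1 + ℏ) * hnorm w ^ 2) *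
          Real.exp (hnorm w * hnorm z) * Real.exp (ℏ * hnorm w ^ 2)) := by
          rw [Real.exp_add]; ring
      _ = _ := by
          rw [← Real.exp_add, ← Real.exp_add]
          ring_nf

/-- On `𝓦^ρ` the Wick correspondence is given by the kernel representation `wop`: the shift
`φ(z̄ - ℏ w̄)` is written with the reproducing kernel, and the integral over `w` is then the Fourier
inversion formula for the symbol. -/
theorem wickOp_eq_wop (hℏ : 0 < ℏ) (hς : 0 < ς) (hρ : 1 < ρ) (hρ' : ρ ≤ 2)
    {f : (PQ n → ℝ) → ℂ} (hf : MemW ρ f) {F : (PQ n → ℂ) → ℂ} (hF : IsExt F f)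
    {Q : (Fin n → ℂ) → ℂ} (hQ : Differentiable ℂ Q) {D : ℝ} (hD : FockBound ℏ D Q)
    (z : Fin n → ℂ) :
    wickOp ℏ ς f (fun u => Q (star u)) z = wop ℏ ς F (fun u => Q (star u)) (star z) := by
  set b := star z with hb
  have hsc := continuous_sympFourier hς hρ hf hF
  have hg := continuous_gw (n := n) ℏ
  have hQc := hQ.continuous
  have hD0 := hD.nonneg
  have hℏ' : (ℏ : ℂ) ≠ 0 := by exact_mod_cast hℏ.ne'
  have hc : (0 : ℝ) < 1 / (4 * ℏ) := by positivity
  obtain ⟨C, hC0, hC⟩ := exists_norm_sympFourier_le hς hρ hρ' hf hF (S := 1 + ℏ) (by positivity)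
  set K : (Fin n → ℂ) → (Fin n → ℂ) → ℂ := fun w u => sympFourier ς f w *
    Complex.exp (w ⬝ᵥ b - star w ⬝ᵥ u) * Complex.exp (b ⬝ᵥ u / ℏ) * Q (star u) * gw ℏ u with hK
  have hint : Integrable (Function.uncurry K) ((muC n).prod (muC n)) := by
    refine ((integrable_exp_linear_sub_sq (n := n) one_pos (C * D * (ℏ ^ n)⁻¹)
      (hnorm b)).mul_prod (integrable_exp_linear_sub_sq (n := n) hc 1 (hnorm b / ℏ))).mono'
      (Continuous.aestronglyMeasurable ?_) (.of_forall fun p => ?_)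
    · simp only [Function.uncurry_def, hK]
      unfold dotProduct
      fun_prop
    · obtain ⟨w, u⟩ := p
      simp only [Function.uncurry, hK, norm_mul, norm_gw hℏ]
      have h1 := hD (star u)
      rw [hnorm_star] at h1
      have hwu : hnorm u * hnorm w ≤ ℏ * hnorm w ^ 2 + hnorm u ^ 2 / (4 * ℏ) := by
        have h : ℏ * hnorm w ^ 2 + hnorm u ^ 2 / (4 * ℏ) - hnorm u * hnorm w =
            (2 * ℏ * hnorm w - hnorm u) ^ 2 / (4 * ℏ) := by field_simp; ring
        have : 0 ≤ (2 * ℏ * hnorm w - hnorm u) ^ 2 / (4 * ℏ) := by positivity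
        linarith
      calc _ ≤ C * Real.exp (-(1 + ℏ) * hnorm w ^ 2) *
            Real.exp ((hnorm b + hnorm u) * hnorm w) * Real.exp (hnorm b / ℏ * hnorm u) *
            (D * Real.exp (hnorm u ^ 2 / (2 * ℏ))) *
            ((ℏ ^ n)⁻¹ * Real.exp (-(1 / ℏ) * hnorm u ^ 2)) := by
            gcongr
            · exact hC w
            · exact norm_exp_dot_sub_dot_le w b u
            · exact norm_exp_dot_div_le hℏ b u
        _ ≤ C * Real.exp (-(1 + ℏ) * hnorm w ^ 2) *
            Real.exp (hnorm b * hnorm w + (ℏ * hnorm w ^ 2 + hnorm u ^ 2 / (4 * ℏ))) *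
            Real.exp (hnorm b / ℏ * hnorm u) *
            (D * Real.exp (hnorm u ^ 2 / (2 * ℏ))) *
            ((ℏ ^ n)⁻¹ * Real.exp (-(1 / ℏ) * hnorm u ^ 2)) := by
            rw [add_mul]
            gcongr
        _ = C * D * (ℏ ^ n)⁻¹ * (Real.exp (-(1 + ℏ) * hnorm w ^ 2) *
            Real.exp (hnorm b * hnorm w + (ℏ * hnorm w ^ 2 + hnorm u ^ 2 / (4 * ℏ))) *
            Real.exp (hnorm b / ℏ * hnorm u) * Real.exp (hnorm u ^ 2 / (2 * ℏ)) *
            Real.exp (-(1 / ℏ) * hnorm u ^ 2)) := by ring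
        _ = _ := by
            rw [one_mul (Real.exp _), mul_assoc (C * D * (ℏ ^ n)⁻¹) (Real.exp _) (Real.exp _)]
            simp only [← Real.exp_add]
            congr 2
            field_simp
            ring
  have hin : ∀ w, ∫ u, K w u ∂(muC n) =
      wickIntegrand ℏ ς f (fun u => Q (star u)) z w := by
    intro w
    have h := reproducing hℏ hQ hD (b - (ℏ : ℂ) • star w)
    rw [wickIntegrand, star_sub, star_smul, ← hb]
    have e : star (ℏ : ℂ) = ℏ := by simp
    rw [e, ← h, ← integral_const_mul, ← integral_const_mul]
    refine integral_congr_ae (.of_forall fun u => ?_)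
    simp only [hK]
    have e1 : Complex.exp (w ⬝ᵥ b - star w ⬝ᵥ u) * Complex.exp (b ⬝ᵥ u / ℏ) =
        Complex.exp (w ⬝ᵥ b) * Complex.exp ((b - (ℏ : ℂ) • star w) ⬝ᵥ u / ℏ) := by
      rw [← Complex.exp_add, ← Complex.exp_add, sub_dotProduct, smul_dotProduct, smul_eq_mul]
      congr 1
      field_simp
      ring
    linear_combination (sympFourier ς f w * Q (star u) * gw ℏ u) * e1
  have hswap := integral_integral_swap hint
  simp only [hin] at hswap
  rw [wickOp, hswap, wop]
  refine integral_congr_ae (.of_forall fun u => ?_)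
  beta_reduce
  rw [isExt_eq_integral hς hρ hρ' hf hF u b, ← integral_mul_const, ← integral_mul_const,
    ← integral_mul_const]

end Correspondence

/-! ### Approximation by functions of class `𝓦^ρ` -/

section Cutoff

/-- Polynomial and exponential growth are dominated by growth of order `ρ > 1` and any type. -/
theorem exists_pow_mul_exp_le {ρ ε : ℝ} (hρ : 1 < ρ) (hε : 0 < ε) (N : ℕ) {a : ℝ} (ha : 0 ≤ a) :
    ∃ C : ℝ, 0 ≤ C ∧ ∀ t : ℝ, 0 ≤ t →
      (1 + t) ^ N * Real.exp (a * t) ≤ C * Real.exp (ε * t ^ ρ) := by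
  have hρ1 : 0 < ρ - 1 := by linarith
  have ha1 : 0 < a + 1 := by linarith
  set T := ((a + 1) / ε) ^ (1 / (ρ - 1)) with hT
  have hT0 : 0 < T := by positivity
  have hTρ : T ^ (ρ - 1) = (a + 1) / ε := by
    rw [hT, ← Real.rpow_mul (by positivity), one_div_mul_cancel hρ1.ne', Real.rpow_one]
  refine ⟨N.factorial * Real.exp 1 * Real.exp ((a + 1) * T), by positivity, fun t ht => ?_⟩
  have h1 : (1 + t) ^ N ≤ N.factorial * Real.exp (1 + t) := by
    have := Real.pow_div_factorial_le_exp (1 + t) (by linarith) N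
    rwa [div_le_iff₀ (by exact_mod_cast N.factorial_pos), mul_comm] at this
  have h2 : (a + 1) * t ≤ (a + 1) * T + ε * t ^ ρ := by
    rcases le_total t T with h | h
    · have h3 : 0 ≤ ε * t ^ ρ := by positivity
      have h4 : (a + 1) * t ≤ (a + 1) * T := by gcongr
      linarith
    · have ht' : 0 < t := hT0.trans_le h
      have h3 : (a + 1) / ε ≤ t ^ (ρ - 1) := by
        rw [← hTρ]; gcongr
      rw [div_le_iff₀ hε] at h3
      have h4 : t ^ ρ = t ^ (ρ - 1) * t := by
        rw [← Real.rpow_add_one ht'.ne']; congr 1; ring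
      have h5 : (a + 1) * t ≤ t ^ (ρ - 1) * ε * t := by gcongr
      have h6 : 0 ≤ (a + 1) * T := by positivity
      rw [h4]
      linarith
  calc _ ≤ N.factorial * Real.exp (1 + t) * Real.exp (a * t) := by gcongr
    _ = N.factorial * Real.exp 1 * Real.exp ((a + 1) * t) := by
        rw [mul_assoc, mul_assoc, ← Real.exp_add, ← Real.exp_add]; ring_nf
    _ ≤ N.factorial * Real.exp 1 * Real.exp ((a + 1) * T + ε * t ^ ρ) := by gcongr
    _ = _ := by rw [Real.exp_add]; ring

/-- The Fourier–Laplace transform of `g`. -/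
noncomputable def fourierLaplace (g : ℝ → ℂ) (ζ : ℂ) : ℂ :=
  ∫ k, g k * Complex.exp (Complex.I * k * ζ)

theorem norm_fourierLaplace_integrand_le {g : ℝ → ℂ} (hs : tsupport g ⊆ Set.Icc (-1) 1) (ζ : ℂ)
    (k : ℝ) : ‖g k * Complex.exp (Complex.I * k * ζ)‖ ≤ ‖g k‖ * Real.exp |ζ.im| := by
  by_cases h : g k = 0
  · simp [h]
  · have hk : |k| ≤ 1 := abs_le.2 (hs (subset_tsupport g h))
    rw [norm_mul, Complex.norm_exp]
    gcongr
    have : (Complex.I * k * ζ).re = -(k * ζ.im) := by simp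
    rw [this]
    calc -(k * ζ.im) ≤ |k * ζ.im| := neg_le_abs _
      _ = |k| * |ζ.im| := abs_mul _ _
      _ ≤ |ζ.im| := mul_le_of_le_one_left (abs_nonneg _) hk

theorem integrable_of_tsupport {g : ℝ → ℂ} (hg : Continuous g) (hs : tsupport g ⊆ Set.Icc (-1) 1) :
    Integrable g :=
  hg.integrable_of_hasCompactSupport (isCompact_Icc.of_isClosed_subset (isClosed_tsupport g) hs)

theorem integrable_fourierLaplace_integrand {g : ℝ → ℂ} (hg : Continuous g)
    (hs : tsupport g ⊆ Set.Icc (-1) 1) (ζ : ℂ) :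
    Integrable fun k : ℝ => g k * Complex.exp (Complex.I * k * ζ) :=
  ((integrable_of_tsupport hg hs).norm.mul_const _).mono'
    (Continuous.aestronglyMeasurable (by fun_prop))
    (.of_forall (norm_fourierLaplace_integrand_le hs ζ))

theorem fourierLaplace_differentiable {g : ℝ → ℂ} (hg : Continuous g)
    (hs : tsupport g ⊆ Set.Icc (-1) 1) : Differentiable ℂ (fourierLaplace g) := by
  refine differentiable_integral_of_locally_dominated ?_ (fun k => by fun_prop) fun ζ₀ => ?_
  · simp only [Function.uncurry_def]
    fun_prop
  · refine ⟨fun k => ‖g k‖ * Real.exp (‖ζ₀‖ + 2), (integrable_of_tsupport hg hs).norm.mul_const _,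
      fun ζ hζ k => (norm_fourierLaplace_integrand_le hs ζ k).trans ?_⟩
    have h1 := Complex.abs_im_le_norm ζ
    have h2 := norm_le_norm_add_norm_sub' ζ ζ₀
    have h3 : |ζ.im| ≤ ‖ζ₀‖ + 2 := by linarith
    beta_reduce
    gcongr

/-- The easy half of the Paley–Wiener theorem, by repeated integration by parts. -/
theorem exists_norm_fourierLaplace_le (N : ℕ) {g : ℝ → ℂ} (hg : ContDiff ℝ ∞ g)
    (hs : tsupport g ⊆ Set.Icc (-1) 1) :
    ∃ C : ℝ, ∀ ζ, (1 + ‖ζ‖) ^ N * ‖fourierLaplace g ζ‖ ≤ C * Real.exp |ζ.im| := by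
  induction N generalizing g with
  | zero =>
    refine ⟨∫ k, ‖g k‖, fun ζ => ?_⟩
    rw [pow_zero, one_mul, ← integral_mul_const]
    exact norm_integral_le_of_norm_le
      ((integrable_of_tsupport hg.continuous hs).norm.mul_const _)
      (.of_forall (norm_fourierLaplace_integrand_le hs ζ))
  | succ N ih =>
    have hg' : ContDiff ℝ ∞ (deriv g) := (contDiff_infty_iff_deriv.1 hg).2
    have hs' : tsupport (deriv g) ⊆ Set.Icc (-1) 1 := tsupport_deriv_subset.trans hs
    obtain ⟨C, hC⟩ := ih hg hs
    obtain ⟨D, hD⟩ := ih hg' hs'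
    refine ⟨C + D, fun ζ => ?_⟩
    have h1 : fourierLaplace (deriv g) ζ = -(Complex.I * ζ) * fourierLaplace g ζ := by
      have he : ∀ k : ℝ, HasDerivAt (fun k : ℝ => Complex.exp (Complex.I * k * ζ))
          (Complex.exp (Complex.I * k * ζ) * (Complex.I * ζ)) k := by
        intro k
        have h2 : HasDerivAt (fun k : ℝ => Complex.I * (k : ℂ) * ζ) (Complex.I * ζ) k := by
          simpa using ((Complex.ofRealCLM.hasDerivAt (x := k)).const_mul Complex.I).mul_const ζ
        exact h2.cexp
      have hgd : ∀ k, HasDerivAt g (deriv g k) k := fun k =>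
        (hg.differentiable (by simp) k).hasDerivAt
      have hi := integrable_fourierLaplace_integrand hg.continuous hs ζ
      have h3 := integral_mul_deriv_eq_deriv_mul_of_integrable (fun k _ => hgd k)
        (fun k _ => he k) ((hi.mul_const (Complex.I * ζ)).congr (.of_forall fun k => mul_assoc _ _ _))
        (integrable_fourierLaplace_integrand hg'.continuous hs' ζ) hi
      rw [fourierLaplace, fourierLaplace, ← integral_const_mul, eq_comm, ← neg_eq_iff_eq_neg.2 h3,
        ← integral_neg]
      refine integral_congr_ae (.of_forall fun k => ?_)
      beta_reduce
      ring
    have h2 : ‖ζ‖ * ‖fourierLaplace g ζ‖ = ‖fourierLaplace (deriv g) ζ‖ := by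
      rw [h1, norm_mul, norm_neg, norm_mul, Complex.norm_I, one_mul]
    calc _ = (1 + ‖ζ‖) ^ N * ‖fourierLaplace g ζ‖ +
          (1 + ‖ζ‖) ^ N * (‖ζ‖ * ‖fourierLaplace g ζ‖) := by ring
      _ ≤ C * Real.exp |ζ.im| + D * Real.exp |ζ.im| := by
          rw [h2]
          exact add_le_add (hC ζ) (hD ζ)
      _ = _ := by ring

/-- There is an entire function of exponential type, rapidly decreasing on the real line, with value
`1` at the origin. -/
theorem exists_entire_cutoff : ∃ s : ℂ → ℂ, Differentiable ℂ s ∧ s 0 = 1 ∧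
    ∀ N : ℕ, ∃ C : ℝ, 0 ≤ C ∧ ∀ ζ, ‖s ζ‖ ≤ C * ((1 + ‖ζ‖) ^ N)⁻¹ * Real.exp |ζ.im| := by
  set β : ContDiffBump (0 : ℝ) := ⟨1 / 2, 1, by norm_num, by norm_num⟩ with hβ
  set g : ℝ → ℂ := fun k => ((β.normed volume k : ℝ) : ℂ) with hg
  have hgs : ContDiff ℝ ∞ g := Complex.ofRealCLM.contDiff.comp β.contDiff_normed
  have hsupp : tsupport g ⊆ Set.Icc (-1) 1 := by
    have h1 : tsupport g ⊆ tsupport (β.normed volume) :=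
      closure_mono fun k hk h => hk (by simp [hg, h])
    rw [β.tsupport_normed_eq, Real.closedBall_eq_Icc] at h1
    simpa [hβ] using h1
  refine ⟨fourierLaplace g, fourierLaplace_differentiable hgs.continuous hsupp, ?_, fun N => ?_⟩
  · simp only [fourierLaplace, mul_zero, Complex.exp_zero, mul_one, hg]
    rw [integral_complex_ofReal, β.integral_normed, Complex.ofReal_one]
  · obtain ⟨C, hC⟩ := exists_norm_fourierLaplace_le N hgs hsupp
    refine ⟨|C|, abs_nonneg C, fun ζ => ?_⟩
    have h := hC ζ
    rw [mul_comm, ← le_div_iff₀ (by positivity)] at h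
    refine h.trans ?_
    rw [div_eq_mul_inv, mul_right_comm]
    gcongr
    exact le_abs_self C

variable {ι : Type*} [Fintype ι]

variable (ι) in
/-- A cutoff in several variables, as a product of cutoffs in one variable. -/
theorem exists_entire_cutoff_pi : ∃ χ : (ι → ℂ) → ℂ, Differentiable ℂ χ ∧ χ 0 = 1 ∧
    ∀ N : ℕ, ∃ C : ℝ, 0 ≤ C ∧ ∀ η, ‖χ η‖ ≤
      C * ((1 + ‖η‖) ^ N)⁻¹ * Real.exp (Fintype.card ι * ‖fun j => (η j).im‖) := by
  obtain ⟨s, hs, hs0, hsb⟩ := exists_entire_cutoff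
  refine ⟨fun η => ∏ j, s (η j), by fun_prop, by simp [hs0], fun N => ?_⟩
  obtain ⟨C, hC0, hC⟩ := hsb N
  refine ⟨C ^ Fintype.card ι, by positivity, fun η => ?_⟩
  have h1 : 1 + ‖η‖ ≤ ∏ j, (1 + ‖η j‖) := by
    have h2 : ∀ j, 1 ≤ 1 + ‖η j‖ := fun j => by linarith [norm_nonneg (η j)]
    have h3 : ‖η‖ ≤ ∏ j, (1 + ‖η j‖) - 1 := by
      refine (pi_norm_le_iff_of_nonneg ?_).2 fun j => ?_
      · exact sub_nonneg.2 (Finset.one_le_prod fun j _ => h2 j)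
      · have := Finset.prod_le_prod_of_subset_of_one_le (Finset.subset_univ {j})
          (fun i _ => zero_le_one.trans (h2 i)) (fun i _ _ => h2 i)
        rw [Finset.prod_singleton] at this
        linarith
    linarith
  calc ‖∏ j, s (η j)‖ ≤ ∏ j, (C * ((1 + ‖η j‖) ^ N)⁻¹ * Real.exp ‖fun j => (η j).im‖) := by
        rw [norm_prod]
        refine Finset.prod_le_prod (fun j _ => norm_nonneg _) fun j _ => (hC (η j)).trans ?_
        gcongr
        exact norm_le_pi_norm (fun j => (η j).im) j
    _ = C ^ Fintype.card ι * ((∏ j, (1 + ‖η j‖)) ^ N)⁻¹ *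
        Real.exp (Fintype.card ι * ‖fun j => (η j).im‖) := by
        rw [Finset.prod_mul_distrib, Finset.prod_mul_distrib, Finset.prod_inv_distrib,
          Finset.prod_pow, Real.exp_nat_mul]
        simp
    _ ≤ _ := by gcongr

variable [DecidableEq ι]

/-- Functions that have an entire extension with the growth bounds of `exists_norm_mderiv_le`,
relative to every real point, where the bound decreases rapidly as the point tends to infinity,
are of class `𝓦^ρ`. -/
theorem IsExt.memW {ρ : ℝ} (hρ : 1 < ρ) {F : (ι → ℂ) → ℂ} {f : (ι → ℝ) → ℂ} (hF : IsExt F f)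
    (h : ∀ (N : ℕ) (ε : ℝ), 0 < ε → ∃ C : ℝ, 0 ≤ C ∧ ∀ (x : ι → ℝ) (ζ : ι → ℂ),
      ‖F (toC x + ζ)‖ ≤ C * ((1 + ‖x‖) ^ N)⁻¹ * Real.exp (ε * ‖ζ‖ ^ ρ)) : MemW ρ f := by
  refine ⟨hF.contDiff, fun L hL N => ?_⟩
  obtain ⟨ε, K, hε, hK, hb⟩ := exists_norm_mderiv_le (ι := ι) hρ hL
  obtain ⟨C, hC0, hC⟩ := h N ε hε
  refine ⟨K * C, fun κ x => (hb F f hF x (C * ((1 + ‖x‖) ^ N)⁻¹) (by positivity) (hC x) κ).trans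
    (le_of_eq ?_)⟩
  ring

/-- Functions of polynomial growth are limits of restrictions to `ℝ^d` of class `𝓦^ρ`, uniformly
with respect to any weight `exp(ε‖ζ‖^ρ)`. -/
theorem exists_memW_approx {ρ : ℝ} (hρ : 1 < ρ) {P : (ι → ℂ) → ℂ} (hP : Differentiable ℂ P) {B : ℝ}
    {m : ℕ} (hB : ∀ ζ, ‖P ζ‖ ≤ B * (1 + ‖ζ‖) ^ m) :
    ∃ S : ℕ → (ι → ℂ) → ℂ, (∀ k, Differentiable ℂ (S k)) ∧
      (∀ k, MemW ρ fun x => S k (toC x)) ∧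
      ∀ ε : ℝ, 0 < ε → ∃ C : ℝ, 0 ≤ C ∧
        ∀ k ζ, ‖S k ζ - P ζ‖ ≤ C * (1 / ((k : ℝ) + 1)) * Real.exp (ε * ‖ζ‖ ^ ρ) := by
  obtain ⟨χ, hχ, hχ0, hχb⟩ := exists_entire_cutoff_pi ι
  set d : ℝ := ((Fintype.card ι : ℕ) : ℝ) with hd
  have hd0 : 0 ≤ d := Nat.cast_nonneg _
  have hB0 : 0 ≤ B := by simpa using (norm_nonneg _).trans (hB 0)
  set δ : ℕ → ℝ := fun k => 1 / ((k : ℝ) + 1) with hδ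
  have hδ0 : ∀ k, 0 < δ k := fun k => by simp only [hδ]; positivity
  have hδ1 : ∀ k, δ k ≤ 1 := fun k => by
    simp only [hδ]
    rw [div_le_one (by positivity)]
    have : (0 : ℝ) ≤ k := Nat.cast_nonneg k
    linarith
  have hnδ : ∀ (k : ℕ) (ζ : ι → ℂ), ‖(δ k : ℂ) • ζ‖ = δ k * ‖ζ‖ := fun k ζ => by
    rw [norm_smul, Complex.norm_real, Real.norm_of_nonneg (hδ0 k).le]
  have hSd : ∀ k, Differentiable ℂ fun ζ => P ζ * χ ((δ k : ℂ) • ζ) := fun k => by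
    have : Differentiable ℂ fun ζ => χ ((δ k : ℂ) • ζ) := hχ.comp (by fun_prop)
    fun_prop
  refine ⟨fun k ζ => P ζ * χ ((δ k : ℂ) • ζ), hSd, fun k => ?_, fun ε hε => ?_⟩
  · have hext : IsExt (fun ζ => P ζ * χ ((δ k : ℂ) • ζ))
        fun x => P (toC x) * χ ((δ k : ℂ) • toC x) := ⟨hSd k, fun x => rfl⟩
    refine hext.memW hρ fun N ε hε => ?_
    obtain ⟨D, hD0, hD⟩ := hχb (N + m)
    obtain ⟨A, hA0, hA⟩ := exists_pow_mul_exp_le hρ hε (m + (N + m)) hd0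
    refine ⟨B * D * (δ k ^ (N + m))⁻¹ * A, by have := hδ0 k; positivity, fun x ζ => ?_⟩
    have hk := hδ0 k
    have hx0 := norm_nonneg x
    have hζ0 := norm_nonneg ζ
    have hsum : ‖toC x + ζ‖ ≤ ‖x‖ + ‖ζ‖ := (norm_add_le _ _).trans (by rw [norm_toC])
    have h1 : ‖P (toC x + ζ)‖ ≤ B * ((1 + ‖x‖) ^ m * (1 + ‖ζ‖) ^ m) := by
      refine (hB _).trans ?_
      rw [← mul_pow]
      gcongr
      nlinarith
    -- The cutoff is used with the power `N + m`, since the power `m` goes into the growth of `P`.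
    have h2 : ((1 + ‖(δ k : ℂ) • (toC x + ζ)‖) ^ (N + m))⁻¹ ≤
        (δ k ^ (N + m))⁻¹ * ((1 + ‖x‖) ^ (N + m))⁻¹ * (1 + ‖ζ‖) ^ (N + m) := by
      have h3 : δ k * (1 + ‖x‖) ≤ (1 + ‖(δ k : ℂ) • (toC x + ζ)‖) * (1 + ‖ζ‖) := by
        have h4 : ‖x‖ ≤ ‖toC x + ζ‖ + ‖ζ‖ := by
          rw [← norm_toC]
          simpa using norm_sub_le (toC x + ζ) ζ
        rw [hnδ]
        have h5 := hδ1 k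
        have h6 : δ k * ‖x‖ ≤ δ k * ‖toC x + ζ‖ + ‖ζ‖ := by
          calc δ k * ‖x‖ ≤ δ k * (‖toC x + ζ‖ + ‖ζ‖) := by gcongr
            _ = δ k * ‖toC x + ζ‖ + δ k * ‖ζ‖ := by ring
            _ ≤ δ k * ‖toC x + ζ‖ + 1 * ‖ζ‖ := by gcongr
            _ = _ := by ring
        have h7 : 0 ≤ δ k * ‖toC x + ζ‖ * ‖ζ‖ := by positivity
        nlinarith
      rw [← mul_inv, ← mul_pow, inv_mul_eq_div, inv_eq_one_div, div_le_div_iff₀ (by positivity)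
        (by positivity), one_mul, ← mul_pow, mul_comm (1 + ‖ζ‖)]
      gcongr
    have him : ‖fun j => (((δ k : ℂ) • (toC x + ζ)) j).im‖ ≤ ‖ζ‖ := by
      refine (pi_norm_le_iff_of_nonneg hζ0).2 fun j => ?_
      have h8 : (((δ k : ℂ) • (toC x + ζ)) j).im = δ k * (ζ j).im := by simp
      rw [h8, norm_mul, Real.norm_of_nonneg hk.le]
      calc δ k * ‖(ζ j).im‖ ≤ 1 * ‖(ζ j).im‖ := by gcongr; exact hδ1 k
        _ ≤ ‖ζ‖ := by rw [one_mul]; exact (Complex.abs_im_le_norm _).trans (norm_le_pi_norm ζ j)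
    rw [norm_mul]
    calc _ ≤ B * ((1 + ‖x‖) ^ m * (1 + ‖ζ‖) ^ m) * (D * ((δ k ^ (N + m))⁻¹ *
          ((1 + ‖x‖) ^ (N + m))⁻¹ * (1 + ‖ζ‖) ^ (N + m)) * Real.exp (d * ‖ζ‖)) := by
          gcongr
          refine (hD _).trans ?_
          gcongr
      _ = B * D * (δ k ^ (N + m))⁻¹ * ((1 + ‖x‖) ^ N)⁻¹ *
          ((1 + ‖ζ‖) ^ (m + (N + m)) * Real.exp (d * ‖ζ‖)) := by
          rw [pow_add (1 + ‖x‖) N m, pow_add (1 + ‖ζ‖) m (N + m)]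
          field_simp
      _ ≤ B * D * (δ k ^ (N + m))⁻¹ * ((1 + ‖x‖) ^ N)⁻¹ * (A * Real.exp (ε * ‖ζ‖ ^ ρ)) := by
          exact mul_le_mul_of_nonneg_left (hA _ hζ0) (by positivity)
      _ = _ := by ring
  · obtain ⟨D, hD0, hD⟩ := hχb 0
    obtain ⟨A, hA0, hA⟩ := exists_pow_mul_exp_le hρ hε (m + 1) hd0
    refine ⟨B * D * Real.exp d * A, by positivity, fun k ζ => ?_⟩
    have hk := hδ0 k
    have hζ0 := norm_nonneg ζ
    have hχ1 : ∀ η, ‖χ η‖ ≤ D * Real.exp (d * ‖η‖) := by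
      intro η
      refine (hD η).trans ?_
      rw [pow_zero, inv_one, mul_one]
      gcongr
      exact (pi_norm_le_iff_of_nonneg (norm_nonneg η)).2 fun j =>
        (Complex.abs_im_le_norm _).trans (norm_le_pi_norm η j)
    -- The mean value inequality for `χ` gives the factor `δ k`.
    have hmv : ‖χ ((δ k : ℂ) • ζ) - χ 0‖ ≤ D * Real.exp (d * (‖ζ‖ + 1)) *
        ‖(δ k : ℂ) • ζ - 0‖ := by
      refine Convex.norm_image_sub_le_of_norm_fderiv_le (𝕜 := ℂ) (s := Metric.closedBall 0 ‖ζ‖)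
        (fun η _ => hχ η) (fun η hη => ?_) (convex_closedBall _ _) (by simp) ?_
      · have hη' : ‖η‖ ≤ ‖ζ‖ := by simpa using hη
        refine (norm_fderiv_le_of_ball hχ one_pos (fun y hy => (hχ1 y).trans ?_)).trans
          (by rw [div_one])
        have : ‖y‖ ≤ ‖ζ‖ + 1 := by
          have := norm_le_norm_add_norm_sub' y η
          linarith
        gcongr
      · rw [mem_closedBall_zero_iff, hnδ]
        exact mul_le_of_le_one_left hζ0 (hδ1 k)
    rw [hχ0, sub_zero, hnδ] at hmv
    have e1 : P ζ * χ ((δ k : ℂ) • ζ) - P ζ = P ζ * (χ ((δ k : ℂ) • ζ) - 1) := by ring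
    rw [e1, norm_mul]
    calc _ ≤ B * (1 + ‖ζ‖) ^ m * (D * Real.exp (d * (‖ζ‖ + 1)) * (δ k * (1 + ‖ζ‖))) := by
          gcongr
          · exact hB ζ
          · refine hmv.trans ?_
            gcongr
            linarith
      _ = B * D * Real.exp d * δ k * ((1 + ‖ζ‖) ^ (m + 1) * Real.exp (d * ‖ζ‖)) := by
          rw [mul_add, mul_one, Real.exp_add]; ring
      _ ≤ B * D * Real.exp d * δ k * (A * Real.exp (ε * ‖ζ‖ ^ ρ)) := by
          exact mul_le_mul_of_nonneg_left (hA _ hζ0) (by positivity)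
      _ = _ := by ring

end Cutoff

/-! ### The topology of `𝓔^ρ` and the density of `𝓦^ρ` -/

section Density

variable {ι : Type*} [Fintype ι] [DecidableEq ι] {ρ : ℝ}

variable (ι ρ) in
theorem ESpace.withSeminorms : WithSeminorms (ESpace.norm (ι := ι) ρ) := ⟨rfl⟩

instance : IsTopologicalAddGroup (ESpace ι ρ) := (ESpace.withSeminorms ι ρ).topologicalAddGroup

/-- The inclusion of `𝓔^ρ` into the space of all functions, as a linear map. -/
def ESpace.fnL : ESpace ι ρ →ₗ[ℂ] ((ι → ℝ) → ℂ) := (ESubmodule ι ρ).subtype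

omit [DecidableEq ι] in
theorem mfact_rpow_pos (κ : ι → ℕ) (a : ℝ) : (0 : ℝ) < (mfact κ : ℝ) ^ a := by
  apply Real.rpow_pos_of_pos
  exact_mod_cast Finset.prod_pos fun j _ => Nat.factorial_pos (κ j)

theorem ESpace.norm_mderiv_le (L : {L : ℝ // 0 < L}) (f : ESpace ι ρ) (κ : ι → ℕ) (x : ι → ℝ) :
    ‖mderiv κ f.fn x‖ ≤ ESpace.norm ρ L f * (L.1 ^ mabs κ)⁻¹ * (mfact κ : ℝ) ^ (1 - 1 / ρ) *
      Real.exp ((‖x‖ / L.1) ^ ρ) := by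
  have h : wt ρ L.1 f.fn (κ, x) ≤ ESpace.norm ρ L f := le_ciSup (wt_bdd L.2 f.memE) (κ, x)
  have h1 := mfact_rpow_pos κ (1 - 1 / ρ)
  have h2 := pow_pos L.2 (mabs κ)
  have h3 := Real.exp_pos ((‖x‖ / L.1) ^ ρ)
  rw [wt, Real.exp_neg] at h
  calc ‖mderiv κ f.fn x‖ = (L.1 ^ mabs κ * ‖mderiv κ f.fn x‖ / (mfact κ : ℝ) ^ (1 - 1 / ρ) *
        (Real.exp ((‖x‖ / L.1) ^ ρ))⁻¹) * (L.1 ^ mabs κ)⁻¹ * (mfact κ : ℝ) ^ (1 - 1 / ρ) *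
        Real.exp ((‖x‖ / L.1) ^ ρ) := by field_simp
    _ ≤ _ := by gcongr

theorem ESpace.norm_le {L : {L : ℝ // 0 < L}} {f : ESpace ι ρ} {C : ℝ}
    (h : ∀ (κ : ι → ℕ) (x : ι → ℝ), ‖mderiv κ f.fn x‖ ≤ C * (L.1 ^ mabs κ)⁻¹ *
      (mfact κ : ℝ) ^ (1 - 1 / ρ) * Real.exp ((‖x‖ / L.1) ^ ρ)) : ESpace.norm ρ L f ≤ C := by
  refine ciSup_le fun ⟨κ, x⟩ => ?_
  have h1 := mfact_rpow_pos κ (1 - 1 / ρ)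
  have h2 := pow_pos L.2 (mabs κ)
  have h3 := Real.exp_pos ((‖x‖ / L.1) ^ ρ)
  rw [wt, Real.exp_neg]
  calc _ ≤ L.1 ^ mabs κ * (C * (L.1 ^ mabs κ)⁻¹ *
        (mfact κ : ℝ) ^ (1 - 1 / ρ) * Real.exp ((‖x‖ / L.1) ^ ρ)) / (mfact κ : ℝ) ^ (1 - 1 / ρ) *
        (Real.exp ((‖x‖ / L.1) ^ ρ))⁻¹ := by gcongr; exact h κ x
    _ = C := by field_simp

/-- Convergence of entire extensions, uniformly with respect to all weights `exp(ε‖ζ‖^ρ)`, implies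
convergence in `𝓔^ρ`. -/
theorem ESpace.tendsto_of_growth (hρ : 1 < ρ) {u : ℕ → ESpace ι ρ} {f : ESpace ι ρ}
    {U : ℕ → (ι → ℂ) → ℂ} {F : (ι → ℂ) → ℂ} (hU : ∀ k, IsExt (U k) (u k).fn) (hF : IsExt F f.fn)
    {s : ℕ → ℝ} (hs0 : ∀ k, 0 ≤ s k) (hs : Filter.Tendsto s Filter.atTop (nhds 0))
    (h : ∀ ε : ℝ, 0 < ε → ∃ C : ℝ, 0 ≤ C ∧
      ∀ k ζ, ‖U k ζ - F ζ‖ ≤ C * s k * Real.exp (ε * ‖ζ‖ ^ ρ)) :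
    Filter.Tendsto u Filter.atTop (nhds f) := by
  refine ((ESpace.withSeminorms ι ρ).tendsto_nhds u f).2 fun L δ hδ => ?_
  obtain ⟨ε, K, hε, hK, hb⟩ := exists_norm_mderiv_le_of_growth (ι := ι) hρ L.2
  obtain ⟨C, hC0, hC⟩ := h ε hε
  have hlim : Filter.Tendsto (fun k => K * (C * s k)) Filter.atTop (nhds 0) := by
    simpa using (hs.const_mul C).const_mul K
  filter_upwards [hlim.eventually_lt_const hδ] with k hk
  refine lt_of_le_of_lt (ESpace.norm_le (hb (U k - F) _ ?_ (C * s k)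
    (mul_nonneg hC0 (hs0 k)) (hC k))) hk
  have h1 : (u k - f).fn = (u k).fn - f.fn := rfl
  exact ⟨(hU k).1.sub hF.1, fun x => by rw [h1, Pi.sub_apply, Pi.sub_apply, (hU k).2, hF.2]⟩

/-- A continuous functional on `𝓔^ρ` that vanishes on `𝓦^ρ` vanishes on functions of polynomial
growth. -/
theorem eq_zero_of_polynomial_growth (hρ : 1 < ρ) (l : ESpace ι ρ →L[ℂ] ℂ)
    (hl : ∀ f : ESpace ι ρ, MemW ρ f.fn → l f = 0) {P : (ι → ℂ) → ℂ} {p : ESpace ι ρ}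
    (hP : IsExt P p.fn) {B : ℝ} {m : ℕ} (hB : ∀ ζ, ‖P ζ‖ ≤ B * (1 + ‖ζ‖) ^ m) : l p = 0 := by
  obtain ⟨S, hSd, hSW, hS⟩ := exists_memW_approx hρ hP.1 hB
  set u : ℕ → ESpace ι ρ := fun k => ⟨fun x => S k (toC x), (hSW k).memE⟩ with hu
  have hlim : Filter.Tendsto u Filter.atTop (nhds p) :=
    ESpace.tendsto_of_growth hρ (fun k => ⟨hSd k, fun x => rfl⟩) hP (fun k => by positivity)
      tendsto_one_div_add_atTop_nhds_zero_nat hS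
  have h1 := (l.continuous.tendsto p).comp hlim
  have h2 : ∀ k, l (u k) = 0 := fun k => hl _ (hSW k)
  exact tendsto_nhds_unique h1 (by simp [Function.comp_def, h2])

theorem norm_taylorPoly_le_pow (f : (ι → ℝ) → ℂ) (m : ℕ) (ζ : ι → ℂ) :
    ‖taylorPoly f m ζ‖ ≤ ((m.factorial : ℝ)⁻¹ *
      ∑ J : Fin m → ι, ‖(List.ofFn J).foldr pderiv f 0‖) * (1 + ‖ζ‖) ^ m := by
  rw [taylorPoly, norm_mul, norm_inv, Complex.norm_natCast, mul_assoc, Finset.sum_mul]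
  gcongr
  refine norm_sum_le_of_le _ fun J _ => ?_
  rw [norm_mul, mul_comm]
  gcongr
  rw [norm_prod]
  refine (Finset.prod_le_prod (fun _ _ => norm_nonneg _)
    (fun k _ => (norm_le_pi_norm ζ (J k)).trans (le_add_of_nonneg_left zero_le_one))).trans ?_
  simp

/-- `𝓦^ρ` is dense in `𝓔^ρ`, in the form needed for the uniqueness of extensions: Taylor polynomials
approximate elements of `𝓔^ρ`, and are themselves approximated by elements of `𝓦^ρ`. -/
theorem eq_zero_of_eq_zero_on_memW (hρ : 1 < ρ) (l : ESpace ι ρ →L[ℂ] ℂ)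
    (hl : ∀ f : ESpace ι ρ, MemW ρ f.fn → l f = 0) (f : ESpace ι ρ) : l f = 0 := by
  have hT : ∀ m, IsExt (taylorPoly f.fn m) fun x => taylorPoly f.fn m (toC x) := fun m =>
    ⟨taylorPoly_differentiable _ m, fun x => rfl⟩
  have hTE : ∀ m, MemE ρ fun x => taylorPoly f.fn m (toC x) := by
    intro m
    refine (hT m).memE hρ fun ε hε => ?_
    obtain ⟨A, hA0, hA⟩ := exists_pow_mul_exp_le hρ hε m le_rfl
    set B := (m.factorial : ℝ)⁻¹ * ∑ J : Fin m → ι, ‖(List.ofFn J).foldr pderiv f.fn 0‖ with hB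
    have hB0 : 0 ≤ B := by positivity
    refine ⟨B * A, by positivity, fun ζ => (norm_taylorPoly_le_pow _ m ζ).trans ?_⟩
    have h := hA ‖ζ‖ (norm_nonneg ζ)
    rw [zero_mul, Real.exp_zero, mul_one] at h
    exact (mul_le_mul_of_nonneg_left h hB0).trans (le_of_eq (mul_assoc _ _ _).symm)
  set t : ℕ → ESpace ι ρ := fun m => ⟨fun x => taylorPoly f.fn m (toC x), hTE m⟩ with ht
  have ht0 : ∀ m, l (t m) = 0 := fun m =>
    eq_zero_of_polynomial_growth hρ l hl (hT m) (norm_taylorPoly_le_pow _ m)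
  obtain ⟨C, hC0, hC⟩ := f.memE.exists_nonneg_bound one_pos
  have hF := isExt_tsum_taylorPoly hρ one_pos hC0 f.memE.1 hC
  have hlim : Filter.Tendsto (fun k => ∑ m ∈ Finset.range k, t m) Filter.atTop (nhds f) := by
    refine ESpace.tendsto_of_growth hρ (U := fun k ζ => ∑ m ∈ Finset.range k, taylorPoly f.fn m ζ)
      (fun k => ⟨?_, fun x => ?_⟩) hF (s := fun k => (1 / 2 : ℝ) ^ k) (fun k => by positivity)
      (tendsto_pow_atTop_nhds_zero_of_lt_one (by norm_num) (by norm_num)) fun ε hε => ?_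
    · have := taylorPoly_differentiable f.fn
      fun_prop
    · have h : (∑ m ∈ Finset.range k, t m).fn = ∑ m ∈ Finset.range k, (t m).fn :=
        map_sum ESpace.fnL _ _
      rw [h, Finset.sum_apply]
      rfl
    · obtain ⟨L, hL, hLε⟩ := exists_rpow_div_le ι (by linarith : 0 < ρ) hε
      obtain ⟨D, hD0, hD⟩ := f.memE.exists_nonneg_bound hL
      refine ⟨2 * D, by positivity, fun k ζ => ?_⟩
      have hb : ∀ m, ‖taylorPoly f.fn m ζ‖ ≤ (1 / 2) ^ m * (D * Real.exp (ε * ‖ζ‖ ^ ρ)) := by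
        intro m
        refine (norm_taylorPoly_le hρ hL hD0 f.memE.1 hD m ζ).trans ?_
        have : 2 * (Fintype.card ι * ‖ζ‖ / L) = 2 * Fintype.card ι / L * ‖ζ‖ := by ring
        rw [this, Real.mul_rpow (by positivity) (norm_nonneg _)]
        gcongr
      have hgeo := summable_geometric_of_lt_one (r := (1 / 2 : ℝ)) (by norm_num) (by norm_num)
      have hsum : Summable fun m => taylorPoly f.fn m ζ :=
        Summable.of_norm_bounded (hgeo.mul_right _) hb
      have hgeo' : HasSum (fun m : ℕ => (1 / 2 : ℝ) ^ (m + k) * (D * Real.exp (ε * ‖ζ‖ ^ ρ)))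
          (2 * (1 / 2) ^ k * (D * Real.exp (ε * ‖ζ‖ ^ ρ))) := by
        refine HasSum.mul_right _ ?_
        simp only [pow_add]
        refine HasSum.mul_right _ ?_
        exact hasSum_geometric_two
      rw [← hsum.sum_add_tsum_nat_add k, sub_add_cancel_left, norm_neg]
      refine (tsum_of_norm_bounded hgeo' fun m => hb (m + k)).trans (le_of_eq ?_)
      ring
  have h1 := (l.continuous.tendsto f).comp hlim
  exact tendsto_nhds_unique h1 (by simp [Function.comp_def, map_sum, ht0])

end Density

/-! ### The topology of `Ē^{2,A}_ρ` -/

section Inductive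

variable {n : ℕ} {ρ A : ℝ}

variable (n ρ A) in
theorem Ebar.withSeminorms : WithSeminorms
    (fun p : {p : Seminorm ℂ (Ebar n ρ A) // StepContinuous p} => p.1) := ⟨rfl⟩

theorem Ebar.ext {φ ψ : Ebar n ρ A} (h : ∀ z, φ.fn z = ψ.fn z) : φ = ψ := Subtype.ext (funext h)

theorem EbarBound.nonneg {r C : ℝ} {Φ : (Fin n → ℂ) → ℂ} (h : EbarBound ρ A r C Φ) : 0 ≤ C :=
  nonneg_of_mul_nonneg_left ((norm_nonneg _).trans (h 0)) (Real.exp_pos _)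

/-- The evaluation functionals on `Ē^{2,A}_ρ`. -/
def Ebar.evalₗ (z : Fin n → ℂ) : Ebar n ρ A →ₗ[ℂ] ℂ :=
  (LinearMap.proj z).comp (EbarSubmodule n ρ A).subtype

theorem Ebar.continuous_eval (z : Fin n → ℂ) : Continuous fun φ : Ebar n ρ A => φ.fn z := by
  set p : Seminorm ℂ (Ebar n ρ A) := (normSeminorm ℂ ℂ).comp (Ebar.evalₗ z) with hp
  have hstep : StepContinuous p := fun r _ =>
    ⟨Real.exp (A * hnorm z ^ 2 - r * hnorm z ^ ρ), fun φ C h => (h z).trans_eq (mul_comm _ _)⟩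
  have hcont : Continuous p := (Ebar.withSeminorms n ρ A).continuous_seminorm ⟨p, hstep⟩
  refine continuous_of_continuousAt_zero (Ebar.evalₗ (ρ := ρ) (A := A) z) ?_
  rw [ContinuousAt, map_zero, tendsto_zero_iff_norm_tendsto_zero]
  have h := hcont.tendsto 0
  rw [map_zero] at h
  exact h

theorem StepContinuous.finset_sup
    (s : Finset {p : Seminorm ℂ (Ebar n ρ A) // StepContinuous p}) :
    StepContinuous (s.sup fun p => p.1) := by
  refine Finset.sup_induction (p := StepContinuous) (fun r _ => ⟨0, fun φ C _ => by simp⟩)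
    (fun p hp q hq r hr => ?_) fun p _ => p.2
  obtain ⟨K, hK⟩ := hp r hr
  obtain ⟨M, hM⟩ := hq r hr
  refine ⟨max K M, fun φ C h => ?_⟩
  have hC := h.nonneg
  rw [Seminorm.sup_apply]
  refine sup_le ((hK φ C h).trans ?_) ((hM φ C h).trans ?_)
  · exact mul_le_mul_of_nonneg_right (le_max_left _ _) hC
  · exact mul_le_mul_of_nonneg_right (le_max_right _ _) hC

/-- A linear map that takes each Banach space of the family continuously into another one is
continuous for the inductive limit topology. -/
theorem Ebar.continuous_of_bound (T : Ebar n ρ A →ₗ[ℂ] Ebar n ρ A)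
    (h : ∀ r : ℝ, 0 < r → ∃ r' K : ℝ, 0 < r' ∧ ∀ (φ : Ebar n ρ A) (C : ℝ),
      EbarBound ρ A r C φ.fn → EbarBound ρ A r' (K * C) (T φ).fn) : Continuous T := by
  refine (Ebar.withSeminorms n ρ A).continuous_of_isBounded (Ebar.withSeminorms n ρ A) T
    fun q => ?_
  have hstep : StepContinuous (q.1.comp T) := by
    intro r hr
    obtain ⟨r', K, hr', hK⟩ := h r hr
    obtain ⟨M, hM⟩ := q.2 r' hr'
    exact ⟨M * K, fun φ C hφ => (hM _ _ (hK φ C hφ)).trans_eq (by ring)⟩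
  exact ⟨{⟨_, hstep⟩}, 1, by simp⟩

/-- Bounded subsets of `Ē^{2,A}_ρ` are bounded in one of the Banach spaces of the family. Otherwise
there are `φ_k` in the set and points `z_k` that violate the bounds with `r = 1/(k+1)` and
`C = k + 1`, and the weighted supremum over the points `z_k` is a continuous seminorm that is
unbounded on the set. -/
theorem Ebar.exists_bound_of_isVonNBounded {s : Set (Ebar n ρ A)}
    (hs : Bornology.IsVonNBounded ℂ s) :
    ∃ r C : ℝ, 0 < r ∧ 0 ≤ C ∧ ∀ φ ∈ s, EbarBound ρ A r C φ.fn := by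
  by_contra! hcon
  have h1 : ∀ k : ℕ, ∃ φ ∈ s, ∃ z, ((k : ℝ) + 1) *
      Real.exp (A * hnorm z ^ 2 - 1 / ((k : ℝ) + 1) * hnorm z ^ ρ) < ‖φ.fn z‖ := by
    intro k
    obtain ⟨φ, hφ, h⟩ := hcon (1 / ((k : ℝ) + 1)) ((k : ℝ) + 1) (by positivity) (by positivity)
    simp only [EbarBound, not_forall, not_le] at h
    exact ⟨φ, hφ, h⟩
  choose φ hφ z hz using h1
  set q : ℕ → Seminorm ℂ (Ebar n ρ A) := fun k =>
    Real.toNNReal (Real.exp (-(A * hnorm (z k) ^ 2 - 1 / ((k : ℝ) + 1) * hnorm (z k) ^ ρ))) •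
      (normSeminorm ℂ ℂ).comp (Ebar.evalₗ (z k)) with hq
  have hqa : ∀ k ψ, q k ψ = Real.exp (-(A * hnorm (z k) ^ 2 -
      1 / ((k : ℝ) + 1) * hnorm (z k) ^ ρ)) * ‖ψ.fn (z k)‖ := fun k ψ => by
    simp only [hq, smul_apply, NNReal.smul_def, Real.coe_toNNReal _ (Real.exp_pos _).le]
    rfl
  have hqb : ∀ r : ℝ, 0 < r → ∃ K : ℝ, ∀ (ψ : Ebar n ρ A) (C : ℝ),
      EbarBound ρ A r C ψ.fn → ∀ k, q k ψ ≤ K * C := by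
    intro r hr
    obtain ⟨k₀, hk₀⟩ := exists_nat_one_div_lt hr
    set e : ℕ → ℝ := fun k => Real.exp ((1 / ((k : ℝ) + 1) - r) * hnorm (z k) ^ ρ) with he
    have he0 : ∀ k, 0 < e k := fun k => Real.exp_pos _
    have hz0 : ∀ k, 0 ≤ hnorm (z k) ^ ρ := fun k => Real.rpow_nonneg (hnorm_nonneg _) _
    refine ⟨1 + ∑ k ∈ Finset.range k₀, e k, fun ψ C hψ k => ?_⟩
    have hC := hψ.nonneg
    -- Only finitely many points `z_k` have a weight `1/(k+1)` larger than `r`.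
    have hek : e k ≤ 1 + ∑ k ∈ Finset.range k₀, e k := by
      rcases lt_or_ge k k₀ with hk | hk
      · have := Finset.single_le_sum (f := e) (fun i _ => (he0 i).le) (Finset.mem_range.2 hk)
        linarith
      · have h2 : 1 / ((k : ℝ) + 1) ≤ 1 / ((k₀ : ℝ) + 1) := by gcongr
        have h3 : e k ≤ 1 := by
          rw [he, Real.exp_le_one_iff]
          exact mul_nonpos_of_nonpos_of_nonneg (by linarith) (hz0 k)
        have h4 : 0 ≤ ∑ k ∈ Finset.range k₀, e k := Finset.sum_nonneg fun i _ => (he0 i).le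
        linarith
    rw [hqa]
    calc _ ≤ Real.exp (-(A * hnorm (z k) ^ 2 - 1 / ((k : ℝ) + 1) * hnorm (z k) ^ ρ)) *
          (C * Real.exp (A * hnorm (z k) ^ 2 - r * hnorm (z k) ^ ρ)) := by
          gcongr
          exact hψ (z k)
      _ = C * (Real.exp (-(A * hnorm (z k) ^ 2 - 1 / ((k : ℝ) + 1) * hnorm (z k) ^ ρ)) *
          Real.exp (A * hnorm (z k) ^ 2 - r * hnorm (z k) ^ ρ)) := by ring
      _ = e k * C := by
          rw [← Real.exp_add, mul_comm]
          simp only [he]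
          ring_nf
      _ ≤ _ := by gcongr
  have hbdd : BddAbove (Set.range q) := by
    refine Seminorm.bddAbove_range_iff.2 fun ψ => ?_
    obtain ⟨-, C, r, hr, hC⟩ := ψ.2
    obtain ⟨K, hK⟩ := hqb r hr
    exact ⟨K * C, Set.forall_mem_range.2 (hK ψ C hC)⟩
  have hstep : StepContinuous (⨆ k, q k) := by
    intro r hr
    obtain ⟨K, hK⟩ := hqb r hr
    refine ⟨K, fun ψ C h => ?_⟩
    rw [Seminorm.iSup_apply hbdd]
    exact ciSup_le (hK ψ C h)
  obtain ⟨R, -, hR⟩ := (Ebar.withSeminorms n ρ A).isVonNBounded_iff_seminorm_bounded.1 hs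
    ⟨_, hstep⟩
  obtain ⟨k, hk⟩ := exists_nat_gt R
  have h2 : q k (φ k) ≤ (⨆ k, q k) (φ k) := Seminorm.le_def.1 (le_ciSup hbdd k) _
  have h3 : (k : ℝ) + 1 < q k (φ k) := by
    rw [hqa, Real.exp_neg, ← div_eq_inv_mul, lt_div_iff₀ (Real.exp_pos _)]
    exact hz k
  have h4 := hR _ (hφ k)
  linarith

/-- `Ē^{2,A}_ρ` with `A = 1/(2ℏ)` is contained in the Fock–Bargmann space. -/
theorem MemEbar.memFock {ℏ : ℝ} (hℏ : 0 < ℏ) (hρ : 1 < ρ) {Φ : (Fin n → ℂ) → ℂ}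
    (h : MemEbar ρ (1 / (2 * ℏ)) Φ) : MemFock ℏ Φ := by
  obtain ⟨ha, C, r, hr, hC⟩ := h
  have hΦ : Continuous Φ := by
    have := ha.continuous.comp (continuous_star (R := Fin n → ℂ))
    simpa [Function.comp_def] using this
  have hh := continuous_hnorm (n := n)
  refine ⟨ha, ?_⟩
  obtain ⟨D, hD0, hD⟩ := exists_pow_mul_exp_le hρ (by positivity : 0 < 2 * r) (2 * n + 1) le_rfl
  have hi := integrable_one_add_norm (E := Fin n → ℂ) (μ := volume) (r := ((2 * n + 1 : ℕ) : ℝ)) (by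
    simp [Module.finrank_pi_fintype, mul_comm])
  refine (integrable_muC_of_volume (hi.const_mul (C ^ 2 * D))).mono'
    (Continuous.aestronglyMeasurable (by fun_prop)) (.of_forall fun z => ?_)
  rw [Real.norm_of_nonneg (by positivity), Real.rpow_neg (by positivity), Real.rpow_natCast]
  have h1 := hD _ (hnorm_nonneg z)
  rw [zero_mul, Real.exp_zero, mul_one] at h1
  have h2 : Real.exp (-(2 * r * hnorm z ^ ρ)) ≤ D * ((1 + ‖z‖) ^ (2 * n + 1))⁻¹ := by
    rw [Real.exp_neg, ← div_eq_mul_inv, le_div_iff₀ (by positivity), inv_mul_le_iff₀ (Real.exp_pos _),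
      mul_comm _ D]
    refine le_trans ?_ h1
    have := norm_le_hnorm z
    gcongr
  calc _ ≤ (C * Real.exp (1 / (2 * ℏ) * hnorm z ^ 2 - r * hnorm z ^ ρ)) ^ 2 *
        Real.exp (-(1 / ℏ) * hnorm z ^ 2) := by
        gcongr
        exact hC z
    _ = C ^ 2 * Real.exp (-(2 * r * hnorm z ^ ρ)) := by
        rw [mul_pow, ← Real.exp_nat_mul, mul_assoc, ← Real.exp_add]
        congr 2
        push_cast
        field_simp
        ring
    _ ≤ C ^ 2 * (D * ((1 + ‖z‖) ^ (2 * n + 1))⁻¹) := by gcongr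
    _ = _ := by ring

end Inductive

/-! ### The extended Wick correspondence -/

section Extended

variable {n : ℕ} {ℏ ς ρ : ℝ}

/-- The entire extension of an element of `𝓔^ρ`. -/
noncomputable def ESpace.entire {ι : Type*} [Fintype ι] [DecidableEq ι] (hρ : 1 < ρ)
    (f : ESpace ι ρ) : (ι → ℂ) → ℂ := (f.memE.exists_isExt hρ).choose

theorem ESpace.isExt_entire {ι : Type*} [Fintype ι] [DecidableEq ι] (hρ : 1 < ρ)
    (f : ESpace ι ρ) : IsExt (f.entire hρ) f.fn := (f.memE.exists_isExt hρ).choose_spec.1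

theorem ESpace.minType_entire {ι : Type*} [Fintype ι] [DecidableEq ι] (hρ : 1 < ρ)
    (f : ESpace ι ρ) : MinType ρ (f.entire hρ) := (f.memE.exists_isExt hρ).choose_spec.2

/-- The entire function `b ↦ φ(b)`, `b = z̄`, that underlies an antiholomorphic function. -/
def Ebar.hol {A : ℝ} (φ : Ebar n ρ A) (b : Fin n → ℂ) : ℂ := φ.fn (star b)

theorem Ebar.hol_star {A : ℝ} (φ : Ebar n ρ A) : (fun u => φ.hol (star u)) = φ.fn := by
  funext u; rw [Ebar.hol, star_star]

theorem Ebar.differentiable_hol {A : ℝ} (φ : Ebar n ρ A) : Differentiable ℂ φ.hol := φ.2.1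

theorem Ebar.continuous_fn {A : ℝ} (φ : Ebar n ρ A) : Continuous φ.fn := by
  rw [← φ.hol_star]
  exact φ.differentiable_hol.continuous.comp continuous_star

theorem Ebar.exists_fockBound (φ : Ebar n ρ (1 / (2 * ℏ))) :
    ∃ D, FockBound ℏ D φ.fn := by
  obtain ⟨-, C, r, hr, hC⟩ := φ.2
  have hC0 : 0 ≤ C := EbarBound.nonneg hC
  refine ⟨C, fun u => (hC u).trans ?_⟩
  gcongr
  have : 0 ≤ r * hnorm u ^ ρ := mul_nonneg hr.le (Real.rpow_nonneg (hnorm_nonneg u) ρ)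
  rw [one_div_mul_eq_div]
  linarith

theorem FockBound.hol {A D : ℝ} {φ : Ebar n ρ A} (h : FockBound ℏ D φ.fn) :
    FockBound ℏ D φ.hol := fun u => by
  have := h (star u)
  rwa [hnorm_star] at this

theorem wop_memEbar (hℏ : 0 < ℏ) (hρ : 0 < ρ) (hρ' : ρ ≤ 2) (ς : ℝ) {F : (PQ n → ℂ) → ℂ}
    (hFd : Differentiable ℂ F) (hF : MinType ρ F) (φ : Ebar n ρ (1 / (2 * ℏ))) :
    MemEbar ρ (1 / (2 * ℏ)) fun z => wop ℏ ς F φ.fn (star z) := by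
  obtain ⟨D, hD⟩ := φ.exists_fockBound
  refine ⟨?_, ?_⟩
  · simp only [Antiholomorphic, star_star]
    exact wop_differentiable hℏ hρ.le hρ' hFd hF φ.continuous_fn hD
  · obtain ⟨-, C, r, hr, hC⟩ := φ.2
    obtain ⟨ε, r', K, hε, hr', -, h⟩ := exists_wop_bound (n := n) hℏ hρ hρ' ς hr
    obtain ⟨M, hM0, hM⟩ := hF ε hε
    exact ⟨_, r', hr', h F M hM0 hM _ C (EbarBound.nonneg hC) hC⟩

/-- The operator on `Ē^{2,A}_ρ` with a given Wick symbol of minimal type, as a linear map. -/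
noncomputable def wopₗ (hℏ : 0 < ℏ) (hρ : 0 < ρ) (hρ' : ρ ≤ 2) (ς : ℝ) {F : (PQ n → ℂ) → ℂ}
    (hFd : Differentiable ℂ F) (hF : MinType ρ F) :
    Ebar n ρ (1 / (2 * ℏ)) →ₗ[ℂ] Ebar n ρ (1 / (2 * ℏ)) where
  toFun φ := ⟨fun z => wop ℏ ς F φ.fn (star z), wop_memEbar hℏ hρ hρ' ς hFd hF φ⟩
  map_add' φ ψ := Ebar.ext fun z => by
    obtain ⟨D, hD⟩ := φ.exists_fockBound
    obtain ⟨D', hD'⟩ := ψ.exists_fockBound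
    have h := integral_add
      (wop_integrable (ς := ς) hℏ hρ.le hρ' hFd.continuous hF φ.continuous_fn hD (star z))
      (wop_integrable (ς := ς) hℏ hρ.le hρ' hFd.continuous hF ψ.continuous_fn hD' (star z))
    refine Eq.trans ?_ h
    refine integral_congr_ae (.of_forall fun u => ?_)
    have e : (φ + ψ).fn u = φ.fn u + ψ.fn u := rfl
    beta_reduce
    rw [e]
    ring
  map_smul' c φ := Ebar.ext fun z => by
    refine Eq.trans ?_ (integral_const_mul c fun u => F (zPart ς u + zbarPart ς (star z)) *
      Complex.exp (star z ⬝ᵥ u / ℏ) * φ.fn u * gw ℏ u)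
    refine integral_congr_ae (.of_forall fun u => ?_)
    have e : (c • φ).fn u = c * φ.fn u := rfl
    beta_reduce
    rw [e]
    ring

/-- The continuous operator on `Ē^{2,A}_ρ` with a given Wick symbol of minimal type. -/
noncomputable def wopCLM (hℏ : 0 < ℏ) (hρ : 0 < ρ) (hρ' : ρ ≤ 2) (ς : ℝ) {F : (PQ n → ℂ) → ℂ}
    (hFd : Differentiable ℂ F) (hF : MinType ρ F) : OpAlg n ρ (1 / (2 * ℏ)) where
  toLinearMap := wopₗ hℏ hρ hρ' ς hFd hF
  cont := Ebar.continuous_of_bound (wopₗ hℏ hρ hρ' ς hFd hF) fun r hr => by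
    obtain ⟨ε, r', K, hε, hr', -, h⟩ := exists_wop_bound (n := n) hℏ hρ hρ' ς hr
    obtain ⟨M, hM0, hM⟩ := hF ε hε
    exact ⟨r', K * M, hr', fun φ C hφ => h F M hM0 hM _ C hφ.nonneg hφ⟩

theorem wopCLM_fn (hℏ : 0 < ℏ) (hρ : 0 < ρ) (hρ' : ρ ≤ 2) (ς : ℝ) {F : (PQ n → ℂ) → ℂ}
    (hFd : Differentiable ℂ F) (hF : MinType ρ F) (φ : Ebar n ρ (1 / (2 * ℏ))) :
    (wopCLM hℏ hρ hρ' ς hFd hF φ).fn = fun z => wop ℏ ς F φ.fn (star z) := rfl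

/-- The extension of the Wick correspondence to `𝓔^ρ`, as a linear map. -/
noncomputable def wickExtₗ (hℏ : 0 < ℏ) (hρ : 1 < ρ) (hρ' : ρ ≤ 2) (ς : ℝ) :
    ESpace (PQ n) ρ →ₗ[ℂ] OpAlg n ρ (1 / (2 * ℏ)) where
  toFun f := wopCLM hℏ (zero_lt_one.trans hρ) hρ' ς (f.isExt_entire hρ).1 (f.minType_entire hρ)
  map_add' f g := ContinuousLinearMap.ext fun φ => Ebar.ext fun z => by
    have hρ0 : 0 ≤ ρ := by linarith
    obtain ⟨D, hD⟩ := φ.exists_fockBound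
    have h := integral_add
      (wop_integrable (ς := ς) hℏ hρ0 hρ' (f.isExt_entire hρ).1.continuous (f.minType_entire hρ)
        φ.continuous_fn hD (star z))
      (wop_integrable (ς := ς) hℏ hρ0 hρ' (g.isExt_entire hρ).1.continuous (g.minType_entire hρ)
        φ.continuous_fn hD (star z))
    refine Eq.trans ?_ h
    have e : (f + g).entire hρ = f.entire hρ + g.entire hρ :=
      ((f + g).isExt_entire hρ).unique ((f.isExt_entire hρ).add (g.isExt_entire hρ))
    rw [wopCLM_fn, e]
    refine integral_congr_ae (.of_forall fun u => ?_)
    simp only [Pi.add_apply]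
    ring
  map_smul' c f := ContinuousLinearMap.ext fun φ => Ebar.ext fun z => by
    refine Eq.trans ?_ (integral_const_mul c fun u =>
      f.entire hρ (zPart ς u + zbarPart ς (star z)) *
      Complex.exp (star z ⬝ᵥ u / ℏ) * φ.fn u * gw ℏ u)
    have e : (c • f).entire hρ = c • f.entire hρ :=
      ((c • f).isExt_entire hρ).unique ((f.isExt_entire hρ).smul c)
    rw [wopCLM_fn, e]
    refine integral_congr_ae (.of_forall fun u => ?_)
    simp only [Pi.smul_apply, smul_eq_mul]
    ring

theorem wickExtₗ_fn (hℏ : 0 < ℏ) (hρ : 1 < ρ) (hρ' : ρ ≤ 2) (ς : ℝ) (f : ESpace (PQ n) ρ)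
    (φ : Ebar n ρ (1 / (2 * ℏ))) : (wickExtₗ hℏ hρ hρ' ς f φ).fn =
      fun z => wop ℏ ς (f.entire hρ) φ.fn (star z) := rfl

/-- Continuity of the extended correspondence: a bounded set lies in one of the Banach spaces of the
family, where the operators are bounded in terms of a single norm of the symbol. -/
theorem continuous_wickExtₗ (hℏ : 0 < ℏ) (hρ : 1 < ρ) (hρ' : ρ ≤ 2) (ς : ℝ) :
    Continuous (wickExtₗ (n := n) hℏ hρ hρ' ς) := by
  have hρ0 : 0 < ρ := by linarith
  refine continuous_of_continuousAt_zero (wickExtₗ (n := n) hℏ hρ hρ' ς) ?_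
  rw [ContinuousAt, map_zero]
  refine (ContinuousLinearMap.hasBasis_nhds_zero_of_basis
    (Ebar.withSeminorms n ρ (1 / (2 * ℏ))).hasBasis_zero_ball).tendsto_right_iff.2 ?_
  rintro ⟨s, I, δ⟩ ⟨hs, hδ⟩
  obtain ⟨r, C, hr, hC0, hC⟩ := Ebar.exists_bound_of_isVonNBounded hs
  obtain ⟨ε, r', K, hε, hr', hK, hb⟩ := exists_wop_bound (n := n) hℏ hρ0 hρ' ς hr
  obtain ⟨M, hM⟩ := StepContinuous.finset_sup I r' hr'
  obtain ⟨L, hL, hLε⟩ := exists_rpow_div_le (PQ n) hρ0 hε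
  have hcont := (ESpace.withSeminorms (PQ n) ρ).continuous_seminorm ⟨L, hL⟩
  have hlim : Filter.Tendsto (fun f : ESpace (PQ n) ρ =>
      M * (K * (2 * ESpace.norm ρ ⟨L, hL⟩ f) * C)) (nhds 0) (nhds 0) := by
    have h := (((hcont.tendsto 0).const_mul 2).const_mul K).mul_const C |>.const_mul M
    simpa using h
  filter_upwards [hlim.eventually_lt_const hδ] with f hf φ hφ
  rw [Seminorm.mem_ball_zero]
  refine lt_of_le_of_lt (hM _ _ ?_) hf
  rw [wickExtₗ_fn]
  refine hb _ _ (by positivity) (fun ζ => ?_) _ C hC0 (hC φ hφ)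
  refine ((f.isExt_entire hρ).norm_le_of_memE hρ hL (apply_nonneg _ f)
    (f.norm_mderiv_le ⟨L, hL⟩) ζ).trans ?_
  gcongr

/-- The extension of the Wick correspondence to `𝓔^ρ`. -/
noncomputable def wickExt (hℏ : 0 < ℏ) (hρ : 1 < ρ) (hρ' : ρ ≤ 2) (ς : ℝ) :
    ESpace (PQ n) ρ →L[ℂ] OpAlg n ρ (1 / (2 * ℏ)) where
  toLinearMap := wickExtₗ hℏ hρ hρ' ς
  cont := continuous_wickExtₗ hℏ hρ hρ' ς

theorem wickExt_fn (hℏ : 0 < ℏ) (hρ : 1 < ρ) (hρ' : ρ ≤ 2) (ς : ℝ) {f : ESpace (PQ n) ρ}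
    {F : (PQ n → ℂ) → ℂ} (hF : IsExt F f.fn) (φ : Ebar n ρ (1 / (2 * ℏ))) (z : Fin n → ℂ) :
    (wickExt hℏ hρ hρ' ς f φ).fn z = wop ℏ ς F φ.fn (star z) := by
  rw [hF.unique (f.isExt_entire hρ)]
  rfl

theorem extendsWick_wickExt (hℏ : 0 < ℏ) (hς : 0 < ς) (hρ : 1 < ρ) (hρ' : ρ ≤ 2) :
    ExtendsWick ℏ ς (wickExt (n := n) hℏ hρ hρ' ς) := by
  intro f hf φ
  obtain ⟨D, hD⟩ := φ.exists_fockBound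
  funext z
  have h := wickOp_eq_wop hℏ hς hρ hρ' hf (f.isExt_entire hρ) φ.differentiable_hol hD.hol z
  rw [φ.hol_star] at h
  rw [wickExt_fn hℏ hρ hρ' ς (f.isExt_entire hρ), h]

/-- Continuous extensions are unique, because `𝓦^ρ` is dense. -/
theorem eq_of_extendsWick (hρ : 1 < ρ) {A : ℝ} {J J' : ESpace (PQ n) ρ →L[ℂ] OpAlg n ρ A}
    (hJ : ExtendsWick ℏ ς J) (hJ' : ExtendsWick ℏ ς J') : J' = J := by
  refine ContinuousLinearMap.ext fun f => ContinuousLinearMap.ext fun φ => Ebar.ext fun z => ?_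
  have hc : ∀ T : ESpace (PQ n) ρ →L[ℂ] OpAlg n ρ A, Continuous fun f => (T f φ).fn z := fun T =>
    (Ebar.continuous_eval z).comp ((continuous_eval_const φ).comp T.continuous)
  set l : ESpace (PQ n) ρ →L[ℂ] ℂ :=
    { toFun := fun f => (J' f φ).fn z - (J f φ).fn z
      map_add' := fun f g => by
        have h : ∀ T : ESpace (PQ n) ρ →L[ℂ] OpAlg n ρ A,
          (T (f + g) φ).fn z = (T f φ).fn z + (T g φ).fn z := fun T => by rw [map_add]; rfl
        rw [h, h]
        ring
      map_smul' := fun c f => by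
        have h : ∀ T : ESpace (PQ n) ρ →L[ℂ] OpAlg n ρ A,
          (T (c • f) φ).fn z = c * (T f φ).fn z := fun T => by rw [map_smul]; rfl
        rw [h, h, RingHom.id_apply, smul_eq_mul]
        ring
      cont := (hc J').sub (hc J) } with hl
  have h := eq_zero_of_eq_zero_on_memW hρ l (fun g hg => by
    change (J' g φ).fn z - (J g φ).fn z = 0
    rw [hJ g hg φ, hJ' g hg φ, sub_self]) f
  exact sub_eq_zero.1 h

/-- The star product has the integral `starInt` as its entire extension. -/
theorem isExt_wickStar (hℏ : 0 < ℏ) (hρ : 1 < ρ) (hρ' : ρ ≤ 2) (ς : ℝ) {F G : (PQ n → ℂ) → ℂ}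
    {f g : (PQ n → ℝ) → ℂ} (hFf : IsExt F f) (hF : MinType ρ F) (hGg : IsExt G g)
    (hG : MinType ρ G) : IsExt (starInt ℏ ς F G) (wickStar ℏ ς f g) := by
  have hρ0 : 0 < ρ := by linarith
  exact ⟨starInt_differentiable hℏ hρ0 hρ' ς hFf.1 hF hGg.1 hG, fun x =>
    (hasSum_wickTerm hℏ hρ0 hρ' ς hFf hF hGg hG x).tsum_eq.symm⟩

theorem wickStar_assoc (hℏ : 0 < ℏ) (hς : 0 < ς) (hρ : 1 < ρ) (hρ' : ρ ≤ 2)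
    (f g h : ESpace (PQ n) ρ) : wickStar ℏ ς (wickStar ℏ ς f.fn g.fn) h.fn =
      wickStar ℏ ς f.fn (wickStar ℏ ς g.fn h.fn) := by
  have hρ0 : 0 < ρ := by linarith
  have hf := f.isExt_entire hρ
  have hg := g.isExt_entire hρ
  have hh := h.isExt_entire hρ
  have hf' := f.minType_entire hρ
  have hg' := g.minType_entire hρ
  have hh' := h.minType_entire hρ
  have h1 := isExt_wickStar hℏ hρ hρ' ς (isExt_wickStar hℏ hρ hρ' ς hf hf' hg hg')
    (starInt_minType hℏ hρ0 hρ' ς hf' hg') hh hh'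
  have h2 := isExt_wickStar hℏ hρ hρ' ς hf hf' (isExt_wickStar hℏ hρ hρ' ς hg hg' hh hh')
    (starInt_minType hℏ hρ0 hρ' ς hg' hh')
  funext x
  obtain ⟨z, rfl⟩ := ofZ_surjective hς x
  rw [← h1.2, ← h2.2, toC_ofZ]
  exact starInt_assoc hℏ hρ0 hρ' ς hf.1 hf' hg.1 hg' hh.1 hh' z (star z)

theorem wickExt_mul (hℏ : 0 < ℏ) (hρ : 1 < ρ) (hρ' : ρ ≤ 2) (ς : ℝ) {f g h : ESpace (PQ n) ρ}
    (hfg : h.fn = wickStar ℏ ς f.fn g.fn) : wickExt hℏ hρ hρ' ς h =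
      wickExt hℏ hρ hρ' ς f * wickExt hℏ hρ hρ' ς g := by
  have hρ0 : 0 < ρ := by linarith
  have hf := f.isExt_entire hρ
  have hg := g.isExt_entire hρ
  have hf' := f.minType_entire hρ
  have hg' := g.minType_entire hρ
  have hh := isExt_wickStar hℏ hρ hρ' ς hf hf' hg hg'
  rw [← hfg] at hh
  refine ContinuousLinearMap.ext fun φ => Ebar.ext fun z => ?_
  obtain ⟨D, hD⟩ := φ.exists_fockBound
  rw [wickExt_fn hℏ hρ hρ' ς hh, mul_apply_eq_comp, wickExt_fn hℏ hρ hρ' ς hf,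
    ← wop_wop hℏ hρ0 hρ' ς hf.1 hf' hg.1 hg' φ.continuous_fn hD]
  rfl

theorem isExt_one {ι : Type*} [Fintype ι] : IsExt (ι := ι) (fun _ => 1) fun _ => 1 :=
  ⟨differentiable_const 1, fun _ => rfl⟩

theorem memE_one {ι : Type*} [Fintype ι] [DecidableEq ι] (hρ : 1 < ρ) :
    MemE (ι := ι) ρ fun _ => 1 :=
  isExt_one.memE hρ fun ε hε => ⟨1, zero_le_one, fun ζ => by
    rw [norm_one, one_mul, Real.one_le_exp_iff]
    positivity⟩

theorem wickExt_one (hℏ : 0 < ℏ) (hρ : 1 < ρ) (hρ' : ρ ≤ 2) (ς : ℝ) {u : ESpace (PQ n) ρ}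
    (hu : u.fn = fun _ => 1) : wickExt hℏ hρ hρ' ς u = 1 := by
  refine ContinuousLinearMap.ext fun φ => Ebar.ext fun z => ?_
  obtain ⟨D, hD⟩ := φ.exists_fockBound
  have h := wop_one hℏ ς φ.differentiable_hol hD.hol (star z)
  rw [φ.hol_star, Ebar.hol, star_star] at h
  rw [wickExt_fn hℏ hρ hρ' ς (F := fun _ => 1) (by rw [hu]; exact isExt_one), h]
  rfl

end Extended

end WickFock

theorem corollary1 (n : ℕ) (ℏ ς ρ : ℝ) (hℏ : 0 < ℏ) (hς : 0 < ς) (hρ : 1 < ρ) (hρ' : ρ ≤ 2) :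
    -- the operators in question are operators in the Fock-Bargmann space
    (∀ φ : Ebar n ρ (1 / (2 * ℏ)), MemFock ℏ φ.fn) ∧
    -- the integrals defining the Wick correspondence converge absolutely
    (∀ f : (PQ n → ℝ) → ℂ, MemW ρ f → ∀ (φ : Ebar n ρ (1 / (2 * ℏ))) (z : Fin n → ℂ),
      Integrable (wickIntegrand ℏ ς f φ.fn z) (muC n)) ∧
    -- the Wick star product is well defined, associative and unital on the space
    (∀ (f g : ESpace (PQ n) ρ) (x : PQ n → ℝ), Summable (wickTerm ℏ ς f.fn g.fn · x)) ∧
    (∀ f g : ESpace (PQ n) ρ, ∃ h : ESpace (PQ n) ρ, h.fn = wickStar ℏ ς f.fn g.fn) ∧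
    (∀ f g h : ESpace (PQ n) ρ, wickStar ℏ ς (wickStar ℏ ς f.fn g.fn) h.fn =
      wickStar ℏ ς f.fn (wickStar ℏ ς g.fn h.fn)) ∧
    (∃ u : ESpace (PQ n) ρ, u.fn = fun _ => 1) ∧
    -- existence of an extension to a continuous unital algebra homomorphism, and its uniqueness
    -- even among all continuous linear extensions
    ∃ J : ESpace (PQ n) ρ →L[ℂ] OpAlg n ρ (1 / (2 * ℏ)),
      ExtendsWick ℏ ς J ∧
      (∀ f g h : ESpace (PQ n) ρ, h.fn = wickStar ℏ ς f.fn g.fn → J h = J f * J g) ∧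
      (∀ u : ESpace (PQ n) ρ, (u.fn = fun _ => 1) → J u = 1) ∧
      ∀ J' : ESpace (PQ n) ρ →L[ℂ] OpAlg n ρ (1 / (2 * ℏ)), ExtendsWick ℏ ς J' → J' = J := by
  have hρ0 : 0 < ρ := by linarith
  refine ⟨fun φ => MemEbar.memFock hℏ hρ φ.2, fun f hf φ z => ?_, fun f g x => ?_, fun f g => ?_,
    wickStar_assoc hℏ hς hρ hρ', ⟨⟨_, memE_one hρ⟩, rfl⟩, wickExt hℏ hρ hρ' ς,
    extendsWick_wickExt hℏ hς hρ hρ', fun f g h => wickExt_mul hℏ hρ hρ' ς,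
    fun u => wickExt_one hℏ hρ hρ' ς,
    fun J' => eq_of_extendsWick hρ (extendsWick_wickExt hℏ hς hρ hρ')⟩
  · obtain ⟨F, hF, -⟩ := hf.memE.exists_isExt hρ
    obtain ⟨D, hD⟩ := φ.exists_fockBound
    exact integrable_wickIntegrand hℏ hς hρ hρ' hf hF φ.continuous_fn hD z
  · exact (hasSum_wickTerm hℏ hρ0 hρ' ς (f.isExt_entire hρ) (f.minType_entire hρ)
      (g.isExt_entire hρ) (g.minType_entire hρ) x).summable
  · have h := isExt_wickStar hℏ hρ hρ' ς (f.isExt_entire hρ) (f.minType_entire hρ)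
      (g.isExt_entire hρ) (g.minType_entire hρ)
    exact ⟨⟨_, h.memE hρ (starInt_minType hℏ hρ0 hρ' ς (f.minType_entire hρ)
      (g.minType_entire hρ))⟩, rfl⟩
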